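/- Let $d\ge 1$, $n\in\mathbb N$, $1<p<\infty$, $\frac1p+\frac1{p'}=1$, and write $|\cdot|$ for the Euclidean norm on $\mathbb C^n$ and $\|\cdot\|$ for the operator norm of matrices. Cubes have sides parallel to the axes, and dyadic cubes are half-open. A dyadic grid $\mathcal D$ in $\mathbb R^d$ is a family of cubes $I$ with side lengths $2^k$, $k\in\mathbb Z$, such that for each $k$ the cubes of side $2^k$ partition $\mathbb R^d$ and any two cubes of $\mathcal D$ are disjoint or nested. For an interval $I$ put $h_I^1=|I|^{-1/2}\chi_I$ and $h_I^0=|I|^{-1/2}(\chi_{I_\ell}-\chi_{I_r})$, where $I_\ell, I_r$ are the left and right halves of $I$. For a cube $I=I_1\times\cdots\times I_d$ and $\varepsilon\in\{0,1\}^d$ put $h_I^\varepsilon(x)=\prod_{i=1}^d h_{I_i}^{\varepsilon_i}(x_i)$. Let $\mathcal S=\{0,1\}^d\setminus\{(1,\dots,1)\}$, and for $\vec f:\mathbb R^d\to\mathbb C^n$ let $\vec f_I^{\,\varepsilon}=\int \vec f\,h_I^\varepsilon\,dx$. Let $W:\mathbb R^d\to M_n(\mathbb C)$ be measurable and positive definite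 almost everywhere, and put $$\|W\|_{A_p}=\sup_{I\text{ a cube}}\frac1{|I|}\int_I\Big(\frac1{|I|}\int_I\|W^{1/p}(x)W^{-1/p}(t)\|^{p'}\,dt\Big)^{p/p'}dx .$$ $W$ is a matrix $A_p$ weight if $\|W\|_{A_p}<\infty$. $L^p(W)$ is the space of measurable $\vec f:\mathbb R^d\to\mathbb C^n$ with $\|\vec f\|_{L^p(W)}=\big(\int|W^{1/p}(x)\vec f(x)|^p\,dx\big)^{1/p}<\infty$. Given $K>0$, a positive definite matrix $V_I$ is called a $K$-reducing matrix of $W$ on $I$ if for all $\vec e\in\mathbb C^n$ $$K^{-1}|V_I\vec e|\le\Big(\frac1{|I|}\int_I|W^{1/p}(x)\vec e|^p\,dx\Big)^{1/p}\le K|V_I\vec e| .$$ **Theorem.** For all $d,n,p,K$ as above there is a constant $C$, depending only on $d,n,p,K$, such that the following holds. Let $W$ be a matrix $A_p$ weight, $\mathcal D$ a dyadic grid in $\mathbb R^d$, and for each $I\in\mathcal D$ let $V_I$ be a $K$-reducing matrix of $W$ on $I$. Then every $\vec f\in L^p(W)$ is locally integrable (so that all $\vec f_I^{\,\varepsilon}$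 are well defined) and, with the square function $$S_W\vec f=\Big(\sum_{I\in\mathcal D}\sum_{\varepsilon\in\mathcal S}\frac{|V_I\vec f_I^{\,\varepsilon}|^2}{|I|}\chi_I\Big)^{1/2},$$ one has $$\|\vec f\|_{L^p(W)}\le C\,\|W\|_{A_p}^{\frac1p+\frac{\lceil p\rceil}p}\,\|S_W\vec f\|_{L^p} \qquad\text{and}\qquad \|S_W\vec f\|_{L^p}\le C\,\|W\|_{A_p}^{\frac2p+\frac{\lceil p'\rceil}p}\,\|\vec f\|_{L^p(W)} .$$ -/

import Mathlib

open MeasureTheory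
open scoped ENNReal NNReal ComplexOrder

namespace MatrixWeighted

noncomputable section

/-- An axis-parallel cube in `ℝ^d`, given by its lower corner and its side length. -/
@[ext]
structure Cube (d : ℕ) where
  corner : Fin d → ℝ
  side : ℝ
  side_pos : 0 < side

/-- The half-open cube `∏ i, [a i, a i + ℓ)` as a set of points. -/
def Cube.toSet {d : ℕ} (Q : Cube d) : Set (Fin d → ℝ) :=
  {x | ∀ i, x i ∈ Set.Ico (Q.corner i) (Q.corner i + Q.side)}

/-- A dyadic grid: all side lengths are powers of two, the cubes of each generation partition
`ℝ^d`, and any two cubes of the grid are disjoint or nested. -/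
structure IsDyadicGrid {d : ℕ} (𝒟 : Set (Cube d)) : Prop where
  side_eq : ∀ I ∈ 𝒟, ∃ k : ℤ, I.side = (2 : ℝ) ^ k
  partition : ∀ (k : ℤ) (x : Fin d → ℝ), ∃! I : Cube d,
    I ∈ 𝒟 ∧ I.side = (2 : ℝ) ^ k ∧ x ∈ I.toSet
  nested : ∀ I ∈ 𝒟, ∀ J ∈ 𝒟,
    Disjoint I.toSet J.toSet ∨ I.toSet ⊆ J.toSet ∨ J.toSet ⊆ I.toSet

/-- The one-dimensional Haar functions of the interval `[a, a + ℓ)`: for `ε = 1` it is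
`ℓ^{-1/2} χ_I`, for `ε = 0` it is `ℓ^{-1/2} (χ_{left half} - χ_{right half})`. -/
def haar₁ (a ℓ : ℝ) (ε : Fin 2) (t : ℝ) : ℝ :=
  ℓ ^ (-(1 / 2) : ℝ) *
    (if ε = 1 then (Set.Ico a (a + ℓ)).indicator 1 t
     else (Set.Ico a (a + ℓ / 2)).indicator 1 t - (Set.Ico (a + ℓ / 2) (a + ℓ)).indicator 1 t)

/-- The Haar function `h_I^ε = ∏ i, h_{I_i}^{ε_i}` of a cube `I`. -/
def haar {d : ℕ} (I : Cube d) (ε : Fin d → Fin 2) (x : Fin d → ℝ) : ℝ :=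
  ∏ i, haar₁ (I.corner i) I.side (ε i) (x i)

/-- The cancellative signatures `{0,1}^d \ {(1,…,1)}`. -/
abbrev Signature (d : ℕ) : Type := {ε : Fin d → Fin 2 // ε ≠ 1}

/-- The vector of Haar coefficients `f_I^ε = ∫ f h_I^ε`. -/
def haarCoeff {d n : ℕ} (f : (Fin d → ℝ) → EuclideanSpace ℂ (Fin n)) (I : Cube d)
    (ε : Fin d → Fin 2) : EuclideanSpace ℂ (Fin n) :=
  ∫ x, haar I ε x • f x

/-- The action of a matrix on `ℂ^n` with its Euclidean norm; the norm of the resulting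
continuous linear map is the usual operator norm of the matrix. -/
abbrev act {n : ℕ} (A : Matrix (Fin n) (Fin n) ℂ) :
    EuclideanSpace ℂ (Fin n) →L[ℂ] EuclideanSpace ℂ (Fin n) :=
  Matrix.toEuclideanCLM (n := Fin n) (𝕜 := ℂ) A

/-- The real power `A ^ r` of a positive definite matrix, by the functional calculus
(apply `t ↦ t ^ r` to the eigenvalues). -/
def matPow {n : ℕ} (A : Matrix (Fin n) (Fin n) ℂ) (r : ℝ) : Matrix (Fin n) (Fin n) ℂ :=
  cfc (fun t : ℝ => t ^ r) A

/-- The norm `‖f‖_{L^p(W)} = (∫ |W^{1/p}(x) f(x)|^p dx)^{1/p}`. -/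
def weightedNorm {d n : ℕ} (p : ℝ) (W : (Fin d → ℝ) → Matrix (Fin n) (Fin n) ℂ)
    (f : (Fin d → ℝ) → EuclideanSpace ℂ (Fin n)) : ℝ≥0∞ :=
  eLpNorm (fun x => act (matPow (W x) (1 / p)) (f x)) (ENNReal.ofReal p) volume

/-- `f ∈ L^p(W)`. -/
def MemWeightedLp {d n : ℕ} (p : ℝ) (W : (Fin d → ℝ) → Matrix (Fin n) (Fin n) ℂ)
    (f : (Fin d → ℝ) → EuclideanSpace ℂ (Fin n)) : Prop :=
  AEStronglyMeasurable f volume ∧ weightedNorm p W f < ∞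

/-- The matrix `A_p` characteristic
`sup_I ⨍_I (⨍_I ‖W^{1/p}(x) W^{-1/p}(t)‖^{p'} dt)^{p/p'} dx`, over all cubes `I`. -/
def apChar {d n : ℕ} (p : ℝ) (W : (Fin d → ℝ) → Matrix (Fin n) (Fin n) ℂ) : ℝ≥0∞ :=
  ⨆ I : Cube d, ⨍⁻ x in I.toSet,
    (⨍⁻ t in I.toSet,
      ‖act (matPow (W x) (1 / p) * matPow (W t) (-(1 / p)))‖ₑ ^ p.conjExponent ∂volume)
        ^ (p / p.conjExponent) ∂volume

/-- `W` is a matrix `A_p` weight: a measurable matrix function, positive definite almost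
everywhere, with finite `A_p` characteristic. -/
structure IsMatrixApWeight {d n : ℕ} (p : ℝ)
    (W : (Fin d → ℝ) → Matrix (Fin n) (Fin n) ℂ) : Prop where
  aemeasurable : ∀ i j, AEMeasurable (fun x => W x i j) volume
  posDef : ∀ᵐ x ∂volume, (W x).PosDef
  apChar_lt_top : apChar p W < ∞

/-- `V` is a reducing matrix of `W` on the cube `I`, with comparability constant `K`:
`V` is positive definite and `|V e|` is comparable to `|I|^{-1/p} ‖χ_I W^{1/p} e‖_{L^p}`. -/
def IsReducing {d n : ℕ} (K : ℝ≥0) (p : ℝ) (W : (Fin d → ℝ) → Matrix (Fin n) (Fin n) ℂ)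
    (I : Cube d) (V : Matrix (Fin n) (Fin n) ℂ) : Prop :=
  V.PosDef ∧ ∀ e : EuclideanSpace ℂ (Fin n),
    ‖act V e‖ₑ ≤ K * (⨍⁻ x in I.toSet, ‖act (matPow (W x) (1 / p)) e‖ₑ ^ p ∂volume) ^ (1 / p) ∧
    (⨍⁻ x in I.toSet, ‖act (matPow (W x) (1 / p)) e‖ₑ ^ p ∂volume) ^ (1 / p) ≤ K * ‖act V e‖ₑ

/-- The square function
`S_W f (x) = (∑_{I ∈ 𝒟} ∑_ε |V_I f_I^ε|² χ_I(x) / |I|)^{1/2}`. -/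
def squareFunction {d n : ℕ} (𝒟 : Set (Cube d)) (V : Cube d → Matrix (Fin n) (Fin n) ℂ)
    (f : (Fin d → ℝ) → EuclideanSpace ℂ (Fin n)) (x : Fin d → ℝ) : ℝ≥0∞ :=
  (∑' I : 𝒟, ∑ ε : Signature d,
    ‖act (V I) (haarCoeff f I ε)‖ₑ ^ 2 / volume (I : Cube d).toSet *
      (I : Cube d).toSet.indicator 1 x) ^ (1 / 2 : ℝ)

end

end MatrixWeighted

open MatrixWeighted

/-!
The weight enters only through the operators `R = W ^ (1 / p)`, `R' = W ^ (-1 / p)` and through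
the reducing operators, and both inequalities rest on one estimate for abstract operator
functions, proved under the hypotheses `LocalBounds`; its exponent is `q`, with dual exponent
`q'`.

*The local estimate* (`LocalBounds.lintegral_squareSum_le`). Below a cube `T` a stopping process
selects the first cubes `I` at which the operator `A I` is much larger than `A T`, or the average
of `|A T f|` is much larger than over `T`, or the unweighted square function of `A T f` has become
large. By Chebyshev's inequality and by Parseval's identity for a single cube
(`sum_enorm_haarCoeff_sq`) the selected cubes cover at most half of `T` (`volume_stoppedSet_le`).
Until the process stops, `|A I f_I| ≤ λ |A T f_I|`; hence the square function is dominated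
pointwise by the `ℓ²` sum of the averages `a_L` of `|A L f|` over the stopping cubes `L`
(`squareSum_le`). The scalar weights `‖A T R'‖ ^ q'` have the doubling property (`doubling` in
`LocalBounds`), so the stopping cubes below `L` carry at most the proportion `1 - 1 / γ` of their
mass, and the number `s` of stopping cubes has exponential moments of base `exp (1 / (2 γ))`.
Hölder's inequality with this exponential weight bounds `a_L ^ q |L|` by the integral over `L` of
`Q ^ s |R f| ^ q` with `Q < 1`, and the sum over the stopping cubes is a geometric series. In the
norm this costs a factor `γ` and no further power of the characteristic.

*The constants.* For the upper bound the estimate is used with `q = p` and the reducing operators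
themselves (`ReducingFamily.localBounds`); for the lower bound it is used with `q = p'`, the dual
weight and the inverses of the reducing operators (`ReducingFamily.localBounds_dual`). The one
non-trivial bound, for the averages of `‖R' V_I‖ ^ p'`, follows from the `A_p` condition by
testing it on a norming functional of `z ↦ ‖R' z‖_{L^{p'}(I)}`
(`ReducingFamily.lintegral_inv_apply_le`). The resulting exponents are `(1 + p') / p` and
`(1 + p) / p`; they may be raised to the stated ones because the characteristic is bounded below by a
constant (`ReducingFamily.one_le_mul_rpow`).

*Duality* (`ReducingFamily.setLIntegral_le_energySum`). For the lower bound, `R f` is paired with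
`|R f| ^ (p - 2) R f`, cut off to a set on which everything is bounded. Expanding the pairing
along the dyadic conditional expectations gives the sum of the pairings of the Haar coefficients
(`IsDyadicGrid.enorm_integral_inner_le`), which Cauchy–Schwarz bounds by the two square functions.
The upper bound removes the cut-off in the limit.
-/

namespace MatrixWeighted

/-! ### Cubes, their children and dyadic grids -/

namespace Cube

variable {d : ℕ}

/-- The child of a cube indexed by `η`: the left half is taken in direction `i` if `η i = 0`, the
right half if `η i = 1`. -/
@[simps]
noncomputable def child (I : Cube d) (η : Fin d → Fin 2) : Cube d where
  corner i := I.corner i + (η i : ℝ) * (I.side / 2)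
  side := I.side / 2
  side_pos := half_pos I.side_pos

/-- The index of the child of `I` which contains a given point of `I`. -/
noncomputable def childIdx (I : Cube d) (x : Fin d → ℝ) (i : Fin d) : Fin 2 :=
  if x i < I.corner i + I.side / 2 then 0 else 1

lemma toSet_eq_pi (I : Cube d) :
    I.toSet = Set.pi Set.univ fun i => Set.Ico (I.corner i) (I.corner i + I.side) := by
  ext x; simp [toSet]

lemma measurableSet_toSet (I : Cube d) : MeasurableSet I.toSet := by
  rw [toSet_eq_pi]
  exact MeasurableSet.univ_pi fun i => measurableSet_Ico

lemma volume_toSet (I : Cube d) : volume I.toSet = ENNReal.ofReal I.side ^ d := by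
  rw [toSet_eq_pi, Real.volume_pi_Ico]
  simp

lemma volume_toSet_eq_ofReal (I : Cube d) : volume I.toSet = ENNReal.ofReal (I.side ^ d) := by
  rw [volume_toSet, ENNReal.ofReal_pow I.side_pos.le]

lemma volume_toSet_ne_zero (I : Cube d) : volume I.toSet ≠ 0 := by
  rw [volume_toSet]
  exact pow_ne_zero _ (by simpa using I.side_pos)

lemma volume_toSet_ne_top (I : Cube d) : volume I.toSet ≠ ∞ := by
  rw [volume_toSet]
  exact ENNReal.pow_ne_top ENNReal.ofReal_ne_top

lemma volume_eq_two_pow_mul_volume_child (I : Cube d) (η : Fin d → Fin 2) :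
    volume I.toSet = 2 ^ d * volume (I.child η).toSet := by
  rw [volume_toSet, volume_toSet, ← mul_pow, child_side,
    show (2 : ℝ≥0∞) = ENNReal.ofReal 2 by simp, ← ENNReal.ofReal_mul (by norm_num)]
  congr 3; ring

lemma mem_child_iff (I : Cube d) (η : Fin d → Fin 2) (x : Fin d → ℝ) :
    x ∈ (I.child η).toSet ↔ x ∈ I.toSet ∧ I.childIdx x = η := by
  have hs := I.side_pos
  simp only [toSet, Set.mem_ofPred_eq, Set.mem_Ico, child_corner, child_side, funext_iff,
    ← forall_and, childIdx]
  refine forall_congr' fun i => ?_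
  generalize η i = e
  fin_cases e
  · simp only [Fin.zero_eta, Fin.isValue, Nat.cast_zero, zero_mul, add_zero]
    split_ifs with h
    · simp only [Fin.isValue, and_true]
      constructor <;> rintro ⟨h1, h2⟩ <;> constructor <;> linarith
    · simp only [Fin.isValue, one_ne_zero, and_false, iff_false, not_and]
      intro h1 h2; exact h h2
  · simp only [Fin.mk_one, Fin.isValue, Nat.cast_one, one_mul]
    split_ifs with h
    · simp only [Fin.isValue, zero_ne_one, and_false, iff_false, not_and]
      intro h1; linarith
    · simp only [Fin.isValue, and_true]
      constructor <;> rintro ⟨h1, h2⟩ <;> constructor <;> linarith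

lemma child_subset (I : Cube d) (η : Fin d → Fin 2) : (I.child η).toSet ⊆ I.toSet :=
  fun _ hx => ((I.mem_child_iff η _).1 hx).1

lemma mem_child_childIdx {I : Cube d} {x : Fin d → ℝ} (hx : x ∈ I.toSet) :
    x ∈ (I.child (I.childIdx x)).toSet := (I.mem_child_iff _ _).2 ⟨hx, rfl⟩

lemma childIdx_eq {I : Cube d} {η : Fin d → Fin 2} {x : Fin d → ℝ}
    (hx : x ∈ (I.child η).toSet) : I.childIdx x = η := ((I.mem_child_iff η _).1 hx).2

lemma iUnion_child (I : Cube d) : ⋃ η, (I.child η).toSet = I.toSet := by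
  ext x
  simp only [Set.mem_iUnion, mem_child_iff]
  exact ⟨fun ⟨_, h, _⟩ => h, fun h => ⟨_, h, rfl⟩⟩

lemma pairwise_disjoint_child (I : Cube d) :
    Pairwise (Function.onFun Disjoint fun η => (I.child η).toSet) := by
  intro η η' hne
  refine Set.disjoint_left.2 fun x hx hx' => hne ?_
  rw [← childIdx_eq hx, ← childIdx_eq hx']

lemma measurable_childIdx (I : Cube d) : Measurable I.childIdx := by
  refine measurable_pi_lambda _ fun i => ?_
  exact Measurable.ite (measurableSet_lt (measurable_pi_apply i) measurable_const)
    measurable_const measurable_const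

lemma lintegral_eq_sum_child (I : Cube d) (φ : (Fin d → ℝ) → ℝ≥0∞) :
    ∫⁻ x in I.toSet, φ x = ∑ η, ∫⁻ x in (I.child η).toSet, φ x := by
  rw [← I.iUnion_child, lintegral_iUnion (fun η => (I.child η).measurableSet_toSet)
    I.pairwise_disjoint_child, tsum_fintype]

lemma integral_eq_sum_child {E : Type*} [NormedAddCommGroup E] [NormedSpace ℝ E] (I : Cube d)
    {φ : (Fin d → ℝ) → E} (hφ : IntegrableOn φ I.toSet) :
    ∫ x in I.toSet, φ x = ∑ η, ∫ x in (I.child η).toSet, φ x := by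
  rw [← I.iUnion_child, integral_iUnion_fintype (fun η => (I.child η).measurableSet_toSet)
    I.pairwise_disjoint_child]
  exact fun η => hφ.mono_set (I.child_subset η)

lemma sum_volume_child (I : Cube d) :
    ∑ η, volume (I.child η).toSet = volume I.toSet := by
  simpa using (I.lintegral_eq_sum_child 1).symm

lemma corner_mem (I : Cube d) : I.corner ∈ I.toSet := fun i =>
  ⟨le_rfl, by linarith [I.side_pos]⟩

end Cube

namespace IsDyadicGrid

variable {d : ℕ} {𝒟 : Set (Cube d)}

lemma eq_of_mem (h𝒟 : IsDyadicGrid 𝒟) {I J : Cube d} (hI : I ∈ 𝒟) (hJ : J ∈ 𝒟)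
    (hs : I.side = J.side) {x : Fin d → ℝ} (hxI : x ∈ I.toSet) (hxJ : x ∈ J.toSet) : I = J := by
  obtain ⟨k, hk⟩ := h𝒟.side_eq I hI
  exact (h𝒟.partition k x).unique ⟨hI, hk, hxI⟩ ⟨hJ, hs ▸ hk, hxJ⟩

/-- A cube of half the side length which meets a cube of the grid is contained in it. -/
lemma subset_of_mem (h𝒟 : IsDyadicGrid 𝒟) (hd : 0 < d) {I J : Cube d} (hI : I ∈ 𝒟) (hJ : J ∈ 𝒟)
    (hs : J.side < I.side) {x : Fin d → ℝ} (hxI : x ∈ I.toSet) (hxJ : x ∈ J.toSet) :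
    J.toSet ⊆ I.toSet := by
  rcases h𝒟.nested I hI J hJ with h | h | h
  · exact absurd hxJ (Set.disjoint_left.1 h hxI)
  · exfalso
    have h1 := measure_mono (μ := volume) h
    rw [Cube.volume_toSet_eq_ofReal, Cube.volume_toSet_eq_ofReal,
      ENNReal.ofReal_le_ofReal_iff (pow_nonneg J.side_pos.le _)] at h1
    exact absurd h1 (not_le.2 (pow_lt_pow_left₀ hs J.side_pos.le hd.ne'))
  · exact h

/-- The grid contains the `2 ^ d` standard children of each of its cubes. The positions of the
cubes of the next generation inside `I` are not prescribed by the definition; the cube at the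
corner `η` is pinned down by induction on the number of right halves in `η`. -/
lemma child_mem (h𝒟 : IsDyadicGrid 𝒟) (hd : 0 < d) {I : Cube d} (hI : I ∈ 𝒟)
    (η : Fin d → Fin 2) : I.child η ∈ 𝒟 := by
  obtain ⟨k, hk⟩ := h𝒟.side_eq I hI
  have hs := I.side_pos
  induction hm : (Finset.univ.filter fun i => η i = 1).card using Nat.strong_induction_on
    generalizing η with
  | _ m ih =>
    have hcI : (I.child η).corner ∈ I.toSet := I.child_subset η (I.child η).corner_mem
    obtain ⟨J, ⟨hJ, hJs, hxJ⟩, -⟩ := h𝒟.partition (k - 1) (I.child η).corner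
    have hside : J.side = I.side / 2 := by
      rw [hJs, hk, zpow_sub_one₀ (by norm_num)]; rfl
    have hsub : J.toSet ⊆ I.toSet :=
      h𝒟.subset_of_mem hd hI hJ (by linarith) hcI hxJ
    have hlow : ∀ i, I.corner i ≤ J.corner i := fun i => (hsub J.corner_mem i).1
    suffices hcorner : J.corner = (I.child η).corner by
      have : J = I.child η := Cube.ext hcorner hside
      rwa [← this]
    funext i
    have hJi := hxJ i
    simp only [Cube.child_corner, Set.mem_Ico] at hJi ⊢
    have hη : η i = 0 ∨ η i = 1 := by omega
    rcases hη with h0 | h1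
    · rw [h0] at hJi ⊢
      have := hlow i
      simp only [Fin.isValue, Fin.val_zero, Nat.cast_zero, zero_mul, add_zero] at hJi ⊢
      linarith
    · refine le_antisymm hJi.1 ?_
      by_contra! hlt
      -- otherwise `J` meets the child on the left of `η` in direction `i`
      set η' := Function.update η i 0 with hη'
      have hη'lt : (Finset.univ.filter fun j => η' j = 1).card < m := by
        rw [← hm]
        refine Finset.card_lt_card ⟨fun j hj => ?_, fun hcon => ?_⟩
        · simp only [Finset.mem_filter, Finset.mem_univ, true_and] at hj ⊢
          by_cases hji : j = i
          · subst hji; exact h1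
          · rwa [hη', Function.update_of_ne hji] at hj
        · have := hcon (Finset.mem_filter.2 ⟨Finset.mem_univ i, h1⟩)
          simp [hη'] at this
      have hmem := ih _ hη'lt η' rfl
      set y := Function.update (I.child η).corner i (J.corner i) with hy
      have hyJ : y ∈ J.toSet := fun j => by
        by_cases hji : j = i
        · subst hji; simpa [hy] using J.side_pos
        · rw [hy, Function.update_of_ne hji]; exact hxJ j
      have hyI : y ∈ (I.child η').toSet := fun j => by
        by_cases hji : j = i
        · subst hji
          have := hlow j
          rw [h1] at hlt
          simp only [hy, Function.update_self, Cube.child_corner, hη', Fin.isValue, Fin.val_zero,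
            Nat.cast_zero, zero_mul, add_zero, Cube.child_side, Set.mem_Ico, this, true_and]
          simp only [Fin.isValue, Fin.val_one, Nat.cast_one, one_mul] at hlt
          linarith
        · have := (I.child η).corner_mem j
          simpa [hy, hη', Function.update_of_ne hji] using hs
      have heq := h𝒟.eq_of_mem hJ hmem (by rw [hside]; rfl) hyJ hyI
      have := (hxJ i).2
      rw [heq] at this
      simp [hη', h1] at this

end IsDyadicGrid

/-! ### Parseval's identity for the Haar coefficients of one cube -/

/-- The sign of the Haar function of signature `e` on the left (`h = 0`) or right (`h = 1`) half of
an interval. -/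
def haarSign (e h : Fin 2) : ℝ := if e = 1 then 1 else if h = 0 then 1 else -1

/-- The sign of the Haar function `h_I^ε` on the child of `I` with index `η`. -/
def walsh {d : ℕ} (ε η : Fin d → Fin 2) : ℝ := ∏ i, haarSign (ε i) (η i)

lemma walsh_one {d : ℕ} (η : Fin d → Fin 2) : walsh 1 η = 1 := by simp [walsh, haarSign]

/-- The Walsh functions are orthogonal: the rows of the matrix `walsh` are products of rows of
`2 × 2` Hadamard matrices. -/
lemma sum_walsh_mul_walsh {d : ℕ} (η η' : Fin d → Fin 2) :
    ∑ ε, walsh ε η * walsh ε η' = if η = η' then 2 ^ d else 0 := by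
  have h1 : ∀ h h' : Fin 2, ∑ e, haarSign e h * haarSign e h' = if h = h' then 2 else 0 := by
    intro h h'
    fin_cases h <;> fin_cases h' <;> norm_num [haarSign]
  calc ∑ ε, walsh ε η * walsh ε η'
      = ∑ ε : Fin d → Fin 2, ∏ i, haarSign (ε i) (η i) * haarSign (ε i) (η' i) := by
        simp_rw [walsh, Finset.prod_mul_distrib]
    _ = ∏ i, ∑ e, haarSign e (η i) * haarSign e (η' i) := by
        rw [Finset.prod_univ_sum, Fintype.piFinset_univ]
    _ = if η = η' then 2 ^ d else 0 := by
        simp_rw [h1]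
        split_ifs with h
        · subst h; simp
        · obtain ⟨i, hi⟩ := Function.ne_iff.1 h
          exact Finset.prod_eq_zero (Finset.mem_univ i) (if_neg hi)

lemma sum_inner_walsh {d : ℕ} {E : Type*} [NormedAddCommGroup E] [InnerProductSpace ℂ E]
    (a b : (Fin d → Fin 2) → E) :
    ∑ ε, inner ℂ (∑ η, (walsh ε η : ℂ) • a η) (∑ η, (walsh ε η : ℂ) • b η)
      = 2 ^ d * ∑ η, inner ℂ (a η) (b η) := by
  calc ∑ ε, inner ℂ (∑ η, (walsh ε η : ℂ) • a η) (∑ η, (walsh ε η : ℂ) • b η)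
      = ∑ η', ∑ η, ((∑ ε, walsh ε η * walsh ε η' : ℝ) : ℂ) * inner ℂ (a η) (b η') := by
        simp_rw [inner_sum, sum_inner, inner_smul_left, inner_smul_right, Complex.conj_ofReal,
          ← mul_assoc, ← Complex.ofReal_mul]
        rw [Finset.sum_comm]
        refine Finset.sum_congr rfl fun η' _ => ?_
        rw [Finset.sum_comm]
        refine Finset.sum_congr rfl fun η _ => ?_
        rw [Complex.ofReal_sum, Finset.sum_mul]
    _ = _ := by
        simp_rw [sum_walsh_mul_walsh]
        rw [Finset.mul_sum]
        refine Finset.sum_congr rfl fun η' _ => ?_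
        rw [Finset.sum_eq_single η' (fun η _ h => by simp [h]) (by simp)]
        simp

/-- The constant value `|I|^{-1/2}` of the modulus of the Haar functions of `I`. -/
noncomputable def haarHeight {d : ℕ} (I : Cube d) : ℝ := (I.side ^ (-(1 / 2) : ℝ)) ^ d

lemma haarHeight_sq {d : ℕ} (I : Cube d) : haarHeight I ^ 2 = (volume.real I.toSet)⁻¹ := by
  rw [measureReal_def, Cube.volume_toSet_eq_ofReal,
    ENNReal.toReal_ofReal (pow_nonneg I.side_pos.le _), haarHeight, ← pow_mul, mul_comm d 2,
    pow_mul, ← inv_pow, ← Real.rpow_neg_one I.side, ← Real.rpow_mul_natCast I.side_pos.le]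
  norm_num

lemma haar_eq_indicator {d : ℕ} (I : Cube d) (ε : Fin d → Fin 2) (x : Fin d → ℝ) :
    haar I ε x = I.toSet.indicator (fun x => haarHeight I * walsh ε (I.childIdx x)) x := by
  have hs := I.side_pos
  by_cases hx : x ∈ I.toSet
  · rw [Set.indicator_of_mem hx, haar, haarHeight, walsh,
      ← Fin.prod_const d, ← Finset.prod_mul_distrib]
    refine Finset.prod_congr rfl fun i _ => ?_
    obtain ⟨h1, h2⟩ := hx i
    rw [haar₁, haarSign, Cube.childIdx]
    congr 1
    by_cases he : ε i = 1
    · simp [he, h1, h2]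
    · by_cases hl : x i < I.corner i + I.side / 2
      · simp [he, h1, hl]
      · simp [he, hl, h2, not_lt.1 hl]
  · rw [Set.indicator_of_notMem hx, haar]
    simp only [Cube.toSet, Set.mem_ofPred_eq, not_forall] at hx
    obtain ⟨i, hi⟩ := hx
    refine Finset.prod_eq_zero (Finset.mem_univ i) ?_
    have h1 : x i ∉ Set.Ico (I.corner i) (I.corner i + I.side / 2) :=
      fun h => hi ⟨h.1, h.2.trans (by linarith)⟩
    have h2 : x i ∉ Set.Ico (I.corner i + I.side / 2) (I.corner i + I.side) :=
      fun h => hi ⟨by linarith [h.1], h.2⟩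
    simp [haar₁, hi, h1, h2]

section

variable {d n : ℕ} {f g : (Fin d → ℝ) → EuclideanSpace ℂ (Fin n)} {I : Cube d}

lemma haarCoeff_eq_sum (hf : IntegrableOn f I.toSet) (ε : Fin d → Fin 2) :
    haarCoeff f I ε
      = (haarHeight I : ℂ) • ∑ η, (walsh ε η : ℂ) • ∫ x in (I.child η).toSet, f x := by
  have h1 : ∀ η, Set.EqOn (fun x => (haarHeight I * walsh ε (I.childIdx x)) • f x)
      (fun x => (haarHeight I * walsh ε η) • f x) (I.child η).toSet := fun η x hx => by
    simp only [Cube.childIdx_eq hx]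
  have h2 : IntegrableOn (fun x => (haarHeight I * walsh ε (I.childIdx x)) • f x) I.toSet := by
    rw [← I.iUnion_child, integrableOn_finite_iUnion]
    intro η
    rw [integrableOn_congr_fun (h1 η) (I.child η).measurableSet_toSet]
    exact (hf.mono_set (I.child_subset η)).smul (haarHeight I * walsh ε η)
  calc haarCoeff f I ε
      = ∫ x in I.toSet, (haarHeight I * walsh ε (I.childIdx x)) • f x := by
        rw [haarCoeff, ← integral_indicator I.measurableSet_toSet]
        congr 1; ext1 x
        rw [haar_eq_indicator]
        by_cases hx : x ∈ I.toSet <;> simp [hx]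
    _ = ∑ η, ∫ x in (I.child η).toSet, (haarHeight I * walsh ε η) • f x := by
        rw [I.integral_eq_sum_child h2]
        exact Finset.sum_congr rfl fun η _ =>
          setIntegral_congr_fun (I.child η).measurableSet_toSet (h1 η)
    _ = _ := by
        rw [Finset.smul_sum]
        refine Finset.sum_congr rfl fun η _ => ?_
        rw [integral_smul, smul_smul, ← Complex.ofReal_mul]
        exact (Complex.coe_smul _ _).symm

/-- Polarized Parseval identity for one cube: the Haar coefficients of `I` carry the difference of
the averaged pairings over the children of `I` and over `I`. -/
lemma sum_inner_haarCoeff (hf : IntegrableOn f I.toSet) (hg : IntegrableOn g I.toSet) :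
    ∑ ε : Signature d, inner ℂ (haarCoeff f I ε) (haarCoeff g I ε)
      + ((volume.real I.toSet)⁻¹ : ℂ) * inner ℂ (∫ x in I.toSet, f x) (∫ x in I.toSet, g x)
    = ∑ η, ((volume.real (I.child η).toSet)⁻¹ : ℂ) *
        inner ℂ (∫ x in (I.child η).toSet, f x) (∫ x in (I.child η).toSet, g x) := by
  have hone : haarCoeff f I 1 = (haarHeight I : ℂ) • ∫ x in I.toSet, f x := by
    rw [haarCoeff_eq_sum hf, I.integral_eq_sum_child hf]; simp [walsh_one]
  have hone' : haarCoeff g I 1 = (haarHeight I : ℂ) • ∫ x in I.toSet, g x := by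
    rw [haarCoeff_eq_sum hg, I.integral_eq_sum_child hg]; simp [walsh_one]
  have hvol : ∀ η, ((volume.real (I.child η).toSet)⁻¹ : ℂ) = 2 ^ d * (haarHeight I : ℂ) ^ 2 := by
    intro η
    rw [← Complex.ofReal_pow, haarHeight_sq, measureReal_def, measureReal_def,
      I.volume_eq_two_pow_mul_volume_child η, ENNReal.toReal_mul]
    simp only [ENNReal.toReal_pow, ENNReal.toReal_ofNat, mul_inv, Complex.ofReal_mul,
      Complex.ofReal_inv, Complex.ofReal_pow, Complex.ofReal_ofNat]
    rw [mul_inv_cancel_left₀ (by simp)]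
  have hall : ∑ ε, inner ℂ (haarCoeff f I ε) (haarCoeff g I ε)
      = ∑ ε : Signature d, inner ℂ (haarCoeff f I ε) (haarCoeff g I ε)
        + inner ℂ (haarCoeff f I 1) (haarCoeff g I 1) := by
    rw [← Finset.sum_erase_add _ _ (Finset.mem_univ (1 : Fin d → Fin 2))]
    congr 1
    exact Finset.sum_subtype _ (by simp) _
  have hI : ((volume.real I.toSet)⁻¹ : ℂ) * inner ℂ (∫ x in I.toSet, f x) (∫ x in I.toSet, g x)
      = inner ℂ (haarCoeff f I 1) (haarCoeff g I 1) := by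
    rw [hone, hone', inner_smul_left, inner_smul_right, Complex.conj_ofReal, ← mul_assoc, ← sq,
      ← Complex.ofReal_pow, haarHeight_sq, Complex.ofReal_inv]
  rw [hI, ← hall]
  simp_rw [haarCoeff_eq_sum hf, haarCoeff_eq_sum hg, inner_smul_left, inner_smul_right,
    Complex.conj_ofReal, ← mul_assoc, hvol]
  rw [← Finset.mul_sum, sum_inner_walsh, ← Finset.mul_sum]
  ring

/-- Parseval identity for one cube. -/
lemma sum_enorm_haarCoeff_sq (hf : IntegrableOn f I.toSet) :
    ∑ ε : Signature d, ‖haarCoeff f I ε‖ₑ ^ 2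
      + ‖∫ x in I.toSet, f x‖ₑ ^ 2 / volume I.toSet
    = ∑ η, ‖∫ x in (I.child η).toSet, f x‖ₑ ^ 2 / volume (I.child η).toSet := by
  have key : ∀ (v : EuclideanSpace ℂ (Fin n)) (J : Cube d),
      ‖v‖ₑ ^ 2 / volume J.toSet = ENNReal.ofReal ((volume.real J.toSet)⁻¹ * ‖v‖ ^ 2) := by
    intro v J
    rw [ENNReal.ofReal_mul (by positivity), ENNReal.ofReal_pow (norm_nonneg _), ofReal_norm,
      ENNReal.ofReal_inv_of_pos, measureReal_def, ENNReal.ofReal_toReal J.volume_toSet_ne_top,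
      ENNReal.div_eq_inv_mul]
    exact ENNReal.toReal_pos J.volume_toSet_ne_zero J.volume_toSet_ne_top
  have h := sum_inner_haarCoeff hf hf
  simp_rw [inner_self_eq_norm_sq_to_K] at h
  have h' : ∑ ε : Signature d, ‖haarCoeff f I ε‖ ^ 2
      + (volume.real I.toSet)⁻¹ * ‖∫ x in I.toSet, f x‖ ^ 2
    = ∑ η, (volume.real (I.child η).toSet)⁻¹ * ‖∫ x in (I.child η).toSet, f x‖ ^ 2 := by
    apply Complex.ofReal_injective
    push_cast
    exact h
  simp_rw [key]
  rw [← ENNReal.ofReal_sum_of_nonneg (fun _ _ => by positivity), ← h',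
    ENNReal.ofReal_add (Finset.sum_nonneg fun _ _ => by positivity) (by positivity),
    ENNReal.ofReal_sum_of_nonneg (fun _ _ => by positivity)]
  congr 1
  exact Finset.sum_congr rfl fun ε _ => by
    rw [ENNReal.ofReal_pow (norm_nonneg _), ofReal_norm]

end

/-! ### Stopping cubes -/

section Stopping

variable {d : ℕ} (halt : Cube d → ℝ≥0∞ → Cube d → Prop) (inc : Cube d → Cube d → ℝ≥0∞)

open scoped Classical in
/-- The number of stopping cubes at `x` in the `N` generations below the cube `I`. The state of the
process is `(T, b, I)`: the last stopping cube `T`, a partial sum `b` accumulated since then, and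
the current cube `I`. Passing from `I` to a child `I'` adds `inc T I` to `b`; if the new state
satisfies `halt`, the process restarts from the state `(I', 0, I')`. -/
noncomputable def stopCount :
    ℕ → Cube d → ℝ≥0∞ → Cube d → (Fin d → ℝ) → ℕ
  | 0, _, _, _ => fun _ => 0
  | N + 1, T, b, I => fun x =>
      if halt T (b + inc T I) (I.child (I.childIdx x)) then
        stopCount N (I.child (I.childIdx x)) 0 (I.child (I.childIdx x)) x + 1
      else stopCount N T (b + inc T I) (I.child (I.childIdx x)) x

open scoped Classical in
/-- The sum of `w s L` over the stopping cubes `L ∋ x` in the `N` generations below `I`, where `s`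
is the number of stopping cubes below `L` at `x`. The states are those of `stopCount`. -/
noncomputable def stopSum (w : ℕ → Cube d → ℝ≥0∞) :
    ℕ → Cube d → ℝ≥0∞ → Cube d → (Fin d → ℝ) → ℝ≥0∞
  | 0, _, _, _ => fun _ => 0
  | N + 1, T, b, I => fun x =>
      if halt T (b + inc T I) (I.child (I.childIdx x)) then
        w (stopCount halt inc N (I.child (I.childIdx x)) 0 (I.child (I.childIdx x)) x)
            (I.child (I.childIdx x))
          + stopSum w N (I.child (I.childIdx x)) 0 (I.child (I.childIdx x)) x
      else stopSum w N T (b + inc T I) (I.child (I.childIdx x)) x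

open scoped Classical in
/-- The union of the first stopping cubes in the `N` generations below `I`. The states are those of
`stopCount`. -/
noncomputable def stoppedSet : ℕ → Cube d → ℝ≥0∞ → Cube d → Set (Fin d → ℝ)
  | 0, _, _, _ => ∅
  | N + 1, T, b, I => ⋃ η,
      if halt T (b + inc T I) (I.child η) then (I.child η).toSet
      else stoppedSet N T (b + inc T I) (I.child η)

variable {halt inc} {N : ℕ} {T I : Cube d} {b : ℝ≥0∞} {η : Fin d → Fin 2} {x : Fin d → ℝ}
  {w : ℕ → Cube d → ℝ≥0∞}

lemma stopCount_succ_of_stop (hs : halt T (b + inc T I) (I.child η))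
    (hx : x ∈ (I.child η).toSet) :
    stopCount halt inc (N + 1) T b I x
      = stopCount halt inc N (I.child η) 0 (I.child η) x + 1 := by
  obtain rfl := Cube.childIdx_eq hx
  exact if_pos hs

lemma stopCount_succ_of_not_stop (hs : ¬ halt T (b + inc T I) (I.child η))
    (hx : x ∈ (I.child η).toSet) :
    stopCount halt inc (N + 1) T b I x = stopCount halt inc N T (b + inc T I) (I.child η) x := by
  obtain rfl := Cube.childIdx_eq hx
  exact if_neg hs

lemma stopSum_succ_of_stop (hs : halt T (b + inc T I) (I.child η))
    (hx : x ∈ (I.child η).toSet) :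
    stopSum halt inc w (N + 1) T b I x
      = w (stopCount halt inc N (I.child η) 0 (I.child η) x) (I.child η)
        + stopSum halt inc w N (I.child η) 0 (I.child η) x := by
  obtain rfl := Cube.childIdx_eq hx
  exact if_pos hs

lemma stopSum_succ_of_not_stop (hs : ¬ halt T (b + inc T I) (I.child η))
    (hx : x ∈ (I.child η).toSet) :
    stopSum halt inc w (N + 1) T b I x = stopSum halt inc w N T (b + inc T I) (I.child η) x := by
  obtain rfl := Cube.childIdx_eq hx
  exact if_neg hs

lemma measurable_comp_childIdx {β : Type*} [MeasurableSpace β] (I : Cube d)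
    {F : (Fin d → Fin 2) → (Fin d → ℝ) → β} (hF : ∀ η, Measurable (F η)) :
    Measurable fun x => F (I.childIdx x) x :=
  (measurable_from_prod_countable_right (f := fun p : (Fin d → Fin 2) × (Fin d → ℝ) => F p.1 p.2)
    hF).comp (I.measurable_childIdx.prodMk measurable_id)

variable (halt inc)

lemma measurable_stopCount (N : ℕ) (T : Cube d) (b : ℝ≥0∞) (I : Cube d) :
    Measurable (stopCount halt inc N T b I) := by
  classical
  induction N generalizing T b I with
  | zero => exact measurable_const
  | succ N ih =>
    refine measurable_comp_childIdx I (F := fun η x => if halt T (b + inc T I) (I.child η) then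
        stopCount halt inc N (I.child η) 0 (I.child η) x + 1
      else stopCount halt inc N T (b + inc T I) (I.child η) x) fun η => ?_
    split_ifs
    · exact (ih _ _ _).add_const 1
    · exact ih _ _ _

lemma measurable_stopSum (w : ℕ → Cube d → ℝ≥0∞) (N : ℕ) (T : Cube d) (b : ℝ≥0∞) (I : Cube d) :
    Measurable (stopSum halt inc w N T b I) := by
  classical
  induction N generalizing T b I with
  | zero => exact measurable_const
  | succ N ih =>
    refine measurable_comp_childIdx I (F := fun η x => if halt T (b + inc T I) (I.child η) then
        w (stopCount halt inc N (I.child η) 0 (I.child η) x) (I.child η)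
          + stopSum halt inc w N (I.child η) 0 (I.child η) x
      else stopSum halt inc w N T (b + inc T I) (I.child η) x) fun η => ?_
    split_ifs
    · exact ((measurable_from_top (f := fun s => w s (I.child η))).comp
        (measurable_stopCount halt inc _ _ _ _)).add (ih _ _ _)
    · exact ih _ _ _

lemma stoppedSet_subset (N : ℕ) (T : Cube d) (b : ℝ≥0∞) (I : Cube d) :
    stoppedSet halt inc N T b I ⊆ I.toSet := by
  induction N generalizing T b I with
  | zero => exact Set.empty_subset _
  | succ N ih =>
    refine Set.iUnion_subset fun η => ?_
    split_ifs
    · exact I.child_subset η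
    · exact (ih _ _ _).trans (I.child_subset η)

lemma measurableSet_stoppedSet (N : ℕ) (T : Cube d) (b : ℝ≥0∞) (I : Cube d) :
    MeasurableSet (stoppedSet halt inc N T b I) := by
  induction N generalizing T b I with
  | zero => exact MeasurableSet.empty
  | succ N ih =>
    refine MeasurableSet.iUnion fun η => ?_
    split_ifs
    · exact (I.child η).measurableSet_toSet
    · exact ih _ _ _

open scoped Classical in
lemma lintegral_stoppedSet_succ (v : (Fin d → ℝ) → ℝ≥0∞) (N : ℕ) (T : Cube d) (b : ℝ≥0∞)
    (I : Cube d) :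
    ∫⁻ x in stoppedSet halt inc (N + 1) T b I, v x
      = ∑ η, if halt T (b + inc T I) (I.child η) then ∫⁻ x in (I.child η).toSet, v x
          else ∫⁻ x in stoppedSet halt inc N T (b + inc T I) (I.child η), v x := by
  have hsub : ∀ η, (if halt T (b + inc T I) (I.child η) then (I.child η).toSet
      else stoppedSet halt inc N T (b + inc T I) (I.child η)) ⊆ (I.child η).toSet := by
    intro η
    split_ifs
    · exact le_rfl
    · exact stoppedSet_subset halt inc _ _ _ _
  rw [stoppedSet, lintegral_iUnion, tsum_fintype]
  · refine Finset.sum_congr rfl fun η _ => ?_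
    split_ifs <;> rfl
  · intro η
    split_ifs
    · exact (I.child η).measurableSet_toSet
    · exact measurableSet_stoppedSet halt inc _ _ _ _
  · exact fun η η' hne => (I.pairwise_disjoint_child hne).mono (hsub η) (hsub η')

variable {𝒟 : Set (Cube d)} (h𝒟 : ∀ I ∈ 𝒟, ∀ η, I.child η ∈ 𝒟)

include h𝒟 in
/-- If the first stopping cubes below each cube carry only a proportion `ρ` of its `v`-measure,
then the number of stopping cubes has exponential moments of every base `σ` with `σ * ρ < 1`. -/
lemma lintegral_mul_pow_stopCount_le {v : (Fin d → ℝ) → ℝ≥0∞} {σ ρ c : ℝ≥0∞}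
    (hσ : σ ≠ ∞) (hc : 1 + σ * c * ρ ≤ c)
    (hv : ∀ N, ∀ L ∈ 𝒟, ∫⁻ x in stoppedSet halt inc N L 0 L, v x ≤ ρ * ∫⁻ x in L.toSet, v x)
    (N : ℕ) {T : Cube d} (hT : T ∈ 𝒟) :
    ∫⁻ x in T.toSet, v x * σ ^ stopCount halt inc N T 0 T x ≤ c * ∫⁻ x in T.toSet, v x := by
  classical
  have restart : ∀ N, ∀ L ∈ 𝒟,
      (∫⁻ x in L.toSet, v x) + σ * c * ∫⁻ x in stoppedSet halt inc N L 0 L, v x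
        ≤ c * ∫⁻ x in L.toSet, v x := fun N L hL => by
    calc _ ≤ (∫⁻ x in L.toSet, v x) + σ * c * (ρ * ∫⁻ x in L.toSet, v x) := by
          gcongr; exact hv N L hL
      _ = (1 + σ * c * ρ) * ∫⁻ x in L.toSet, v x := by ring
      _ ≤ _ := by gcongr
  have key : ∀ N T b, ∀ I ∈ 𝒟, ∫⁻ x in I.toSet, v x * σ ^ stopCount halt inc N T b I x
      ≤ (∫⁻ x in I.toSet, v x) + σ * c * ∫⁻ x in stoppedSet halt inc N T b I, v x := by
    intro N
    induction N with
    | zero => intro T b I _; simp [stopCount]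
    | succ N ih =>
      intro T b I hI
      rw [I.lintegral_eq_sum_child, I.lintegral_eq_sum_child, lintegral_stoppedSet_succ,
        Finset.mul_sum, ← Finset.sum_add_distrib]
      refine Finset.sum_le_sum fun η _ => ?_
      have hη := h𝒟 I hI η
      split_ifs with hs
      · calc ∫⁻ x in (I.child η).toSet, v x * σ ^ stopCount halt inc (N + 1) T b I x
            ≤ ∫⁻ x in (I.child η).toSet,
                σ * (v x * σ ^ stopCount halt inc N (I.child η) 0 (I.child η) x) := by
              refine setLIntegral_mono' (I.child η).measurableSet_toSet fun x hx => ?_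
              rw [stopCount_succ_of_stop hs hx, pow_succ]
              exact le_of_eq (by ring)
          _ ≤ σ * (c * ∫⁻ x in (I.child η).toSet, v x) := by
              rw [lintegral_const_mul' _ _ hσ]
              gcongr
              exact (ih (I.child η) 0 (I.child η) hη).trans (restart N _ hη)
          _ ≤ _ := by rw [← mul_assoc]; exact le_add_self
      · calc ∫⁻ x in (I.child η).toSet, v x * σ ^ stopCount halt inc (N + 1) T b I x
            = ∫⁻ x in (I.child η).toSet,
                v x * σ ^ stopCount halt inc N T (b + inc T I) (I.child η) x :=
              setLIntegral_congr_fun (I.child η).measurableSet_toSet fun x hx => by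
                simp only [stopCount_succ_of_not_stop hs hx]
          _ ≤ _ := ih _ _ _ hη
  exact (key N T 0 T hT).trans (restart N T hT)

include h𝒟 in
/-- Integrated form of the passage from the stopping cubes to the function `G`: an estimate for each
stopping cube `L` with a weight `Q ^ s` that decays in the number `s` of stopping cubes below `L`
sums up to a geometric series. -/
lemma lintegral_stopSum_le {G : (Fin d → ℝ) → ℝ≥0∞} {Q c : ℝ≥0∞}
    (hw : ∀ N, ∀ L ∈ 𝒟, ∫⁻ x in L.toSet, w (stopCount halt inc N L 0 L x) L
      ≤ c * ∫⁻ x in L.toSet, Q ^ stopCount halt inc N L 0 L x * G x)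
    (N : ℕ) (T : Cube d) (b : ℝ≥0∞) {I : Cube d} (hI : I ∈ 𝒟) :
    ∫⁻ x in I.toSet, stopSum halt inc w N T b I x
      ≤ c * ∫⁻ x in I.toSet, (∑ j ∈ Finset.range (stopCount halt inc N T b I x), Q ^ j) * G x := by
  induction N generalizing T b I with
  | zero => simp [stopSum]
  | succ N ih =>
    rw [I.lintegral_eq_sum_child, I.lintegral_eq_sum_child, Finset.mul_sum]
    refine Finset.sum_le_sum fun η _ => ?_
    have hη := h𝒟 I hI η
    have hm := (I.child η).measurableSet_toSet
    by_cases hs : halt T (b + inc T I) (I.child η)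
    · calc ∫⁻ x in (I.child η).toSet, stopSum halt inc w (N + 1) T b I x
          = ∫⁻ x in (I.child η).toSet,
              (w (stopCount halt inc N (I.child η) 0 (I.child η) x) (I.child η)
                + stopSum halt inc w N (I.child η) 0 (I.child η) x) :=
            setLIntegral_congr_fun hm fun x hx => by simp only [stopSum_succ_of_stop hs hx]
        _ = (∫⁻ x in (I.child η).toSet,
              w (stopCount halt inc N (I.child η) 0 (I.child η) x) (I.child η))
            + ∫⁻ x in (I.child η).toSet, stopSum halt inc w N (I.child η) 0 (I.child η) x :=
            lintegral_add_right _ (measurable_stopSum halt inc _ _ _ _ _)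
        _ ≤ c * (∫⁻ x in (I.child η).toSet,
              Q ^ stopCount halt inc N (I.child η) 0 (I.child η) x * G x)
            + c * ∫⁻ x in (I.child η).toSet, (∑ j ∈ Finset.range
                (stopCount halt inc N (I.child η) 0 (I.child η) x), Q ^ j) * G x :=
            add_le_add (hw N _ hη) (ih _ _ hη)
        _ ≤ c * ∫⁻ x in (I.child η).toSet,
              (Q ^ stopCount halt inc N (I.child η) 0 (I.child η) x * G x
              + (∑ j ∈ Finset.range
                (stopCount halt inc N (I.child η) 0 (I.child η) x), Q ^ j) * G x) := by
            rw [← mul_add]; gcongr; exact le_lintegral_add _ _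
        _ = _ := by
            congr 1
            refine setLIntegral_congr_fun hm fun x hx => ?_
            simp only [stopCount_succ_of_stop hs hx, Finset.sum_range_succ]
            ring
    · calc ∫⁻ x in (I.child η).toSet, stopSum halt inc w (N + 1) T b I x
          = ∫⁻ x in (I.child η).toSet, stopSum halt inc w N T (b + inc T I) (I.child η) x :=
            setLIntegral_congr_fun hm fun x hx => by simp only [stopSum_succ_of_not_stop hs hx]
        _ ≤ _ := ih _ _ hη
        _ = _ := by
            congr 1
            refine setLIntegral_congr_fun hm fun x hx => ?_
            simp only [stopCount_succ_of_not_stop hs hx]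

end Stopping

/-! ### Weighted Hölder inequality along a chain of stopping cubes -/

/-- One step of Hölder's inequality
`(∑ x_i) ^ q ≤ (∑ t_i ^ (-1 / (q - 1))) ^ (q - 1) * ∑ t_i * x_i ^ q`. -/
lemma add_rpow_le_of_rpow_le {q : ℝ} (hq : 1 < q) {x r P κ t : ℝ≥0∞} (ht0 : t ≠ 0) (ht : t ≠ ∞)
    (hr : r ^ q ≤ κ ^ (q - 1) * P) :
    (x + r) ^ q ≤ (t ^ (-(1 / (q - 1))) + κ) ^ (q - 1) * (t * x ^ q + P) := by
  have hq0 : 0 < q := by linarith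
  have hq1 : 0 < q - 1 := by linarith
  have hconj : q.HolderConjugate (q / (q - 1)) := Real.HolderConjugate.conjExponent hq
  have hx : x = t ^ (1 / q) * x * t ^ (-(1 / q)) := by
    rw [mul_right_comm, ← ENNReal.rpow_add _ _ ht0 ht]; simp
  have hr' : r ≤ P ^ (1 / q) * κ ^ ((q - 1) / q) := by
    rw [← ENNReal.rpow_le_rpow_iff hq0]
    refine hr.trans (le_of_eq ?_)
    rw [ENNReal.mul_rpow_of_nonneg _ _ hq0.le, ← ENNReal.rpow_mul, ← ENNReal.rpow_mul,
      div_mul_cancel₀ _ hq0.ne', div_mul_cancel₀ _ hq0.ne', ENNReal.rpow_one, mul_comm]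
  have h := ENNReal.inner_le_Lp_mul_Lq Finset.univ ![t ^ (1 / q) * x, P ^ (1 / q)]
    ![t ^ (-(1 / q)), κ ^ ((q - 1) / q)] hconj
  simp only [Fin.sum_univ_two, Matrix.cons_val_zero, Matrix.cons_val_one] at h
  rw [← hx, ENNReal.mul_rpow_of_nonneg _ _ hq0.le] at h
  simp only [← ENNReal.rpow_mul] at h
  have e1 : 1 / q * q = 1 := by field_simp
  have e2 : -(1 / q) * (q / (q - 1)) = -(1 / (q - 1)) := by field_simp
  have e3 : (q - 1) / q * (q / (q - 1)) = 1 := by field_simp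
  have e4 : 1 / (q / (q - 1)) * q = q - 1 := by field_simp
  rw [e1, e2, e3, ENNReal.rpow_one, ENNReal.rpow_one, ENNReal.rpow_one] at h
  calc (x + r) ^ q ≤ ((t * x ^ q + P) ^ (1 / q)
        * (t ^ (-(1 / (q - 1))) + κ) ^ (1 / (q / (q - 1)))) ^ q := by
        refine ENNReal.rpow_le_rpow (le_trans ?_ h) hq0.le
        gcongr
    _ = _ := by
        rw [ENNReal.mul_rpow_of_nonneg _ _ hq0.le, ← ENNReal.rpow_mul, ← ENNReal.rpow_mul, e1, e4,
          ENNReal.rpow_one, mul_comm]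

section

variable {d : ℕ} (halt : Cube d → ℝ≥0∞ → Cube d → Prop) (inc : Cube d → Cube d → ℝ≥0∞)

lemma stopSum_rpow_le {q : ℝ} (hq : 1 < q) {θ : ℝ≥0∞} (h0 : θ ≠ 0) (hθ : θ ≠ ∞)
    (a : Cube d → ℝ≥0∞) (N : ℕ) (T : Cube d) (b : ℝ≥0∞) {I : Cube d} {x : Fin d → ℝ}
    (hx : x ∈ I.toSet) :
    stopSum halt inc (fun _ L => a L) N T b I x ^ q
      ≤ (∑ j ∈ Finset.range (stopCount halt inc N T b I x), (θ ^ (-(1 / (q - 1)))) ^ j) ^ (q - 1)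
        * stopSum halt inc (fun s L => θ ^ s * a L ^ q) N T b I x := by
  induction N generalizing T b I with
  | zero => simp [stopSum, stopCount, (by linarith : 0 < q), (by linarith : 0 < q - 1)]
  | succ N ih =>
    have hm := Cube.mem_child_childIdx hx
    by_cases hs : halt T (b + inc T I) (I.child (I.childIdx x))
    · rw [stopSum_succ_of_stop hs hm, stopSum_succ_of_stop hs hm, stopCount_succ_of_stop hs hm,
        Finset.sum_range_succ_comm]
      refine (add_rpow_le_of_rpow_le hq (pow_ne_zero (stopCount halt inc N
        (I.child (I.childIdx x)) 0 (I.child (I.childIdx x)) x) h0) (ENNReal.pow_ne_top hθ)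
        (ih _ 0 hm)).trans_eq ?_
      rw [← ENNReal.rpow_natCast, ← ENNReal.rpow_natCast, ← ENNReal.rpow_mul, ← ENNReal.rpow_mul,
        mul_comm (Nat.cast _) (-(1 / (q - 1)))]
    · rw [stopSum_succ_of_not_stop hs hm, stopSum_succ_of_not_stop hs hm,
        stopCount_succ_of_not_stop hs hm]
      exact ih _ _ hm

/-- The `ℓ^1` sum over a chain of stopping cubes is controlled by a weighted `ℓ^q` sum, the weights
growing geometrically towards the top of the chain. -/
lemma add_stopSum_rpow_le {q : ℝ} (hq : 1 < q) {θ : ℝ≥0∞} (h0 : θ ≠ 0) (hθ : θ ≠ ∞)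
    (a : Cube d → ℝ≥0∞) (N : ℕ) {T : Cube d} {x : Fin d → ℝ} (hx : x ∈ T.toSet) :
    (a T + stopSum halt inc (fun _ L => a L) N T 0 T x) ^ q
      ≤ ((1 - θ ^ (-(1 / (q - 1))))⁻¹) ^ (q - 1)
        * (θ ^ stopCount halt inc N T 0 T x * a T ^ q
          + stopSum halt inc (fun s L => θ ^ s * a L ^ q) N T 0 T x) := by
  refine (add_rpow_le_of_rpow_le hq (pow_ne_zero (stopCount halt inc N T 0 T x) h0)
    (ENNReal.pow_ne_top hθ) (stopSum_rpow_le halt inc hq h0 hθ a N T 0 hx)).trans ?_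
  gcongr
  rw [← ENNReal.tsum_geometric]
  refine le_trans (le_of_eq ?_)
    (ENNReal.sum_le_tsum (Finset.range (stopCount halt inc N T 0 T x + 1)))
  rw [Finset.sum_range_succ_comm, ← ENNReal.rpow_natCast, ← ENNReal.rpow_natCast,
      ← ENNReal.rpow_mul, ← ENNReal.rpow_mul, mul_comm (Nat.cast _) (-(1 / (q - 1)))]

lemma stopSum_sq_le (a : Cube d → ℝ≥0∞) (N : ℕ) (T : Cube d) (b : ℝ≥0∞) {I : Cube d}
    {x : Fin d → ℝ} (hx : x ∈ I.toSet) :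
    stopSum halt inc (fun _ L => a L ^ 2) N T b I x
      ≤ stopSum halt inc (fun _ L => a L) N T b I x ^ 2 := by
  induction N generalizing T b I with
  | zero => simp [stopSum]
  | succ N ih =>
    have hm := Cube.mem_child_childIdx hx
    by_cases hs : halt T (b + inc T I) (I.child (I.childIdx x))
    · rw [stopSum_succ_of_stop hs hm, stopSum_succ_of_stop hs hm, add_sq]
      refine add_le_add ?_ (ih _ _ hm)
      exact le_self_add
    · rw [stopSum_succ_of_not_stop hs hm, stopSum_succ_of_not_stop hs hm]
      exact ih _ _ hm

end

/-! ### The stopping condition and the pointwise domination of the square function -/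

section Sparse

variable {d n : ℕ}

/-- The average of `‖h‖` over the cube `I`. -/
noncomputable def normAvg (h : (Fin d → ℝ) → EuclideanSpace ℂ (Fin n)) (I : Cube d) : ℝ≥0∞ :=
  (∫⁻ x in I.toSet, ‖h x‖ₑ) / volume I.toSet

/-- The contribution `∑_ε |h_I^ε|² / |I|` of the cube `I` to the square of the dyadic square
function of `h`. -/
noncomputable def haarEnergy (h : (Fin d → ℝ) → EuclideanSpace ℂ (Fin n)) (I : Cube d) : ℝ≥0∞ :=
  (∑ ε : Signature d, ‖haarCoeff h I ε‖ₑ ^ 2) / volume I.toSet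

lemma normAvg_mul_volume (h : (Fin d → ℝ) → EuclideanSpace ℂ (Fin n)) (I : Cube d) :
    normAvg h I * volume I.toSet = ∫⁻ x in I.toSet, ‖h x‖ₑ :=
  ENNReal.div_mul_cancel I.volume_toSet_ne_zero I.volume_toSet_ne_top

lemma haarEnergy_mul_volume (h : (Fin d → ℝ) → EuclideanSpace ℂ (Fin n)) (I : Cube d) :
    haarEnergy h I * volume I.toSet = ∑ ε : Signature d, ‖haarCoeff h I ε‖ₑ ^ 2 :=
  ENNReal.div_mul_cancel I.volume_toSet_ne_zero I.volume_toSet_ne_top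

lemma enorm_integral_child_sq_div_le {h : (Fin d → ℝ) → EuclideanSpace ℂ (Fin n)} {I : Cube d}
    {c : ℝ≥0∞} (hc : normAvg h I ≤ c) (η : Fin d → Fin 2) :
    ‖∫ x in (I.child η).toSet, h x‖ₑ ^ 2 / volume (I.child η).toSet
      ≤ 4 ^ d * c ^ 2 * volume (I.child η).toSet := by
  have h1 : ‖∫ x in (I.child η).toSet, h x‖ₑ ≤ c * (2 ^ d * volume (I.child η).toSet) := by
    calc ‖∫ x in (I.child η).toSet, h x‖ₑ ≤ ∫⁻ x in (I.child η).toSet, ‖h x‖ₑ :=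
          enorm_integral_le_lintegral_enorm _
      _ ≤ ∫⁻ x in I.toSet, ‖h x‖ₑ := lintegral_mono_set (I.child_subset η)
      _ ≤ _ := by
          rw [← normAvg_mul_volume, ← I.volume_eq_two_pow_mul_volume_child η]
          gcongr
  rw [ENNReal.div_le_iff (I.child η).volume_toSet_ne_zero (I.child η).volume_toSet_ne_top]
  calc ‖∫ x in (I.child η).toSet, h x‖ₑ ^ 2 ≤ (c * (2 ^ d * volume (I.child η).toSet)) ^ 2 := by
        gcongr
    _ = _ := by
        rw [show (4 : ℝ≥0∞) ^ d = (2 ^ d) ^ 2 by rw [← pow_mul, mul_comm, pow_mul]; norm_num]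
        ring

lemma haarEnergy_le_of_normAvg_le {h : (Fin d → ℝ) → EuclideanSpace ℂ (Fin n)} {I : Cube d}
    (hh : IntegrableOn h I.toSet) {c : ℝ≥0∞} (hc : normAvg h I ≤ c) :
    haarEnergy h I ≤ 4 ^ d * c ^ 2 := by
  rw [haarEnergy, ENNReal.div_le_iff I.volume_toSet_ne_zero I.volume_toSet_ne_top]
  calc ∑ ε : Signature d, ‖haarCoeff h I ε‖ₑ ^ 2
      ≤ ∑ η, ‖∫ x in (I.child η).toSet, h x‖ₑ ^ 2 / volume (I.child η).toSet := by
        rw [← sum_enorm_haarCoeff_sq hh]; exact le_self_add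
    _ ≤ ∑ η, 4 ^ d * c ^ 2 * volume (I.child η).toSet :=
        Finset.sum_le_sum fun η _ => enorm_integral_child_sq_div_le hc η
    _ = _ := by rw [← Finset.mul_sum, I.sum_volume_child]

lemma haarCoeff_clm_comp {h : (Fin d → ℝ) → EuclideanSpace ℂ (Fin n)} {I : Cube d}
    (hh : IntegrableOn h I.toSet)
    (B : EuclideanSpace ℂ (Fin n) →L[ℂ] EuclideanSpace ℂ (Fin n)) (ε : Fin d → Fin 2) :
    haarCoeff (fun x => B (h x)) I ε = B (haarCoeff h I ε) := by
  rw [haarCoeff_eq_sum hh, haarCoeff_eq_sum (B.integrable_comp hh), map_smul, map_sum]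
  congr 1
  refine Finset.sum_congr rfl fun η _ => ?_
  rw [map_smul, B.integral_comp_comm (hh.mono_set (I.child_subset η))]

lemma haarEnergy_clm_comp_le {h : (Fin d → ℝ) → EuclideanSpace ℂ (Fin n)} {I : Cube d}
    (hh : IntegrableOn h I.toSet)
    (B : EuclideanSpace ℂ (Fin n) →L[ℂ] EuclideanSpace ℂ (Fin n)) :
    haarEnergy (fun x => B (h x)) I ≤ ‖B‖ₑ ^ 2 * haarEnergy h I := by
  rw [haarEnergy, haarEnergy, ← mul_div_assoc, Finset.mul_sum]
  gcongr with ε _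
  rw [haarCoeff_clm_comp hh, ← mul_pow]
  gcongr
  exact B.le_opENorm _

variable (A A' : Cube d → EuclideanSpace ℂ (Fin n) →L[ℂ] EuclideanSpace ℂ (Fin n))
  (f : (Fin d → ℝ) → EuclideanSpace ℂ (Fin n)) (lam : ℝ≥0∞)

/-- The partial sums `∑ |A_I f_I^ε|² / |I|` of the square function at `x`, over the cubes containing
`x` of the `N` generations starting with `I`. -/
noncomputable def squareSum : ℕ → Cube d → (Fin d → ℝ) → ℝ≥0∞
  | 0, _ => fun _ => 0
  | N + 1, I => fun x =>
      haarEnergy (fun y => A I (f y)) I + squareSum N (I.child (I.childIdx x)) x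

/-- The average of `|A_T f|` over `T`. -/
noncomputable def topAvg (T : Cube d) : ℝ≥0∞ := normAvg (fun y => A T (f y)) T

/-- The increment of the stopping process with stopping cube `T` at the cube `I`. -/
noncomputable def energyInc (T I : Cube d) : ℝ≥0∞ := haarEnergy (fun y => A T (f y)) I

/-- The process with stopping cube `T` stops at `I` if the reducing matrix `A_I` is much larger than
`A_T`, or the average of `|A_T f|` over `I` is much larger than over `T`, or the square function of
`A_T f`, summed from `T` down to the parent of `I`, is large. -/
def ShouldStop (T : Cube d) (b : ℝ≥0∞) (I : Cube d) : Prop :=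
  lam < ‖A I ∘L A' T‖ₑ ∨ 8 * topAvg A f T < normAvg (fun y => A T (f y)) I ∨
    256 * 4 ^ d * topAvg A f T ^ 2 < b

variable {A A' f lam}

lemma not_shouldStop_self (hA : ∀ I v, A I (A' I v) = v) (hlam : 1 ≤ lam) (T : Cube d) :
    ¬ ShouldStop A A' f lam T 0 T := by
  have h1 : ‖A T ∘L A' T‖ₑ ≤ 1 := by
    have : A T ∘L A' T = ContinuousLinearMap.id ℂ _ := by ext1 v; simp [hA]
    rw [this, ← ofReal_norm, ← ENNReal.ofReal_one]
    exact ENNReal.ofReal_le_ofReal ContinuousLinearMap.norm_id_le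
  rintro (h | h | h)
  · exact absurd h (not_lt.2 (h1.trans hlam))
  · exact absurd h (not_lt.2 (le_mul_of_one_le_left' (by norm_num)))
  · exact absurd h not_lt_zero

/-- Sparse domination of the square function. -/
lemma squareSum_le (hA : ∀ I v, A I (A' I v) = v) (hA' : ∀ I v, A' I (A I v) = v)
    (hlam : 1 ≤ lam) (hf : ∀ I : Cube d, IntegrableOn f I.toSet) (N : ℕ) (T : Cube d) (b : ℝ≥0∞)
    {I : Cube d} (hns : ¬ ShouldStop A A' f lam T b I) {x : Fin d → ℝ} (hx : x ∈ I.toSet) :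
    squareSum A f N I x + lam ^ 2 * b ≤ lam ^ 2 * (320 * 4 ^ d) * (topAvg A f T ^ 2
      + stopSum (ShouldStop A A' f lam) (energyInc A f)
          (fun _ L => topAvg A f L ^ 2) N T b I x) := by
  induction N generalizing T b I with
  | zero =>
    simp only [ShouldStop, not_or, not_lt] at hns
    simp only [squareSum, stopSum, zero_add, add_zero]
    rw [mul_assoc]
    gcongr
    exact hns.2.2.trans (by gcongr; norm_num)
  | succ N ih =>
    have hm := Cube.mem_child_childIdx hx
    have hns' := hns
    simp only [ShouldStop, not_or, not_lt] at hns'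
    obtain ⟨h1, h2, h3⟩ := hns'
    have hE : haarEnergy (fun y => A I (f y)) I ≤ lam ^ 2 * energyInc A f T I := by
      have : (fun y => A I (f y)) = fun y => (A I ∘L A' T) (A T (f y)) := by
        funext y; simp [hA']
      rw [this]
      refine (haarEnergy_clm_comp_le ((A T).integrable_comp (hf I)) _).trans ?_
      rw [energyInc]; gcongr
    have hb : lam ^ 2 * (b + energyInc A f T I) ≤ lam ^ 2 * (320 * 4 ^ d) * topAvg A f T ^ 2 := by
      rw [mul_assoc]
      gcongr
      calc b + energyInc A f T I
          ≤ 256 * 4 ^ d * topAvg A f T ^ 2 + 4 ^ d * (8 * topAvg A f T) ^ 2 :=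
            add_le_add h3 (haarEnergy_le_of_normAvg_le ((A T).integrable_comp (hf I)) h2)
        _ = 320 * 4 ^ d * topAvg A f T ^ 2 := by ring
    rw [squareSum]
    by_cases hs : ShouldStop A A' f lam T (b + energyInc A f T I) (I.child (I.childIdx x))
    · rw [stopSum_succ_of_stop hs hm]
      have := ih (I.child (I.childIdx x)) 0 (not_shouldStop_self hA hlam _) hm
      rw [mul_zero, add_zero] at this
      calc haarEnergy (fun y => A I (f y)) I + squareSum A f N (I.child (I.childIdx x)) x
            + lam ^ 2 * b
          ≤ lam ^ 2 * energyInc A f T I + squareSum A f N (I.child (I.childIdx x)) x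
            + lam ^ 2 * b := by gcongr
        _ = lam ^ 2 * (b + energyInc A f T I) + squareSum A f N (I.child (I.childIdx x)) x := by
            ring
        _ ≤ _ := add_le_add hb this
        _ = _ := by ring
    · rw [stopSum_succ_of_not_stop hs hm]
      calc haarEnergy (fun y => A I (f y)) I + squareSum A f N (I.child (I.childIdx x)) x
            + lam ^ 2 * b
          ≤ lam ^ 2 * energyInc A f T I + squareSum A f N (I.child (I.childIdx x)) x
            + lam ^ 2 * b := by gcongr
        _ = squareSum A f N (I.child (I.childIdx x)) x + lam ^ 2 * (b + energyInc A f T I) := by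
            ring
        _ ≤ _ := ih T _ hs hm

/-- The first stopping cubes below `T` cover at most half of `T`. For the square function condition
the quantity `b * |I| + 64 * 4 ^ d * a ^ 2 * |I| - |∫_I A_T f| ^ 2 / |I|` (with `a` the average of
`|A_T f|` over `T`) is conserved by Parseval's identity for each cube until the process stops. -/
lemma volume_stoppedSet_le {𝒟 : Set (Cube d)} (h𝒟 : ∀ I ∈ 𝒟, ∀ η, I.child η ∈ 𝒟)
    (hA : ∀ I v, A I (A' I v) = v) (hlam : 1 ≤ lam)
    (hf : ∀ I : Cube d, IntegrableOn f I.toSet) {T : Cube d} (hT : T ∈ 𝒟)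
    {φ : (Fin d → ℝ) → ℝ≥0∞}
    (hφ : ∀ I ∈ 𝒟, lam < ‖A I ∘L A' T‖ₑ → volume I.toSet ≤ ∫⁻ x in I.toSet, φ x)
    (hφT : ∫⁻ x in T.toSet, φ x ≤ 8⁻¹ * volume T.toSet) (N : ℕ) :
    volume (stoppedSet (ShouldStop A A' f lam) (energyInc A f) N T 0 T)
      ≤ 2⁻¹ * volume T.toSet := by
  classical
  set h : (Fin d → ℝ) → EuclideanSpace ℂ (Fin n) := fun y => A T (f y) with hh
  set a := topAvg A f T with ha
  have hint : ∀ I : Cube d, IntegrableOn h I.toSet := fun I => (A T).integrable_comp (hf I)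
  have hatop : a ≠ ∞ := by
    rw [ha, topAvg, normAvg]
    exact ENNReal.div_ne_top (hint T).2.ne T.volume_toSet_ne_zero
  set D : ℝ≥0∞ := 64 * 4 ^ d * a ^ 2 with hD
  set δ : ℝ≥0∞ := (4 * D)⁻¹ with hδ
  have h4D : 256 * 4 ^ d * a ^ 2 = 4 * D := by rw [hD]; ring
  have hδD : δ * D ≤ 4⁻¹ := by
    rw [hδ, ENNReal.mul_inv (by simp) (by simp), mul_assoc]
    exact mul_le_of_le_one_right' (ENNReal.inv_mul_le_one _)
  have hδDtop : δ * D ≠ ∞ := ne_top_of_le_ne_top (by norm_num) hδD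
  set e : Cube d → ℝ≥0∞ := fun I => ‖∫ x in I.toSet, h x‖ₑ ^ 2 / volume I.toSet with he
  set μ : Cube d → ℝ≥0∞ := fun I => ∫⁻ x in I.toSet, (φ x + (8 * a)⁻¹ * ‖h x‖ₑ) with hμ
  have hμφ : ∀ I : Cube d, ∫⁻ x in I.toSet, φ x ≤ μ I := fun I =>
    lintegral_mono fun x => le_self_add
  have hμh : ∀ I : Cube d, ∫⁻ x in I.toSet, (8 * a)⁻¹ * ‖h x‖ₑ ≤ μ I := fun I =>
    lintegral_mono fun x => le_add_self
  have havg : ∀ I b, ¬ ShouldStop A A' f lam T b I → normAvg h I ≤ 8 * a := fun I b hns => by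
    simp only [ShouldStop, not_or, not_lt] at hns
    exact hns.2.1
  have hvol : ∀ I ∈ 𝒟, ∀ b, ShouldStop A A' f lam T b I →
      volume I.toSet ≤ μ I + δ * (b * volume I.toSet) := by
    rintro I hI b (hs | hs | hs)
    · exact (hφ I hI hs).trans ((hμφ I).trans le_self_add)
    · refine le_trans ?_ ((hμh I).trans le_self_add)
      have hI0 : normAvg h I ≠ 0 := (lt_of_le_of_lt (zero_le) hs).ne'
      rw [lintegral_const_mul'' _ (hint I).1.enorm, ← normAvg_mul_volume, ← mul_assoc]
      by_cases ha0 : a = 0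
      · rw [ha0, mul_zero, ENNReal.inv_zero, ENNReal.top_mul hI0,
          ENNReal.top_mul I.volume_toSet_ne_zero]
        exact le_top
      · refine le_mul_of_one_le_left' ?_
        rw [← ENNReal.inv_mul_cancel (a := 8 * a) (by simp [ha0])
          (ENNReal.mul_ne_top (by norm_num) hatop)]
        gcongr
    · rw [← ha, h4D] at hs
      refine le_trans ?_ le_add_self
      rw [← mul_assoc]
      refine le_mul_of_one_le_left' ?_
      rw [hδ, mul_comm, ← div_eq_mul_inv]
      rw [ENNReal.le_div_iff_mul_le (Or.inr (lt_of_le_of_lt (zero_le) hs).ne')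
        (Or.inl (by finiteness)), one_mul]
      exact hs.le
  have heI : ∀ I b, ¬ ShouldStop A A' f lam T b I → e I ≤ D * volume I.toSet := fun I b hns => by
    rw [he]
    simp only
    rw [ENNReal.div_le_iff I.volume_toSet_ne_zero I.volume_toSet_ne_top]
    calc ‖∫ x in I.toSet, h x‖ₑ ^ 2 ≤ (8 * a * volume I.toSet) ^ 2 := by
          gcongr
          refine (enorm_integral_le_lintegral_enorm _).trans ?_
          rw [← normAvg_mul_volume]
          gcongr
          exact havg I b hns
      _ = 64 * 1 * a ^ 2 * volume I.toSet * volume I.toSet := by ring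
      _ ≤ D * volume I.toSet * volume I.toSet := by
          rw [hD]; gcongr; exact one_le_pow₀ (by norm_num)
  have heη : ∀ I b, ¬ ShouldStop A A' f lam T b I → ∀ η,
      e (I.child η) ≤ D * volume (I.child η).toSet := fun I b hns η => by
    refine (enorm_integral_child_sq_div_le (havg I b hns) η).trans (le_of_eq ?_)
    rw [hD]; ring
  have key : ∀ N b, ∀ I ∈ 𝒟, ¬ ShouldStop A A' f lam T b I →
      volume (stoppedSet (ShouldStop A A' f lam) (energyInc A f) N T b I) + δ * e I
        ≤ μ I + δ * ((b + D) * volume I.toSet) := by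
    intro N
    induction N with
    | zero =>
      intro b I hI hns
      simp only [stoppedSet, measure_empty, zero_add]
      calc δ * e I ≤ δ * (D * volume I.toSet) := by gcongr; exact heI I b hns
        _ ≤ δ * ((b + D) * volume I.toSet) := by gcongr; exact le_add_self
        _ ≤ _ := le_add_self
    | succ N ih =>
      intro b I hI hns
      have hvolsucc := lintegral_stoppedSet_succ (ShouldStop A A' f lam) (energyInc A f) 1 N T b I
      simp only [Pi.one_apply, setLIntegral_one] at hvolsucc
      have hE : δ * (energyInc A f T I * volume I.toSet) ≠ ∞ := by
        refine ne_top_of_le_ne_top (ENNReal.mul_ne_top hδDtop I.volume_toSet_ne_top)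
          (b := δ * D * volume I.toSet) ?_
        rw [mul_assoc]
        gcongr
        refine (haarEnergy_le_of_normAvg_le (hint I) (havg I b hns)).trans (le_of_eq ?_)
        rw [hD]; ring
      have hpars : energyInc A f T I * volume I.toSet + e I = ∑ η, e (I.child η) := by
        rw [energyInc, haarEnergy_mul_volume]
        exact sum_enorm_haarCoeff_sq (hint I)
      have hstep : ∀ η, (if ShouldStop A A' f lam T (b + energyInc A f T I) (I.child η) then
            volume (I.child η).toSet else volume (stoppedSet (ShouldStop A A' f lam)
              (energyInc A f) N T (b + energyInc A f T I) (I.child η))) + δ * e (I.child η)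
          ≤ μ (I.child η) + δ * ((b + energyInc A f T I + D) * volume (I.child η).toSet) := by
        intro η
        split_ifs with hs
        · calc _ ≤ μ (I.child η) + δ * ((b + energyInc A f T I) * volume (I.child η).toSet)
                + δ * (D * volume (I.child η).toSet) :=
              add_le_add (hvol _ (h𝒟 I hI η) _ hs) (by gcongr; exact heη I b hns η)
            _ = _ := by ring
        · exact ih _ _ (h𝒟 I hI η) hs
      have hsum := Finset.sum_le_sum fun η (_ : η ∈ Finset.univ) => hstep η
      rw [Finset.sum_add_distrib, Finset.sum_add_distrib, ← Finset.mul_sum, ← Finset.mul_sum,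
        ← Finset.mul_sum, ← hvolsucc, ← hpars, I.sum_volume_child, ← I.lintegral_eq_sum_child]
        at hsum
      refine (ENNReal.add_le_add_iff_right hE).1 ?_
      calc _ = volume (stoppedSet (ShouldStop A A' f lam) (energyInc A f) (N + 1) T b I)
            + δ * (energyInc A f T I * volume I.toSet + e I) := by ring
        _ ≤ _ := hsum
        _ = _ := by ring
  have hμT : μ T ≤ 4⁻¹ * volume T.toSet := by
    rw [hμ]
    simp only
    rw [lintegral_add_right' _ ((hint T).1.enorm.const_mul _),
      lintegral_const_mul'' _ (hint T).1.enorm, ← normAvg_mul_volume]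
    calc _ ≤ 8⁻¹ * volume T.toSet + (8 * a)⁻¹ * (a * volume T.toSet) := add_le_add hφT le_rfl
      _ = 8⁻¹ * volume T.toSet + 8⁻¹ * (a⁻¹ * a) * volume T.toSet := by
          rw [ENNReal.mul_inv (by simp) (by simp)]; ring
      _ ≤ 8⁻¹ * volume T.toSet + 8⁻¹ * 1 * volume T.toSet := by
          gcongr; exact ENNReal.inv_mul_le_one _
      _ = 4⁻¹ * volume T.toSet := by
          rw [mul_one, ← add_mul, show (8 : ℝ≥0∞) = 2 * 4 by norm_num,
            ENNReal.mul_inv (by simp) (by simp), ← add_mul, ENNReal.inv_two_add_inv_two, one_mul]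
  calc _ ≤ volume (stoppedSet (ShouldStop A A' f lam) (energyInc A f) N T 0 T) + δ * e T :=
        le_self_add
    _ ≤ μ T + δ * ((0 + D) * volume T.toSet) := key N 0 T hT (not_shouldStop_self hA hlam T)
    _ ≤ 4⁻¹ * volume T.toSet + 4⁻¹ * volume T.toSet := by
        rw [zero_add, ← mul_assoc]
        gcongr
    _ = 2⁻¹ * volume T.toSet := by
        rw [← add_mul, show (4 : ℝ≥0∞) = 2 * 2 by norm_num, ENNReal.mul_inv (by simp) (by simp),
          ← add_mul, ENNReal.inv_two_add_inv_two, one_mul]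

end Sparse

/-! ### The local square function estimate -/

/-- The base of the exponential moments: `σ = exp (1 / (2 * γ))` and `ρ = 1 - 1 / γ` satisfy
`σ * ρ ≤ exp (-1 / (2 * γ))`. -/
lemma one_add_exp_mul_le {γ : ℝ≥0} (hγ : 1 ≤ γ) :
    1 + ENNReal.ofReal (Real.exp (1 / (2 * γ))) * (3 * γ) * ENNReal.ofReal (1 - 1 / γ) ≤ 3 * γ := by
  have hg : (1 : ℝ) ≤ γ := by exact_mod_cast hγ
  have hg0 : (0 : ℝ) < γ := by linarith
  have h1 : 1 - 1 / (γ : ℝ) ≤ Real.exp (-(1 / γ)) := by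
    have := Real.add_one_le_exp (-(1 / (γ : ℝ))); linarith
  have h2 : Real.exp (1 / (2 * γ)) * (1 - 1 / γ) ≤ 2 * γ / (2 * γ + 1) := by
    calc Real.exp (1 / (2 * γ)) * (1 - 1 / γ)
        ≤ Real.exp (1 / (2 * γ)) * Real.exp (-(1 / γ)) := by gcongr
      _ = (Real.exp (1 / (2 * γ)))⁻¹ := by
          rw [← Real.exp_add, ← Real.exp_neg]; congr 1; field_simp; ring
      _ ≤ (1 / (2 * (γ : ℝ)) + 1)⁻¹ := by
          exact inv_anti₀ (by positivity) (Real.add_one_le_exp _)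
      _ = 2 * (γ : ℝ) / (2 * (γ : ℝ) + 1) := by field_simp; ring
  have h3 : (1 : ℝ) + Real.exp (1 / (2 * γ)) * (3 * γ) * (1 - 1 / γ) ≤ 3 * γ := by
    have : 2 * γ / (2 * γ + 1) * (3 * γ) ≤ 3 * (γ : ℝ) - 1 := by
      rw [div_mul_eq_mul_div, div_le_iff₀ (by linarith)]; nlinarith
    nlinarith
  have h4 : (0 : ℝ) ≤ 1 - 1 / γ := by
    rw [sub_nonneg, div_le_one hg0]; exact hg
  have e : (3 * γ : ℝ≥0∞) = ENNReal.ofReal (3 * γ) := by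
    rw [ENNReal.ofReal_mul (by norm_num)]; simp
  rw [e, ← ENNReal.ofReal_mul (Real.exp_pos _).le, ← ENNReal.ofReal_mul (by positivity),
    ← ENNReal.ofReal_one, ← ENNReal.ofReal_add (by norm_num) (by positivity)]
  exact ENNReal.ofReal_le_ofReal h3

lemma inv_one_sub_exp_le {γ : ℝ≥0} (hγ : 1 ≤ γ) {q : ℝ} (hq : 1 < q) :
    (1 - ENNReal.ofReal (Real.exp (1 / (2 * γ))) ^ (-(q - 1)))⁻¹
      ≤ ENNReal.ofReal (1 + 2 / (q - 1)) * γ := by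
  have hg : (1 : ℝ) ≤ γ := by exact_mod_cast hγ
  have hq1 : 0 < q - 1 := by linarith
  set z : ℝ := (q - 1) / (2 * γ) with hz
  have hz0 : 0 < z := by positivity
  have h1 : ENNReal.ofReal (Real.exp (1 / (2 * γ))) ^ (-(q - 1))
      = ENNReal.ofReal (Real.exp (-z)) := by
    rw [ENNReal.ofReal_rpow_of_pos (Real.exp_pos _), ← Real.exp_mul]
    congr 2; rw [hz]; field_simp
  have h2 : z / (1 + z) ≤ 1 - Real.exp (-z) := by
    have : Real.exp (-z) ≤ (z + 1)⁻¹ := by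
      rw [Real.exp_neg]; gcongr; exact Real.add_one_le_exp z
    have e : z / (1 + z) = 1 - (z + 1)⁻¹ := by field_simp; ring
    linarith
  have h3 : (z / (1 + z))⁻¹ ≤ (1 + 2 / (q - 1)) * γ := by
    have : (z / (1 + z))⁻¹ = 1 + 2 * γ / (q - 1) := by rw [hz]; field_simp; ring
    rw [this, add_mul, one_mul, div_mul_eq_mul_div]; linarith
  rw [h1, ← ENNReal.ofReal_one, ← ENNReal.ofReal_sub _ (Real.exp_pos _).le,
    ← ENNReal.ofReal_inv_of_pos (by linarith [div_pos hz0 (by linarith : 0 < 1 + z)])]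
  calc ENNReal.ofReal (1 - Real.exp (-z))⁻¹ ≤ ENNReal.ofReal ((1 + 2 / (q - 1)) * γ) := by
        refine ENNReal.ofReal_le_ofReal (le_trans ?_ h3)
        gcongr
    _ = _ := by rw [ENNReal.ofReal_mul (by positivity)]; simp

/-- The constant in `lintegral_squareSum_le`. -/
noncomputable def localConst (d : ℕ) (q : ℝ) (C₁ : ℝ≥0) : ℝ≥0∞ :=
  (8 * C₁ + 1) ^ q * (320 * 4 ^ d) ^ (q / 2) *
    ((1 - (3 / 2) ^ (-(1 / (q - 1))))⁻¹) ^ (q - 1) * 4 * 3 ^ (q - 1) *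
    ENNReal.ofReal (1 + 2 / (q - 1))

lemma localConst_ne_top (d : ℕ) {q : ℝ} (hq : 1 < q) (C₁ : ℝ≥0) : localConst d q C₁ ≠ ∞ := by
  have hq1 : 0 < q - 1 := by linarith
  have h1 : (1 - (3 / 2 : ℝ≥0∞) ^ (-(1 / (q - 1))))⁻¹ ≠ ∞ := by
    rw [ENNReal.inv_ne_top]
    refine (tsub_pos_of_lt ?_).ne'
    rw [ENNReal.rpow_neg]
    refine ENNReal.inv_lt_one.2 (ENNReal.one_lt_rpow ?_ (by positivity))
    rw [ENNReal.lt_div_iff_mul_lt (by simp) (by simp)]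
    norm_num
  have h2 : (8 * (C₁ : ℝ≥0∞) + 1) ^ q ≠ ∞ :=
    ENNReal.rpow_ne_top_of_nonneg (by linarith) (by finiteness)
  have h3 : (320 * 4 ^ d : ℝ≥0∞) ^ (q / 2) ≠ ∞ :=
    ENNReal.rpow_ne_top_of_nonneg (by linarith) (by finiteness)
  have h4 : ((1 - (3 / 2 : ℝ≥0∞) ^ (-(1 / (q - 1))))⁻¹) ^ (q - 1) ≠ ∞ :=
    ENNReal.rpow_ne_top_of_nonneg hq1.le h1
  have h5 : (3 : ℝ≥0∞) ^ (q - 1) ≠ ∞ := ENNReal.rpow_ne_top_of_nonneg hq1.le (by norm_num)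
  rw [localConst]
  finiteness

section

variable {d n : ℕ} {A A' : Cube d → EuclideanSpace ℂ (Fin n) →L[ℂ] EuclideanSpace ℂ (Fin n)}
  {R R' : (Fin d → ℝ) → EuclideanSpace ℂ (Fin n) →L[ℂ] EuclideanSpace ℂ (Fin n)}
  {f : (Fin d → ℝ) → EuclideanSpace ℂ (Fin n)} {𝒟 : Set (Cube d)} {q : ℝ} {C₁ α β γ : ℝ≥0}

/-- The hypotheses under which the square function with reducing matrices `A` is bounded from the
space with norm `‖R f‖_{L^q}` to `L^q`. Here `A' I` is the inverse of `A I`, `R' x` is the inverse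
of `R x`, and `q / (q - 1)` is the exponent dual to `q`. -/
structure LocalBounds (𝒟 : Set (Cube d)) (q : ℝ) (C₁ α β γ : ℝ≥0)
    (A A' : Cube d → EuclideanSpace ℂ (Fin n) →L[ℂ] EuclideanSpace ℂ (Fin n))
    (R R' : (Fin d → ℝ) → EuclideanSpace ℂ (Fin n) →L[ℂ] EuclideanSpace ℂ (Fin n)) : Prop where
  child_mem : ∀ I ∈ 𝒟, ∀ η, I.child η ∈ 𝒟
  left_inv : ∀ I v, A' I (A I v) = v
  right_inv : ∀ I v, A I (A' I v) = v
  left_inv_ae : ∀ᵐ x, ∀ v, R' x (R x v) = v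
  meas : AEStronglyMeasurable R volume
  meas' : AEStronglyMeasurable R' volume
  one_le_α : 1 ≤ α
  one_le_γ : 1 ≤ γ
  comparison : ∀ I ∈ 𝒟, ∀ T ∈ 𝒟,
    volume I.toSet * ‖A I ∘L A' T‖ₑ ^ q ≤ C₁ * ∫⁻ x in I.toSet, ‖R x ∘L A' T‖ₑ ^ q
  upper : ∀ T ∈ 𝒟, ∫⁻ x in T.toSet, ‖R x ∘L A' T‖ₑ ^ q ≤ α ^ q * volume T.toSet
  upper_dual : ∀ T ∈ 𝒟,
    ∫⁻ x in T.toSet, ‖A T ∘L R' x‖ₑ ^ (q / (q - 1)) ≤ β ^ (q / (q - 1)) * volume T.toSet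
  doubling : ∀ T ∈ 𝒟, ∀ J ∈ 𝒟, ∀ E ⊆ J.toSet, MeasurableSet E → volume J.toSet ≤ 2 * volume E →
    ∫⁻ x in J.toSet, ‖A T ∘L R' x‖ₑ ^ (q / (q - 1))
      ≤ γ * ∫⁻ x in E, ‖A T ∘L R' x‖ₑ ^ (q / (q - 1))

namespace LocalBounds

lemma aemeasurable_enorm_comp (h : LocalBounds 𝒟 q C₁ α β γ A A' R R')
    (B : EuclideanSpace ℂ (Fin n) →L[ℂ] EuclideanSpace ℂ (Fin n)) :
    AEMeasurable (fun x => ‖B ∘L R' x‖ₑ) volume :=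
  ((ContinuousLinearMap.compL ℂ _ _ _ B).continuous.comp_aestronglyMeasurable h.meas').enorm

lemma lintegral_dual_lt_top (h : LocalBounds 𝒟 q C₁ α β γ A A' R R') (hq : 1 < q)
    {T J : Cube d} (hJ : J ∈ 𝒟) :
    ∫⁻ x in J.toSet, ‖A T ∘L R' x‖ₑ ^ (q / (q - 1)) < ∞ := by
  have hq' : 0 ≤ q / (q - 1) := div_nonneg (by linarith) (by linarith)
  calc ∫⁻ x in J.toSet, ‖A T ∘L R' x‖ₑ ^ (q / (q - 1))
      ≤ ∫⁻ x in J.toSet, ‖A T ∘L A' J‖ₑ ^ (q / (q - 1)) * ‖A J ∘L R' x‖ₑ ^ (q / (q - 1)) := by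
        refine lintegral_mono fun x => ?_
        rw [← ENNReal.mul_rpow_of_nonneg _ _ hq']
        gcongr
        have : A T ∘L R' x = (A T ∘L A' J) ∘L (A J ∘L R' x) := by
          ext1 v; simp [h.left_inv]
        rw [this]
        exact ContinuousLinearMap.opENorm_comp_le _ _
    _ = ‖A T ∘L A' J‖ₑ ^ (q / (q - 1)) * ∫⁻ x in J.toSet, ‖A J ∘L R' x‖ₑ ^ (q / (q - 1)) :=
        lintegral_const_mul' _ _ (ENNReal.rpow_ne_top_of_nonneg hq' enorm_ne_top)
    _ < ∞ := ENNReal.mul_lt_top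
        (ENNReal.rpow_lt_top_of_nonneg hq' enorm_ne_top)
        ((h.upper_dual J hJ).trans_lt (ENNReal.mul_lt_top
          (ENNReal.rpow_lt_top_of_nonneg hq' ENNReal.coe_ne_top) J.volume_toSet_ne_top.lt_top))

lemma volume_stoppedSet_le (h : LocalBounds 𝒟 q C₁ α β γ A A' R R') (hq : 1 < q)
    (hf : ∀ I : Cube d, IntegrableOn f I.toSet) {T : Cube d} (hT : T ∈ 𝒟) (N : ℕ) :
    volume (stoppedSet (ShouldStop A A' f ((8 * C₁ + 1) * α)) (energyInc A f) N T 0 T)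
      ≤ 2⁻¹ * volume T.toSet := by
  set lam : ℝ≥0∞ := (8 * C₁ + 1) * α with hlam
  have hα : (1 : ℝ≥0∞) ≤ α := by exact_mod_cast h.one_le_α
  have hlam1 : 1 ≤ lam := one_le_mul le_add_self hα
  have hlamtop : lam ≠ ∞ := by finiteness
  have hq0 : 0 < q := by linarith
  have hl0 : lam ^ q ≠ 0 := (ENNReal.rpow_pos (zero_lt_one.trans_le hlam1) hlamtop).ne'
  have hltop : lam ^ q ≠ ∞ := ENNReal.rpow_ne_top_of_nonneg hq0.le hlamtop
  have hlq : 8 * C₁ * (α : ℝ≥0∞) ^ q ≤ lam ^ q := by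
    rw [hlam, ENNReal.mul_rpow_of_nonneg _ _ hq0.le]
    gcongr
    calc (8 * C₁ : ℝ≥0∞) ≤ (8 * C₁ + 1) ^ (1 : ℝ) := by rw [ENNReal.rpow_one]; exact le_self_add
      _ ≤ (8 * C₁ + 1) ^ q := ENNReal.rpow_le_rpow_of_exponent_le le_add_self hq.le
  have hcst : (lam ^ q)⁻¹ * C₁ ≠ ∞ := ENNReal.mul_ne_top (ENNReal.inv_ne_top.2 hl0) (by simp)
  refine MatrixWeighted.volume_stoppedSet_le h.child_mem h.right_inv hlam1 hf hT
    (φ := fun x => (lam ^ q)⁻¹ * C₁ * ‖R x ∘L A' T‖ₑ ^ q) ?_ ?_ N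
  · intro I hI hlt
    rw [lintegral_const_mul' _ _ hcst, mul_assoc, mul_comm, ← div_eq_mul_inv,
      ENNReal.le_div_iff_mul_le (Or.inl hl0) (Or.inl hltop)]
    refine le_trans ?_ (h.comparison I hI T hT)
    gcongr
  · rw [lintegral_const_mul' _ _ hcst]
    calc (lam ^ q)⁻¹ * C₁ * ∫⁻ x in T.toSet, ‖R x ∘L A' T‖ₑ ^ q
        ≤ (lam ^ q)⁻¹ * C₁ * (α ^ q * volume T.toSet) := by gcongr; exact h.upper T hT
      _ = 8⁻¹ * 8 * (lam ^ q)⁻¹ * C₁ * (α ^ q * volume T.toSet) := by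
          rw [ENNReal.inv_mul_cancel (by norm_num) (by norm_num), one_mul]
      _ = 8⁻¹ * ((lam ^ q)⁻¹ * (8 * C₁ * α ^ q)) * volume T.toSet := by ring
      _ ≤ 8⁻¹ * ((lam ^ q)⁻¹ * lam ^ q) * volume T.toSet := by gcongr
      _ ≤ 8⁻¹ * volume T.toSet := by
          gcongr
          exact mul_le_of_le_one_right' (ENNReal.inv_mul_le_one _)

/-- The `A_∞` property: the first stopping cubes below `L` carry at most the proportion `1 - 1 / γ`
of the measure `‖A_T R'‖ ^ q'`. -/
lemma lintegral_stoppedSet_le (h : LocalBounds 𝒟 q C₁ α β γ A A' R R') (hq : 1 < q)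
    (hf : ∀ I : Cube d, IntegrableOn f I.toSet) {T L : Cube d} (hT : T ∈ 𝒟) (hL : L ∈ 𝒟) (N : ℕ) :
    ∫⁻ x in stoppedSet (ShouldStop A A' f ((8 * C₁ + 1) * α)) (energyInc A f) N L 0 L,
        ‖A T ∘L R' x‖ₑ ^ (q / (q - 1))
      ≤ ENNReal.ofReal (1 - 1 / γ) * ∫⁻ x in L.toSet, ‖A T ∘L R' x‖ₑ ^ (q / (q - 1)) := by
  set S := stoppedSet (ShouldStop A A' f ((8 * C₁ + 1) * α)) (energyInc A f) N L 0 L with hS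
  have hSsub : S ⊆ L.toSet := stoppedSet_subset _ _ _ _ _ _
  have hSm : MeasurableSet S := measurableSet_stoppedSet _ _ _ _ _ _
  have hγ : (1 : ℝ) ≤ γ := by exact_mod_cast h.one_le_γ
  have hγ0 : (γ : ℝ≥0∞) ≠ 0 := by
    have : (γ : ℝ≥0) ≠ 0 := (zero_lt_one.trans_le h.one_le_γ).ne'
    exact_mod_cast this
  have hvol : volume L.toSet ≤ 2 * volume (L.toSet \ S) := by
    have h1 := h.volume_stoppedSet_le hq hf hL N
    rw [← hS] at h1
    have h2 : volume L.toSet = volume S + volume (L.toSet \ S) := by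
      rw [← measure_inter_add_sdiff L.toSet hSm, Set.inter_eq_right.2 hSsub]
    have h3 : 2⁻¹ * volume L.toSet ≤ volume (L.toSet \ S) := by
      refine (ENNReal.add_le_add_iff_left (a := 2⁻¹ * volume L.toSet)
        (ENNReal.mul_ne_top (by norm_num) L.volume_toSet_ne_top)).1 ?_
      rw [← add_mul, ENNReal.inv_two_add_inv_two, one_mul]
      nth_rewrite 1 [h2]
      gcongr
    calc volume L.toSet = 2 * (2⁻¹ * volume L.toSet) := by
          rw [← mul_assoc, ENNReal.mul_inv_cancel (by norm_num) (by norm_num), one_mul]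
      _ ≤ _ := by gcongr
  set v : (Fin d → ℝ) → ℝ≥0∞ := fun x => ‖A T ∘L R' x‖ₑ ^ (q / (q - 1)) with hv
  have hsplit : ∫⁻ x in L.toSet, v x = (∫⁻ x in S, v x) + ∫⁻ x in L.toSet \ S, v x := by
    rw [← lintegral_inter_add_sdiff v L.toSet hSm, Set.inter_eq_right.2 hSsub]
  have hdoub := h.doubling T hT L hL (L.toSet \ S) Set.sdiff_subset
    (L.measurableSet_toSet.diff hSm) hvol
  have hfin : (γ : ℝ≥0∞)⁻¹ * ∫⁻ x in L.toSet, v x ≠ ∞ :=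
    ENNReal.mul_ne_top (ENNReal.inv_ne_top.2 hγ0) (h.lintegral_dual_lt_top hq hL).ne
  have hone : ENNReal.ofReal (1 - 1 / γ) + (γ : ℝ≥0∞)⁻¹ = 1 := by
    have e : (γ : ℝ≥0∞)⁻¹ = ENNReal.ofReal (1 / γ) := by
      rw [one_div, ENNReal.ofReal_inv_of_pos (by linarith), ENNReal.ofReal_coe_nnreal]
    rw [e, ← ENNReal.ofReal_add ?_ (by positivity)]
    · simp
    · rw [sub_nonneg, div_le_one (by linarith)]; exact hγ
  refine (ENNReal.add_le_add_iff_right hfin).1 ?_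
  rw [← add_mul, hone, one_mul]
  nth_rewrite 2 [hsplit]
  gcongr
  rw [mul_comm, ← div_eq_mul_inv]
  exact ENNReal.div_le_of_le_mul' hdoub

end LocalBounds

end

namespace LocalBounds

variable {d n : ℕ} {A A' : Cube d → EuclideanSpace ℂ (Fin n) →L[ℂ] EuclideanSpace ℂ (Fin n)}
  {R R' : (Fin d → ℝ) → EuclideanSpace ℂ (Fin n) →L[ℂ] EuclideanSpace ℂ (Fin n)}
  {f : (Fin d → ℝ) → EuclideanSpace ℂ (Fin n)} {𝒟 : Set (Cube d)} {q : ℝ} {C₁ α β γ : ℝ≥0}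

/-- Estimate of the average `a_L` of `|A_L f|` over a stopping cube `L`. Hölder's inequality is
applied with the weight `σ ^ s`, where `s` counts the stopping cubes below `L`; the exponential
moments of `s` leave the decaying weight `(σ ^ (-(q - 1))) ^ s` on `|R f| ^ q`. -/
lemma topAvg_rpow_mul_volume_le (h : LocalBounds 𝒟 q C₁ α β γ A A' R R') (hq : 1 < q)
    (hf : ∀ I : Cube d, IntegrableOn f I.toSet) (hfm : AEStronglyMeasurable f volume)
    {L : Cube d} (hL : L ∈ 𝒟) (N : ℕ) :
    topAvg A f L ^ q * volume L.toSet ≤ (3 * γ) ^ (q - 1) * β ^ q *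
      ∫⁻ x in L.toSet, (ENNReal.ofReal (Real.exp (1 / (2 * γ))) ^ (-(q - 1))) ^
        stopCount (ShouldStop A A' f ((8 * C₁ + 1) * α)) (energyInc A f) N L 0 L x
          * ‖R x (f x)‖ₑ ^ q := by
  set σ := ENNReal.ofReal (Real.exp (1 / (2 * γ))) with hσ
  set s := stopCount (ShouldStop A A' f ((8 * C₁ + 1) * α)) (energyInc A f) N L 0 L with hs
  have hsm : Measurable s := measurable_stopCount _ _ _ _ _ _
  have hσ0 : σ ≠ 0 := by simp [hσ, Real.exp_pos]
  have hσtop : σ ≠ ∞ := ENNReal.ofReal_ne_top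
  have hq0 : 0 < q := by linarith
  have hq1 : 0 < q - 1 := by linarith
  have hq' : 0 < q / (q - 1) := by positivity
  have hconj : (q / (q - 1)).HolderConjugate q := (Real.HolderConjugate.conjExponent hq).symm
  set ω : (Fin d → ℝ) → ℝ≥0∞ := fun x => σ ^ s x with hω
  have hωm : Measurable ω := (measurable_from_top (f := fun k : ℕ => σ ^ k)).comp hsm
  have hω0 : ∀ x, ω x ≠ 0 := fun x => pow_ne_zero _ hσ0
  have hωtop : ∀ x, ω x ≠ ∞ := fun x => ENNReal.pow_ne_top hσtop
  set u : (Fin d → ℝ) → ℝ≥0∞ := fun x => ‖A L ∘L R' x‖ₑ with hu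
  set g : (Fin d → ℝ) → ℝ≥0∞ := fun x => ‖R x (f x)‖ₑ with hg
  have hum : AEMeasurable u volume := h.aemeasurable_enorm_comp _
  have hgm : AEMeasurable g volume :=
    (isBoundedBilinearMap_apply.continuous.comp_aestronglyMeasurable (h.meas.prodMk hfm)).enorm
  have e1 : (q - 1) / q * (q / (q - 1)) = 1 := by field_simp
  have e2 : -((q - 1) / q) * q = -(q - 1) := by field_simp
  have e3 : 1 / (q / (q - 1)) * q = q - 1 := by field_simp
  have e4 : 1 / q * q = 1 := by field_simp
  have e5 : q / (q - 1) * (q - 1) = q := by field_simp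
  have holder : topAvg A f L * volume L.toSet
      ≤ (∫⁻ x in L.toSet, u x ^ (q / (q - 1)) * ω x) ^ (1 / (q / (q - 1)))
        * (∫⁻ x in L.toSet, (σ ^ (-(q - 1))) ^ s x * g x ^ q) ^ (1 / q) := by
    rw [topAvg, normAvg_mul_volume]
    calc ∫⁻ x in L.toSet, ‖A L (f x)‖ₑ
        ≤ ∫⁻ x in L.toSet, ((fun x => u x * ω x ^ ((q - 1) / q))
            * fun x => ω x ^ (-((q - 1) / q)) * g x) x := by
          refine lintegral_mono_ae (ae_restrict_of_ae ?_)
          filter_upwards [h.left_inv_ae] with x hx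
          rw [Pi.mul_apply, mul_assoc, ← mul_assoc (ω x ^ _),
            ← ENNReal.rpow_add _ _ (hω0 x) (hωtop x), add_neg_cancel, ENNReal.rpow_zero, one_mul]
          calc ‖A L (f x)‖ₑ = ‖(A L ∘L R' x) (R x (f x))‖ₑ := by simp [hx]
            _ ≤ u x * g x := ContinuousLinearMap.le_opENorm _ _
      _ ≤ (∫⁻ x in L.toSet, (u x * ω x ^ ((q - 1) / q)) ^ (q / (q - 1))) ^ (1 / (q / (q - 1)))
          * (∫⁻ x in L.toSet, (ω x ^ (-((q - 1) / q)) * g x) ^ q) ^ (1 / q) :=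
          ENNReal.lintegral_mul_le_Lp_mul_Lq _ hconj
            (hum.mul (hωm.pow_const _).aemeasurable).restrict
            ((hωm.pow_const _).aemeasurable.mul hgm).restrict
      _ = _ := by
          congr 3
          · ext1 x
            rw [ENNReal.mul_rpow_of_nonneg _ _ hq'.le, ← ENNReal.rpow_mul, e1, ENNReal.rpow_one]
          · ext1 x
            rw [ENNReal.mul_rpow_of_nonneg _ _ hq0.le, ← ENNReal.rpow_mul, e2, hω]
            simp only
            rw [← ENNReal.rpow_natCast, ← ENNReal.rpow_natCast, ← ENNReal.rpow_mul,
              ← ENNReal.rpow_mul, mul_comm (s x : ℝ)]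
  have hmom : ∫⁻ x in L.toSet, u x ^ (q / (q - 1)) * ω x
      ≤ 3 * γ * (β ^ (q / (q - 1)) * volume L.toSet) := by
    refine (lintegral_mul_pow_stopCount_le _ _ h.child_mem hσtop (one_add_exp_mul_le h.one_le_γ)
      (fun N J hJ => h.lintegral_stoppedSet_le hq hf hL hJ N) N hL).trans ?_
    gcongr
    exact h.upper_dual L hL
  have hpow := ENNReal.rpow_le_rpow holder hq0.le
  rw [ENNReal.mul_rpow_of_nonneg _ _ hq0.le, ENNReal.mul_rpow_of_nonneg _ _ hq0.le,
    ← ENNReal.rpow_mul, ← ENNReal.rpow_mul, e3, e4, ENNReal.rpow_one] at hpow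
  have hvol0 : volume L.toSet ^ (q - 1) ≠ 0 :=
    (ENNReal.rpow_pos (pos_iff_ne_zero.2 L.volume_toSet_ne_zero) L.volume_toSet_ne_top).ne'
  have hvoltop : volume L.toSet ^ (q - 1) ≠ ∞ :=
    ENNReal.rpow_ne_top_of_nonneg hq1.le L.volume_toSet_ne_top
  have hvolq : volume L.toSet ^ q = volume L.toSet * volume L.toSet ^ (q - 1) := by
    nth_rewrite 2 [← ENNReal.rpow_one (volume L.toSet)]
    rw [← ENNReal.rpow_add _ _ L.volume_toSet_ne_zero L.volume_toSet_ne_top]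
    congr 1; ring
  refine (ENNReal.mul_le_mul_iff_left hvol0 hvoltop).1 ?_
  calc topAvg A f L ^ q * volume L.toSet * volume L.toSet ^ (q - 1)
      = topAvg A f L ^ q * volume L.toSet ^ q := by rw [hvolq, mul_assoc]
    _ ≤ _ := hpow
    _ ≤ (3 * γ * (β ^ (q / (q - 1)) * volume L.toSet)) ^ (q - 1)
        * ∫⁻ x in L.toSet, (σ ^ (-(q - 1))) ^ s x * g x ^ q := by gcongr
    _ = _ := by
        rw [ENNReal.mul_rpow_of_nonneg (3 * (γ : ℝ≥0∞)) _ hq1.le,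
          ENNReal.mul_rpow_of_nonneg _ (volume L.toSet) hq1.le, ← ENNReal.rpow_mul, e5]
        ring

lemma lintegral_chain_le (h : LocalBounds 𝒟 q C₁ α β γ A A' R R') (hq : 1 < q)
    (hf : ∀ I : Cube d, IntegrableOn f I.toSet) (hfm : AEStronglyMeasurable f volume)
    {T : Cube d} (hT : T ∈ 𝒟) (N : ℕ) :
    ∫⁻ x in T.toSet, ((3 / 2) ^ stopCount (ShouldStop A A' f ((8 * C₁ + 1) * α)) (energyInc A f)
          N T 0 T x * topAvg A f T ^ q
        + stopSum (ShouldStop A A' f ((8 * C₁ + 1) * α)) (energyInc A f)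
          (fun s L => (3 / 2) ^ s * topAvg A f L ^ q) N T 0 T x)
      ≤ 4 * ((3 * γ) ^ (q - 1) * β ^ q) * (ENNReal.ofReal (1 + 2 / (q - 1)) * γ)
        * ∫⁻ x in T.toSet, ‖R x (f x)‖ₑ ^ q := by
  set σ := ENNReal.ofReal (Real.exp (1 / (2 * γ))) with hσ
  set c := (3 * (γ : ℝ≥0∞)) ^ (q - 1) * β ^ q with hc
  have hctop : c ≠ ∞ := ENNReal.mul_ne_top
    (ENNReal.rpow_ne_top_of_nonneg (by linarith) (by finiteness))
    (ENNReal.rpow_ne_top_of_nonneg (by linarith) (by finiteness))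
  have h32 : (3 / 2 : ℝ≥0∞) ≠ ∞ := by finiteness
  have hmom : (1 : ℝ≥0∞) + 3 / 2 * 4 * 2⁻¹ ≤ 4 := by
    rw [show (3 / 2 * 4 * 2⁻¹ : ℝ≥0∞) = 3 by
      rw [ENNReal.div_eq_inv_mul,
        show (2⁻¹ * 3 * 4 * 2⁻¹ : ℝ≥0∞) = (2⁻¹ * 2) * (2⁻¹ * 2) * 3 by ring,
        ENNReal.inv_mul_cancel (by norm_num) (by norm_num)]; norm_num]
    norm_num
  have hw : ∀ N, ∀ L ∈ 𝒟, ∫⁻ x in L.toSet, (fun s L => (3 / 2) ^ s * topAvg A f L ^ q)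
        (stopCount (ShouldStop A A' f ((8 * C₁ + 1) * α)) (energyInc A f) N L 0 L x) L
      ≤ 4 * c * ∫⁻ x in L.toSet, (σ ^ (-(q - 1))) ^ stopCount
        (ShouldStop A A' f ((8 * C₁ + 1) * α)) (energyInc A f) N L 0 L x * ‖R x (f x)‖ₑ ^ q := by
    intro N L hL
    have hcount := lintegral_mul_pow_stopCount_le (ShouldStop A A' f ((8 * C₁ + 1) * α))
      (energyInc A f) h.child_mem (v := 1) h32 hmom
      (fun N J hJ => by simpa using h.volume_stoppedSet_le hq hf hJ N) N hL
    simp only [Pi.one_apply, one_mul, setLIntegral_one] at hcount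
    have hm : Measurable fun x => (3 / 2 : ℝ≥0∞) ^ stopCount
        (ShouldStop A A' f ((8 * C₁ + 1) * α)) (energyInc A f) N L 0 L x :=
      (measurable_from_top (f := fun k : ℕ => (3 / 2 : ℝ≥0∞) ^ k)).comp
        (measurable_stopCount _ _ _ _ _ _)
    simp only
    rw [lintegral_mul_const _ hm]
    calc _ ≤ 4 * volume L.toSet * topAvg A f L ^ q := by gcongr
      _ = 4 * (topAvg A f L ^ q * volume L.toSet) := by ring
      _ ≤ _ := by
        rw [mul_assoc 4 c]
        exact mul_le_mul_right (h.topAvg_rpow_mul_volume_le hq hf hfm hL N) 4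
  rw [lintegral_add_right _ (measurable_stopSum _ _ _ _ _ _ _)]
  calc _ ≤ 4 * c * (∫⁻ x in T.toSet, (σ ^ (-(q - 1))) ^ stopCount
          (ShouldStop A A' f ((8 * C₁ + 1) * α)) (energyInc A f) N T 0 T x * ‖R x (f x)‖ₑ ^ q)
        + 4 * c * ∫⁻ x in T.toSet, (∑ j ∈ Finset.range (stopCount
          (ShouldStop A A' f ((8 * C₁ + 1) * α)) (energyInc A f) N T 0 T x),
            (σ ^ (-(q - 1))) ^ j) * ‖R x (f x)‖ₑ ^ q :=
        add_le_add (hw N T hT) (lintegral_stopSum_le _ _ h.child_mem hw N T 0 hT)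
    _ ≤ 4 * c * ∫⁻ x in T.toSet, ((σ ^ (-(q - 1))) ^ stopCount
          (ShouldStop A A' f ((8 * C₁ + 1) * α)) (energyInc A f) N T 0 T x * ‖R x (f x)‖ₑ ^ q
        + (∑ j ∈ Finset.range (stopCount
          (ShouldStop A A' f ((8 * C₁ + 1) * α)) (energyInc A f) N T 0 T x),
            (σ ^ (-(q - 1))) ^ j) * ‖R x (f x)‖ₑ ^ q) := by
        rw [← mul_add]; gcongr; exact le_lintegral_add _ _
    _ ≤ 4 * c * ∫⁻ x in T.toSet, (ENNReal.ofReal (1 + 2 / (q - 1)) * γ) * ‖R x (f x)‖ₑ ^ q := by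
        gcongr with x
        rw [← add_mul, ← Finset.sum_range_succ_comm]
        gcongr
        refine (ENNReal.sum_le_tsum _).trans ?_
        rw [ENNReal.tsum_geometric]
        exact inv_one_sub_exp_le h.one_le_γ hq
    _ = _ := by
        rw [lintegral_const_mul' _ _ (by finiteness)]; ring

/-- The local square function estimate, uniformly in the number of generations. -/
theorem lintegral_squareSum_le (h : LocalBounds 𝒟 q C₁ α β γ A A' R R') (hq : 1 < q)
    (hf : ∀ I : Cube d, IntegrableOn f I.toSet) (hfm : AEStronglyMeasurable f volume)
    {T : Cube d} (hT : T ∈ 𝒟) (N : ℕ) :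
    ∫⁻ x in T.toSet, squareSum A f N T x ^ (q / 2)
      ≤ localConst d q C₁ * (α * β * γ) ^ q * ∫⁻ x in T.toSet, ‖R x (f x)‖ₑ ^ q := by
  have hq0 : 0 < q := by linarith
  have hq1 : 0 < q - 1 := by linarith
  have hq2 : 0 < q / 2 := by linarith
  set lam : ℝ≥0∞ := (8 * C₁ + 1) * α with hlam
  have hα : (1 : ℝ≥0∞) ≤ α := by exact_mod_cast h.one_le_α
  have hlam1 : 1 ≤ lam := one_le_mul le_add_self hα
  set κ : ℝ≥0∞ := ((1 - (3 / 2) ^ (-(1 / (q - 1))))⁻¹) ^ (q - 1) with hκ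
  set C₂ : ℝ≥0∞ := lam ^ q * (320 * 4 ^ d) ^ (q / 2) * κ with hC₂
  have hpt : ∀ x ∈ T.toSet, squareSum A f N T x ^ (q / 2) ≤ C₂ *
      ((3 / 2) ^ stopCount (ShouldStop A A' f lam) (energyInc A f) N T 0 T x * topAvg A f T ^ q
        + stopSum (ShouldStop A A' f lam) (energyInc A f)
          (fun s L => (3 / 2) ^ s * topAvg A f L ^ q) N T 0 T x) := by
    intro x hx
    have h1 := squareSum_le h.right_inv h.left_inv hlam1 hf N T 0
      (not_shouldStop_self h.right_inv hlam1 T) hx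
    rw [mul_zero, add_zero] at h1
    have h2 : topAvg A f T ^ 2 + stopSum (ShouldStop A A' f lam) (energyInc A f)
          (fun _ L => topAvg A f L ^ 2) N T 0 T x
        ≤ (topAvg A f T + stopSum (ShouldStop A A' f lam) (energyInc A f)
          (fun _ L => topAvg A f L) N T 0 T x) ^ 2 := by
      rw [add_sq]
      exact add_le_add le_self_add (stopSum_sq_le _ _ _ _ _ _ hx)
    have h3 := add_stopSum_rpow_le (ShouldStop A A' f lam) (energyInc A f) hq (θ := 3 / 2)
      (by simp) (by finiteness) (topAvg A f) N hx
    have hsq : ∀ y : ℝ≥0∞, (y ^ 2) ^ (q / 2) = y ^ q := fun y => by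
      rw [← ENNReal.rpow_natCast, ← ENNReal.rpow_mul]; congr 1; push_cast; ring
    calc squareSum A f N T x ^ (q / 2)
        ≤ (lam ^ 2 * (320 * 4 ^ d) * (topAvg A f T + stopSum (ShouldStop A A' f lam)
            (energyInc A f) (fun _ L => topAvg A f L) N T 0 T x) ^ 2) ^ (q / 2) := by
          gcongr
          exact h1.trans (by gcongr)
      _ = lam ^ q * (320 * 4 ^ d) ^ (q / 2) * (topAvg A f T + stopSum (ShouldStop A A' f lam)
            (energyInc A f) (fun _ L => topAvg A f L) N T 0 T x) ^ q := by
          rw [ENNReal.mul_rpow_of_nonneg _ _ hq2.le, ENNReal.mul_rpow_of_nonneg _ _ hq2.le, hsq,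
            hsq]
      _ ≤ _ := by rw [hC₂, mul_assoc (lam ^ q * _)]; gcongr
  have hm : Measurable fun x =>
      ((3 / 2 : ℝ≥0∞) ^ stopCount (ShouldStop A A' f lam) (energyInc A f) N T 0 T x
        * topAvg A f T ^ q
        + stopSum (ShouldStop A A' f lam) (energyInc A f)
          (fun s L => (3 / 2) ^ s * topAvg A f L ^ q) N T 0 T x) :=
    (((measurable_from_top (f := fun k : ℕ => (3 / 2 : ℝ≥0∞) ^ k)).comp
      (measurable_stopCount _ _ _ _ _ _)).mul_const _).add (measurable_stopSum _ _ _ _ _ _ _)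
  calc ∫⁻ x in T.toSet, squareSum A f N T x ^ (q / 2) ≤ _ :=
        setLIntegral_mono' T.measurableSet_toSet hpt
    _ = C₂ * _ := lintegral_const_mul _ hm
    _ ≤ C₂ * (4 * ((3 * γ) ^ (q - 1) * β ^ q) * (ENNReal.ofReal (1 + 2 / (q - 1)) * γ)
        * ∫⁻ x in T.toSet, ‖R x (f x)‖ₑ ^ q) := by
        gcongr; exact h.lintegral_chain_le hq hf hfm hT N
    _ = _ := by
        have hγq : (γ : ℝ≥0∞) ^ q = γ ^ (q - 1) * γ := by
          nth_rewrite 3 [← ENNReal.rpow_one (γ : ℝ≥0∞)]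
          rw [← ENNReal.rpow_add_of_nonneg _ _ hq1.le (by norm_num)]
          congr 1; ring
        rw [hC₂, hlam, localConst, ENNReal.mul_rpow_of_nonneg _ _ hq0.le,
          ENNReal.mul_rpow_of_nonneg _ _ hq0.le, ENNReal.mul_rpow_of_nonneg _ _ hq0.le,
          ENNReal.mul_rpow_of_nonneg _ _ hq1.le, hγq, ← hκ]
        ring

end LocalBounds

/-! ### The generations of a dyadic grid and the global square function estimate -/

/-- The cubes of side length `2 ^ k` of a family of cubes. -/
def level {d : ℕ} (𝒟 : Set (Cube d)) (k : ℤ) : Set (Cube d) := {I ∈ 𝒟 | I.side = (2 : ℝ) ^ k}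

namespace IsDyadicGrid

variable {d : ℕ} {𝒟 : Set (Cube d)}

/-- The cube of side length `2 ^ k` of the grid which contains `x`. -/
noncomputable def cubeAt (h𝒟 : IsDyadicGrid 𝒟) (k : ℤ) (x : Fin d → ℝ) : Cube d :=
  (h𝒟.partition k x).choose

variable (h𝒟 : IsDyadicGrid 𝒟)

include h𝒟

lemma cubeAt_mem (k : ℤ) (x : Fin d → ℝ) : h𝒟.cubeAt k x ∈ 𝒟 :=
  (h𝒟.partition k x).choose_spec.1.1

lemma side_cubeAt (k : ℤ) (x : Fin d → ℝ) : (h𝒟.cubeAt k x).side = 2 ^ k :=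
  (h𝒟.partition k x).choose_spec.1.2.1

lemma mem_cubeAt (k : ℤ) (x : Fin d → ℝ) : x ∈ (h𝒟.cubeAt k x).toSet :=
  (h𝒟.partition k x).choose_spec.1.2.2

lemma cubeAt_mem_level (k : ℤ) (x : Fin d → ℝ) : h𝒟.cubeAt k x ∈ level 𝒟 k :=
  ⟨h𝒟.cubeAt_mem k x, h𝒟.side_cubeAt k x⟩

lemma eq_cubeAt {k : ℤ} {x : Fin d → ℝ} {I : Cube d} (hI : I ∈ level 𝒟 k) (hx : x ∈ I.toSet) :
    I = h𝒟.cubeAt k x :=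
  h𝒟.eq_of_mem hI.1 (h𝒟.cubeAt_mem k x) (hI.2.trans (h𝒟.side_cubeAt k x).symm) hx
    (h𝒟.mem_cubeAt k x)

lemma child_cubeAt (hd : 0 < d) (k : ℤ) (x : Fin d → ℝ) :
    (h𝒟.cubeAt k x).child ((h𝒟.cubeAt k x).childIdx x) = h𝒟.cubeAt (k - 1) x := by
  refine h𝒟.eq_cubeAt ⟨h𝒟.child_mem hd (h𝒟.cubeAt_mem k x) _, ?_⟩
    (Cube.mem_child_childIdx (h𝒟.mem_cubeAt k x))
  rw [Cube.child_side, h𝒟.side_cubeAt, zpow_sub_one₀ (by norm_num)]; rfl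

lemma child_mem_level (hd : 0 < d) {k : ℤ} {I : Cube d} (hI : I ∈ level 𝒟 k)
    (η : Fin d → Fin 2) : I.child η ∈ level 𝒟 (k - 1) := by
  refine ⟨h𝒟.child_mem hd hI.1 η, ?_⟩
  rw [Cube.child_side, hI.2, zpow_sub_one₀ (by norm_num)]; rfl

lemma pairwise_disjoint_level (k : ℤ) :
    Pairwise (Function.onFun Disjoint fun I : level 𝒟 k => (I : Cube d).toSet) := by
  intro I J hne
  refine Set.disjoint_left.2 fun x hx hx' => hne (Subtype.ext ?_)
  rw [h𝒟.eq_cubeAt I.2 hx, h𝒟.eq_cubeAt J.2 hx']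

lemma iUnion_level (k : ℤ) : ⋃ I : level 𝒟 k, (I : Cube d).toSet = Set.univ :=
  Set.eq_univ_of_forall fun x =>
    Set.mem_iUnion.2 ⟨⟨_, h𝒟.cubeAt_mem_level k x⟩, h𝒟.mem_cubeAt k x⟩

lemma countable_level (k : ℤ) : Countable (level 𝒟 k) := by
  have h : Set.Countable (Set.univ : Set (level 𝒟 k)) := by
    refine Set.PairwiseDisjoint.countable_of_nonempty_interior
      (s := fun I : level 𝒟 k => (I : Cube d).toSet)
      (fun I _ J _ hne => h𝒟.pairwise_disjoint_level k hne) fun I _ => ?_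
    have hs := (I : Cube d).side_pos
    refine ⟨fun i => (I : Cube d).corner i + (I : Cube d).side / 2, ?_⟩
    rw [mem_interior]
    refine ⟨Set.pi Set.univ fun i => Set.Ioo ((I : Cube d).corner i)
      ((I : Cube d).corner i + (I : Cube d).side), ?_, ?_, ?_⟩
    · rw [Cube.toSet_eq_pi]
      exact Set.pi_mono fun i _ => Set.Ioo_subset_Ico_self
    · exact isOpen_set_pi Set.finite_univ fun i _ => isOpen_Ioo
    · intro i _
      constructor <;> dsimp only <;> linarith
  exact Set.countable_univ_iff.1 h

lemma countable : Countable 𝒟 := by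
  have h : 𝒟 ⊆ ⋃ k : ℤ, level 𝒟 k := fun I hI => by
    obtain ⟨k, hk⟩ := h𝒟.side_eq I hI
    exact Set.mem_iUnion.2 ⟨k, hI, hk⟩
  exact ((Set.countable_iUnion fun k =>
    Set.countable_coe_iff.1 (h𝒟.countable_level k)).mono h).to_subtype

lemma lintegral_eq_tsum_level (k : ℤ) (φ : (Fin d → ℝ) → ℝ≥0∞) :
    ∫⁻ x, φ x = ∑' I : level 𝒟 k, ∫⁻ x in (I : Cube d).toSet, φ x := by
  have := h𝒟.countable_level k
  rw [← lintegral_iUnion (fun I : level 𝒟 k => (I : Cube d).measurableSet_toSet)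
    (h𝒟.pairwise_disjoint_level k), h𝒟.iUnion_level, Measure.restrict_univ]

lemma measurable_comp_cubeAt {α : Type*} [MeasurableSpace α] (k : ℤ) (φ : Cube d → α) :
    Measurable fun x => φ (h𝒟.cubeAt k x) := by
  intro s _
  have h : (fun x => φ (h𝒟.cubeAt k x)) ⁻¹' s = ⋃ I ∈ {I ∈ level 𝒟 k | φ I ∈ s}, I.toSet := by
    ext x
    simp only [Set.mem_preimage, Set.mem_iUnion, exists_prop]
    constructor
    · exact fun hx => ⟨_, ⟨h𝒟.cubeAt_mem_level k x, hx⟩, h𝒟.mem_cubeAt k x⟩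
    · rintro ⟨I, ⟨hI, hs⟩, hx⟩
      rwa [← h𝒟.eq_cubeAt hI hx]
  rw [h]
  have hc : (level 𝒟 k).Countable := h𝒟.countable_level k
  exact MeasurableSet.biUnion (hc.mono fun I hI => hI.1) fun I _ => I.measurableSet_toSet

lemma tsum_indicator (φ : Cube d → ℝ≥0∞) (x : Fin d → ℝ) :
    ∑' I : 𝒟, φ I * (I : Cube d).toSet.indicator 1 x = ∑' k : ℤ, φ (h𝒟.cubeAt k x) := by
  have hinj : Function.Injective fun k : ℤ => (⟨_, h𝒟.cubeAt_mem k x⟩ : 𝒟) := by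
    intro k l hkl
    have h1 : h𝒟.cubeAt k x = h𝒟.cubeAt l x := congrArg Subtype.val hkl
    have h2 := h𝒟.side_cubeAt k x
    rw [h1, h𝒟.side_cubeAt] at h2
    exact (zpow_right_injective₀ (by norm_num) (by norm_num) h2).symm
  rw [← hinj.tsum_eq]
  · exact tsum_congr fun k => by simp [h𝒟.mem_cubeAt k x]
  · intro I hI
    have hx : x ∈ (I : Cube d).toSet := by
      by_contra hx
      exact hI (by simp [hx])
    obtain ⟨k, hk⟩ := h𝒟.side_eq I I.2
    exact ⟨k, Subtype.ext (h𝒟.eq_cubeAt ⟨I.2, hk⟩ hx).symm⟩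

lemma squareSum_cubeAt {n : ℕ} (hd : 0 < d)
    (A : Cube d → EuclideanSpace ℂ (Fin n) →L[ℂ] EuclideanSpace ℂ (Fin n))
    (f : (Fin d → ℝ) → EuclideanSpace ℂ (Fin n)) (N : ℕ) (k : ℤ) (x : Fin d → ℝ) :
    squareSum A f N (h𝒟.cubeAt k x) x = ∑ m ∈ Finset.range N,
      haarEnergy (fun y => A (h𝒟.cubeAt (k - m) x) (f y)) (h𝒟.cubeAt (k - m) x) := by
  induction N generalizing k with
  | zero => rfl
  | succ N ih =>
    simp only [squareSum]
    rw [Finset.sum_range_succ', h𝒟.child_cubeAt hd, ih, add_comm]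
    congr 1
    · refine Finset.sum_congr rfl fun m _ => ?_
      rw [show k - 1 - (m : ℤ) = k - ((m + 1 : ℕ) : ℤ) by push_cast; ring]
    · simp

/-- The global square function estimate, by exhausting the grid with finitely many generations. -/
theorem lintegral_tsum_haarEnergy_le {n : ℕ} (hd : 0 < d)
    {A A' : Cube d → EuclideanSpace ℂ (Fin n) →L[ℂ] EuclideanSpace ℂ (Fin n)}
    {R R' : (Fin d → ℝ) → EuclideanSpace ℂ (Fin n) →L[ℂ] EuclideanSpace ℂ (Fin n)}
    {f : (Fin d → ℝ) → EuclideanSpace ℂ (Fin n)} {q : ℝ} {C₁ α β γ : ℝ≥0}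
    (h : LocalBounds 𝒟 q C₁ α β γ A A' R R') (hq : 1 < q)
    (hf : ∀ I : Cube d, IntegrableOn f I.toSet) (hfm : AEStronglyMeasurable f volume) :
    ∫⁻ x, (∑' I : 𝒟, haarEnergy (fun y => A I (f y)) I * (I : Cube d).toSet.indicator 1 x)
        ^ (q / 2)
      ≤ localConst d q C₁ * (α * β * γ) ^ q * ∫⁻ x, ‖R x (f x)‖ₑ ^ q := by
  have hq2 : 0 < q / 2 := by linarith
  set e : ℤ → (Fin d → ℝ) → ℝ≥0∞ := fun k x =>
    haarEnergy (fun y => A (h𝒟.cubeAt k x) (f y)) (h𝒟.cubeAt k x) with he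
  have hem : ∀ k, Measurable (e k) := fun k =>
    h𝒟.measurable_comp_cubeAt k fun I => haarEnergy (fun y => A I (f y)) I
  set y : ℕ → (Fin d → ℝ) → ℝ≥0∞ := fun M x =>
    ∑ m ∈ Finset.range (2 * M + 1), e (M - m) x with hy
  have hy' : ∀ M x, y M x = ∑ k ∈ Finset.Icc (-(M : ℤ)) M, e k x := by
    intro M x
    refine Finset.sum_bij (fun m _ => (M : ℤ) - m) ?_ ?_ ?_ ?_
    · intro m hm; simp only [Finset.mem_range, Finset.mem_Icc] at hm ⊢; omega
    · intro a _ b _ hab; simpa using hab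
    · intro k hk
      simp only [Finset.mem_Icc] at hk
      exact ⟨(M - k).toNat, by simp only [Finset.mem_range]; omega, by omega⟩
    · intro m _; rfl
  have hmono : Monotone fun M : ℕ => Finset.Icc (-(M : ℤ)) M := fun M M' hM =>
    Finset.Icc_subset_Icc (by omega) (by omega)
  have htend : ∀ x, Filter.Tendsto (fun M => y M x ^ (q / 2)) Filter.atTop
      (nhds ((∑' I : 𝒟, haarEnergy (fun y => A I (f y)) I
        * (I : Cube d).toSet.indicator 1 x) ^ (q / 2))) := by
    intro x
    rw [h𝒟.tsum_indicator (fun I => haarEnergy (fun y => A I (f y)) I)]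
    refine (ENNReal.continuous_rpow_const.tendsto _).comp ?_
    simp_rw [hy']
    refine (ENNReal.summable (f := fun k => e k x)).hasSum.comp
      (Filter.tendsto_atTop_finset_of_monotone hmono fun k => ⟨k.natAbs, ?_⟩)
    rw [Finset.mem_Icc]; omega
  have hlim := lintegral_tendsto_of_tendsto_of_monotone (μ := volume)
    (fun M => ((Finset.measurable_sum _ fun m _ => hem _).pow_const (q / 2)).aemeasurable
      (f := fun x => y M x ^ (q / 2)))
    (ae_of_all _ fun x M M' hM => by
      simp only [hy']
      gcongr) (ae_of_all _ htend)
  refine le_of_tendsto' hlim fun M => ?_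
  rw [h𝒟.lintegral_eq_tsum_level M, h𝒟.lintegral_eq_tsum_level M (fun x => ‖R x (f x)‖ₑ ^ q),
    ← ENNReal.tsum_mul_left]
  refine ENNReal.tsum_le_tsum fun J => ?_
  refine le_trans (le_of_eq ?_) (h.lintegral_squareSum_le hq hf hfm J.2.1 (2 * M + 1))
  refine setLIntegral_congr_fun (J : Cube d).measurableSet_toSet fun x hx => ?_
  rw [h𝒟.eq_cubeAt J.2 hx, h𝒟.squareSum_cubeAt hd]

end IsDyadicGrid

/-! ### Powers of positive definite matrices -/

section MatPow

variable {n : ℕ}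

lemma act_mul (A B : Matrix (Fin n) (Fin n) ℂ) : act (A * B) = act A ∘L act B :=
  map_mul (Matrix.toEuclideanCLM (n := Fin n) (𝕜 := ℂ)) A B

lemma act_one : act (1 : Matrix (Fin n) (Fin n) ℂ) = ContinuousLinearMap.id ℂ _ :=
  map_one (Matrix.toEuclideanCLM (n := Fin n) (𝕜 := ℂ))

lemma continuous_act : Continuous fun A : Matrix (Fin n) (Fin n) ℂ => act A :=
  LinearMap.continuous_of_finiteDimensional
    ((Matrix.toEuclideanCLM (n := Fin n) (𝕜 := ℂ)).toAlgEquiv.toLinearMap)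

lemma isSelfAdjoint_act {A : Matrix (Fin n) (Fin n) ℂ} (hA : IsSelfAdjoint A) :
    IsSelfAdjoint (act A) :=
  hA.map (Matrix.toEuclideanCLM (n := Fin n) (𝕜 := ℂ))

lemma isSelfAdjoint_matPow (A : Matrix (Fin n) (Fin n) ℂ) (r : ℝ) : IsSelfAdjoint (matPow A r) :=
  cfc_predicate _ _

lemma matPow_mul_matPow_neg {A : Matrix (Fin n) (Fin n) ℂ} (hA : A.PosDef) (r : ℝ) :
    matPow A r * matPow A (-r) = 1 := by
  have hsp : spectrum ℝ A = Set.range hA.isHermitian.eigenvalues :=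
    hA.isHermitian.spectrum_real_eq_range_eigenvalues
  have hpos : ∀ t ∈ spectrum ℝ A, 0 < t := by
    rw [hsp]
    rintro _ ⟨i, rfl⟩
    exact hA.eigenvalues_pos i
  have hc : ∀ s : ℝ, ContinuousOn (fun t : ℝ => t ^ s) (spectrum ℝ A) := fun s t ht =>
    (Real.continuousAt_rpow_const _ _ (Or.inl (hpos t ht).ne')).continuousWithinAt
  rw [matPow, matPow, ← cfc_mul _ _ A (hc r) (hc (-r)),
    ← cfc_const_one ℝ A hA.isHermitian.isSelfAdjoint]
  refine cfc_congr fun t ht => ?_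
  rw [← Real.rpow_add (hpos t ht), add_neg_cancel, Real.rpow_zero]

/-- Powers of positive definite matrices are limits of one fixed sequence of polynomials; this makes
them measurable functions of the matrix. -/
lemma exists_polynomial_tendsto_matPow (n : ℕ) (r : ℝ) :
    ∃ P : ℕ → Polynomial ℝ, ∀ A : Matrix (Fin n) (Fin n) ℂ, A.PosDef →
      Filter.Tendsto (fun m => Polynomial.aeval A (P m)) Filter.atTop (nhds (matPow A r)) := by
  have hex : ∀ m : ℕ, ∃ P : Polynomial ℝ, ∀ t ∈ Set.Icc (1 / ((m : ℝ) + 1)) (m + 1),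
      |P.eval t - t ^ r| < 1 / ((m : ℝ) + 1) := fun m => by
    refine exists_polynomial_near_of_continuousOn _ _ (fun t : ℝ => t ^ r) ?_ _ (by positivity)
    intro t ht
    have : (0 : ℝ) < t := lt_of_lt_of_le (by positivity) ht.1
    exact (Real.continuousAt_rpow_const _ _ (Or.inl this.ne')).continuousWithinAt
  choose P hP using hex
  refine ⟨P, fun A hA => ?_⟩
  have hscal : ∀ t : ℝ, 0 < t →
      Filter.Tendsto (fun m => (P m).eval t) Filter.atTop (nhds (t ^ r)) := by
    intro t ht
    rw [tendsto_iff_dist_tendsto_zero]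
    refine squeeze_zero' (Filter.Eventually.of_forall fun m => dist_nonneg) ?_
      tendsto_one_div_add_atTop_nhds_zero_nat
    have h1 : ∀ᶠ m : ℕ in Filter.atTop, 1 / ((m : ℝ) + 1) < t :=
      tendsto_one_div_add_atTop_nhds_zero_nat.eventually (gt_mem_nhds ht)
    have h2 : ∀ᶠ m : ℕ in Filter.atTop, t ≤ (m : ℝ) :=
      tendsto_natCast_atTop_atTop.eventually_ge_atTop t
    filter_upwards [h1, h2] with m hm1 hm2
    exact (hP m t ⟨hm1.le, by linarith⟩).le
  have hcfc : ∀ m, Polynomial.aeval A (P m) = hA.isHermitian.cfc fun t => (P m).eval t :=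
      fun m => by
    rw [← cfc_polynomial (P m) A hA.isHermitian.isSelfAdjoint, hA.isHermitian.cfc_eq]
  simp_rw [hcfc]
  rw [matPow, hA.isHermitian.cfc_eq]
  simp only [Matrix.IsHermitian.cfc, Unitary.conjStarAlgAut_apply]
  have hdiag : Filter.Tendsto (fun m => Matrix.diagonal
      ((RCLike.ofReal : ℝ → ℂ) ∘ (fun t => (P m).eval t) ∘ hA.isHermitian.eigenvalues))
      Filter.atTop (nhds (Matrix.diagonal
        ((RCLike.ofReal : ℝ → ℂ) ∘ (fun t : ℝ => t ^ r) ∘ hA.isHermitian.eigenvalues))) := by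
    refine (Continuous.matrix_diagonal continuous_id).continuousAt.tendsto.comp ?_
    refine tendsto_pi_nhds.2 fun i => ?_
    exact (RCLike.continuous_ofReal.tendsto _).comp (hscal _ (hA.eigenvalues_pos i))
  exact (hdiag.const_mul _).mul_const _

lemma aestronglyMeasurable_act_matPow {d : ℕ} {W : (Fin d → ℝ) → Matrix (Fin n) (Fin n) ℂ}
    (hW : ∀ i j, AEMeasurable (fun x => W x i j) volume) (hpos : ∀ᵐ x, (W x).PosDef) (r : ℝ) :
    AEStronglyMeasurable (fun x => act (matPow (W x) r)) volume := by
  obtain ⟨P, hP⟩ := exists_polynomial_tendsto_matPow n r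
  have h0 : AEStronglyMeasurable (fun x => act (W x)) volume := by
    have hW' : AEMeasurable (fun x i j => W x i j) volume :=
      aemeasurable_pi_iff.2 fun i => aemeasurable_pi_iff.2 fun j => hW i j
    exact (continuous_act (n := n)).comp_aestronglyMeasurable hW'.aestronglyMeasurable
  refine aestronglyMeasurable_of_tendsto_ae Filter.atTop
    (f := fun m x => act (Polynomial.aeval (W x) (P m))) (fun m => ?_) ?_
  · have : ∀ x, act (Polynomial.aeval (W x) (P m)) = Polynomial.aeval (act (W x)) (P m) := fun x =>
      (Polynomial.aeval_algHom_apply ((Matrix.toEuclideanCLM (n := Fin n)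
        (𝕜 := ℂ)).toAlgEquiv.toAlgHom.restrictScalars ℝ) (W x) (P m)).symm
    simp_rw [this]
    exact (Polynomial.continuous_aeval (P m)).comp_aestronglyMeasurable h0
  · filter_upwards [hpos] with x hx
    exact (continuous_act.tendsto _).comp (hP _ hx)

end MatPow

/-! ### Operator norms and reducing matrices -/

/-- The space `ℂ^n` with its Euclidean norm. -/
notation:max "𝔼" n:max => EuclideanSpace ℂ (Fin n)

section Op

variable {n : ℕ}

lemma enorm_comp_comm {B C : 𝔼 n →L[ℂ] 𝔼 n} (hB : IsSelfAdjoint B) (hC : IsSelfAdjoint C) :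
    ‖B ∘L C‖ₑ = ‖C ∘L B‖ₑ := by
  have h : star (B * C) = C * B := by rw [star_mul, hB.star_eq, hC.star_eq]
  rw [← ContinuousLinearMap.mul_def, ← ContinuousLinearMap.mul_def, ← h, ← ofReal_norm,
    ← ofReal_norm, ContinuousLinearMap.star_eq_adjoint, LinearIsometryEquiv.norm_map]

lemma inner_apply_comm {B : 𝔼 n →L[ℂ] 𝔼 n} (hB : IsSelfAdjoint B) (v w : 𝔼 n) :
    inner ℂ (B v) w = inner ℂ v (B w) := by
  rw [ContinuousLinearMap.isSelfAdjoint_iff'] at hB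
  nth_rewrite 1 [← hB]
  exact ContinuousLinearMap.adjoint_inner_left B w v

lemma enorm_inner_le (v w : 𝔼 n) : ‖inner ℂ v w‖ₑ ≤ ‖v‖ₑ * ‖w‖ₑ := by
  rw [← ofReal_norm, ← ofReal_norm, ← ofReal_norm, ← ENNReal.ofReal_mul (norm_nonneg _)]
  exact ENNReal.ofReal_le_ofReal (norm_inner_le_norm v w)

lemma enorm_sq_eq_enorm_inner (v : 𝔼 n) : ‖v‖ₑ ^ 2 = ‖inner ℂ v v‖ₑ := by
  rw [inner_self_eq_norm_sq_to_K, enorm_pow]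
  congr 1
  rw [← ofReal_norm, ← ofReal_norm, RCLike.norm_ofReal, abs_norm]

/-- The operator norm is controlled by the images of the standard basis. -/
lemma opENorm_rpow_le_sum {s : ℝ} (hs : 1 ≤ s) (B : 𝔼 n →L[ℂ] 𝔼 n) :
    ‖B‖ₑ ^ s ≤ (n : ℝ≥0∞) ^ (s - 1) * ∑ i, ‖B (EuclideanSpace.basisFun (Fin n) ℂ i)‖ₑ ^ s := by
  have h : ‖B‖ₑ ≤ ∑ i, ‖B (EuclideanSpace.basisFun (Fin n) ℂ i)‖ₑ := by
    have h1 : ‖B‖ ≤ ∑ i, ‖B (EuclideanSpace.basisFun (Fin n) ℂ i)‖ := by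
      refine B.opNorm_le_bound (Finset.sum_nonneg fun _ _ => norm_nonneg _) fun v => ?_
      have hv : B v = ∑ i, v i • B (EuclideanSpace.basisFun (Fin n) ℂ i) := by
        conv_lhs => rw [← (EuclideanSpace.basisFun (Fin n) ℂ).sum_repr v, map_sum]
        simp_rw [map_smul, EuclideanSpace.basisFun_repr]
      rw [hv, Finset.sum_mul]
      refine (norm_sum_le _ _).trans (Finset.sum_le_sum fun i _ => ?_)
      rw [norm_smul, mul_comm]
      gcongr
      exact PiLp.norm_apply_le v i
    rw [← ofReal_norm]
    refine (ENNReal.ofReal_le_ofReal h1).trans (le_of_eq ?_)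
    rw [ENNReal.ofReal_sum_of_nonneg fun _ _ => norm_nonneg _]
    simp_rw [ofReal_norm]
  refine (ENNReal.rpow_le_rpow h (by linarith)).trans ?_
  refine (ENNReal.rpow_sum_le_const_mul_sum_rpow _ _ hs).trans (le_of_eq ?_)
  rw [Finset.card_univ, Fintype.card_fin]

end Op

section Weight

variable {d n : ℕ}

lemma enorm_basisFun (i : Fin n) : ‖EuclideanSpace.basisFun (Fin n) ℂ i‖ₑ = 1 := by
  rw [← ofReal_norm, OrthonormalBasis.norm_eq_one, ENNReal.ofReal_one]

/-- The factors `R = W ^ (1 / p)` and `R' = W ^ (-1 / p)` of a matrix `A_p` weight, as operators,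
together with the `A_p` condition with constant `X`. -/
structure WeightFactors (p : ℝ) (X : ℝ≥0) (R R' : (Fin d → ℝ) → 𝔼 n →L[ℂ] 𝔼 n) : Prop where
  meas : AEStronglyMeasurable R volume
  meas' : AEStronglyMeasurable R' volume
  selfAdjoint : ∀ x, IsSelfAdjoint (R x)
  selfAdjoint' : ∀ x, IsSelfAdjoint (R' x)
  left_inv_ae : ∀ᵐ x, ∀ v, R' x (R x v) = v
  right_inv_ae : ∀ᵐ x, ∀ v, R x (R' x v) = v
  ap : ∀ I : Cube d, ∫⁻ x in I.toSet,
    (∫⁻ t in I.toSet, ‖R x ∘L R' t‖ₑ ^ (p / (p - 1))) ^ (p - 1) ≤ X * volume I.toSet ^ p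

/-- Invertible self-adjoint operators `B I` with inverses `B' I` which are reducing operators, with
constant `K`, for the cubes of the family `𝒟`. -/
structure ReducingFamily (p : ℝ) (K : ℝ≥0) (𝒟 : Set (Cube d)) (R : (Fin d → ℝ) → 𝔼 n →L[ℂ] 𝔼 n)
    (B B' : Cube d → 𝔼 n →L[ℂ] 𝔼 n) : Prop where
  selfAdjoint : ∀ I, IsSelfAdjoint (B I)
  selfAdjoint' : ∀ I, IsSelfAdjoint (B' I)
  left_inv : ∀ I v, B' I (B I v) = v
  right_inv : ∀ I v, B I (B' I v) = v
  lower : ∀ I ∈ 𝒟, ∀ e, ‖B I e‖ₑ ^ p * volume I.toSet ≤ K ^ p * ∫⁻ x in I.toSet, ‖R x e‖ₑ ^ p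
  upper : ∀ I ∈ 𝒟, ∀ e, ∫⁻ x in I.toSet, ‖R x e‖ₑ ^ p ≤ K ^ p * (‖B I e‖ₑ ^ p * volume I.toSet)

lemma aemeasurable_enorm_clm_apply {R : (Fin d → ℝ) → 𝔼 n →L[ℂ] 𝔼 n}
    (hR : AEStronglyMeasurable R volume) (e : 𝔼 n) : AEMeasurable (fun x => ‖R x e‖ₑ) volume :=
  ((ContinuousLinearMap.apply ℂ 𝔼 n e).continuous.comp_aestronglyMeasurable hR).enorm

lemma aemeasurable_enorm_comp_right {R : (Fin d → ℝ) → 𝔼 n →L[ℂ] 𝔼 n}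
    (hR : AEStronglyMeasurable R volume) (B : 𝔼 n →L[ℂ] 𝔼 n) :
    AEMeasurable (fun x => ‖R x ∘L B‖ₑ) volume :=
  (((ContinuousLinearMap.compL ℂ 𝔼 n 𝔼 n 𝔼 n).flip B).continuous.comp_aestronglyMeasurable hR).enorm

lemma aemeasurable_enorm_comp_left {R : (Fin d → ℝ) → 𝔼 n →L[ℂ] 𝔼 n}
    (hR : AEStronglyMeasurable R volume) (B : 𝔼 n →L[ℂ] 𝔼 n) :
    AEMeasurable (fun x => ‖B ∘L R x‖ₑ) volume :=
  ((ContinuousLinearMap.compL ℂ 𝔼 n 𝔼 n 𝔼 n B).continuous.comp_aestronglyMeasurable hR).enorm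

/-- A bound for `∫ |R e| ^ s` over all unit vectors of the standard basis bounds the integral of the
operator norm. -/
lemma lintegral_opENorm_rpow_le {s : ℝ} (hs : 1 ≤ s) {R : (Fin d → ℝ) → 𝔼 n →L[ℂ] 𝔼 n}
    (hR : AEStronglyMeasurable R volume) (B : 𝔼 n →L[ℂ] 𝔼 n) {c : ℝ≥0∞} {Ω : Set (Fin d → ℝ)}
    (h : ∀ i, ∫⁻ x in Ω, ‖R x (B (EuclideanSpace.basisFun (Fin n) ℂ i))‖ₑ ^ s ≤ c) :
    ∫⁻ x in Ω, ‖R x ∘L B‖ₑ ^ s ≤ (n : ℝ≥0∞) ^ s * c := by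
  have hn : (n : ℝ≥0∞) ^ (s - 1) * n = (n : ℝ≥0∞) ^ s := by
    nth_rewrite 2 [← ENNReal.rpow_one (n : ℝ≥0∞)]
    rw [← ENNReal.rpow_add_of_nonneg _ _ (by linarith) zero_le_one]
    congr 1; ring
  calc ∫⁻ x in Ω, ‖R x ∘L B‖ₑ ^ s
      ≤ ∫⁻ x in Ω, (n : ℝ≥0∞) ^ (s - 1) *
          ∑ i, ‖R x (B (EuclideanSpace.basisFun (Fin n) ℂ i))‖ₑ ^ s :=
        lintegral_mono fun x => opENorm_rpow_le_sum hs _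
    _ = (n : ℝ≥0∞) ^ (s - 1) *
          ∑ i, ∫⁻ x in Ω, ‖R x (B (EuclideanSpace.basisFun (Fin n) ℂ i))‖ₑ ^ s := by
        rw [lintegral_const_mul' _ _ (ENNReal.rpow_ne_top_of_nonneg (by linarith) (by simp)),
          lintegral_finsetSum']
        exact fun i _ => ((aemeasurable_enorm_clm_apply hR _).pow_const _).restrict
    _ ≤ (n : ℝ≥0∞) ^ (s - 1) * ∑ _i : Fin n, c := by gcongr; exact h _
    _ = _ := by rw [Finset.sum_const, Finset.card_univ, Fintype.card_fin, nsmul_eq_mul,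
                  ← mul_assoc, hn]

variable {p : ℝ} {X K : ℝ≥0} {R R' : (Fin d → ℝ) → 𝔼 n →L[ℂ] 𝔼 n} {𝒟 : Set (Cube d)}
  {B B' : Cube d → 𝔼 n →L[ℂ] 𝔼 n}

namespace ReducingFamily

lemma lintegral_comp_le (hB : ReducingFamily p K 𝒟 R B B') (hp : 1 < p)
    (hR : AEStronglyMeasurable R volume) {I : Cube d} (hI : I ∈ 𝒟) (C : 𝔼 n →L[ℂ] 𝔼 n) :
    ∫⁻ x in I.toSet, ‖R x ∘L C‖ₑ ^ p
      ≤ (n * K : ℝ≥0∞) ^ p * (‖B I ∘L C‖ₑ ^ p * volume I.toSet) := by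
  have hp0 : 0 ≤ p := by linarith
  rw [ENNReal.mul_rpow_of_nonneg _ _ hp0, mul_assoc]
  refine lintegral_opENorm_rpow_le hp.le hR C fun i => (hB.upper I hI _).trans ?_
  gcongr
  have := (B I ∘L C).le_opENorm (EuclideanSpace.basisFun (Fin n) ℂ i)
  rwa [enorm_basisFun, mul_one] at this

lemma le_lintegral_comp (hB : ReducingFamily p K 𝒟 R B B') (hp : 1 < p) {I : Cube d} (hI : I ∈ 𝒟)
    (C : 𝔼 n →L[ℂ] 𝔼 n) :
    volume I.toSet * ‖B I ∘L C‖ₑ ^ p ≤ K ^ p * ∫⁻ x in I.toSet, ‖R x ∘L C‖ₑ ^ p := by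
  have hp0 : 0 < p := by linarith
  set D : ℝ≥0∞ := (K ^ p * ∫⁻ x in I.toSet, ‖R x ∘L C‖ₑ ^ p) / volume I.toSet with hD
  have h : ‖B I ∘L C‖ₑ ≤ D ^ (1 / p) := by
    refine ContinuousLinearMap.opENorm_le_bound _ fun v => ?_
    rw [← ENNReal.rpow_le_rpow_iff hp0, ENNReal.mul_rpow_of_nonneg _ _ hp0.le, ← ENNReal.rpow_mul,
      one_div_mul_cancel hp0.ne', ENNReal.rpow_one, hD, ENNReal.div_eq_inv_mul, mul_assoc,
      ← ENNReal.div_eq_inv_mul,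
      ENNReal.le_div_iff_mul_le (Or.inl I.volume_toSet_ne_zero) (Or.inl I.volume_toSet_ne_top)]
    refine (hB.lower I hI (C v)).trans ?_
    rw [mul_assoc]
    gcongr
    rw [← lintegral_mul_const' _ _ (ENNReal.rpow_ne_top_of_nonneg hp0.le enorm_ne_top)]
    refine lintegral_mono fun x => ?_
    rw [← ENNReal.mul_rpow_of_nonneg _ _ hp0.le]
    gcongr
    exact (R x ∘L C).le_opENorm v
  have h2 := ENNReal.rpow_le_rpow h hp0.le
  rw [← ENNReal.rpow_mul, one_div_mul_cancel hp0.ne', ENNReal.rpow_one, hD,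
    ENNReal.le_div_iff_mul_le (Or.inl I.volume_toSet_ne_zero) (Or.inl I.volume_toSet_ne_top)] at h2
  rwa [mul_comm]

/-- The inverses of reducing operators are dominated by averages of `R'`: duality and Hölder. -/
lemma le_lintegral_comp_inv (hB : ReducingFamily p K 𝒟 R B B') (hp : 1 < p)
    (hW : WeightFactors p X R R') {I : Cube d} (hI : I ∈ 𝒟) (C : 𝔼 n →L[ℂ] 𝔼 n) :
    volume I.toSet * ‖B' I ∘L C‖ₑ ^ (p / (p - 1))
      ≤ K ^ (p / (p - 1)) * ∫⁻ x in I.toSet, ‖R' x ∘L C‖ₑ ^ (p / (p - 1)) := by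
  have hp0 : 0 < p := by linarith
  have hp1 : 0 < p - 1 := by linarith
  have hp' : 0 < p / (p - 1) := by positivity
  have hconj : (p / (p - 1)).HolderConjugate p := (Real.HolderConjugate.conjExponent hp).symm
  set Y : ℝ≥0∞ := ∫⁻ x in I.toSet, ‖R' x ∘L C‖ₑ ^ (p / (p - 1)) with hY
  set m := volume I.toSet with hm
  have hm0 : m ≠ 0 := I.volume_toSet_ne_zero
  have hmtop : m ≠ ∞ := I.volume_toSet_ne_top
  have key : ∀ v, ‖(B' I ∘L C) v‖ₑ
      ≤ (K * (Y ^ (1 / (p / (p - 1))) * m ^ (1 / p) / m)) * ‖v‖ₑ := by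
    intro v
    set w := (B' I ∘L C) v with hw
    by_cases hw0 : w = 0
    · rw [hw0, enorm_zero]; exact zero_le
    have hwe : ‖w‖ₑ ≠ 0 := by simpa using hw0
    set y := B' I w with hy
    have hBy : B I y = w := hB.right_inv I w
    have h1 : ‖w‖ₑ ^ 2 = ‖inner ℂ (C v) y‖ₑ := by
      rw [enorm_sq_eq_enorm_inner, hy, ← inner_apply_comm (hB.selfAdjoint' I)]; rfl
    have h2 : ‖inner ℂ (C v) y‖ₑ * m ≤ ‖v‖ₑ * (Y ^ (1 / (p / (p - 1)))
        * (K ^ p * (‖w‖ₑ ^ p * m)) ^ (1 / p)) := by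
      calc ‖inner ℂ (C v) y‖ₑ * m = ∫⁻ _ in I.toSet, ‖inner ℂ (C v) y‖ₑ := by
            rw [setLIntegral_const]
        _ ≤ ∫⁻ x in I.toSet, ‖v‖ₑ * (‖R' x ∘L C‖ₑ * ‖R x y‖ₑ) := by
            refine lintegral_mono_ae (ae_restrict_of_ae ?_)
            filter_upwards [hW.right_inv_ae] with x hx
            calc ‖inner ℂ (C v) y‖ₑ = ‖inner ℂ ((R' x ∘L C) v) (R x y)‖ₑ := by
                  rw [← inner_apply_comm (hW.selfAdjoint x)]
                  simp [hx]
              _ ≤ ‖(R' x ∘L C) v‖ₑ * ‖R x y‖ₑ := enorm_inner_le _ _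
              _ ≤ (‖R' x ∘L C‖ₑ * ‖v‖ₑ) * ‖R x y‖ₑ := by
                  gcongr; exact ContinuousLinearMap.le_opENorm _ _
              _ = _ := by ring
        _ = ‖v‖ₑ * ∫⁻ x in I.toSet, ‖R' x ∘L C‖ₑ * ‖R x y‖ₑ :=
            lintegral_const_mul' _ _ enorm_ne_top
        _ ≤ ‖v‖ₑ * (Y ^ (1 / (p / (p - 1))) * (∫⁻ x in I.toSet, ‖R x y‖ₑ ^ p) ^ (1 / p)) := by
            gcongr
            exact ENNReal.lintegral_mul_le_Lp_mul_Lq _ hconj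
              (aemeasurable_enorm_comp_right hW.meas' C).restrict
              (aemeasurable_enorm_clm_apply hW.meas y).restrict
        _ ≤ _ := by
            gcongr
            have := hB.upper I hI y
            rwa [hBy] at this
    rw [← h1, ENNReal.mul_rpow_of_nonneg _ _ (by positivity), ENNReal.mul_rpow_of_nonneg _ _
      (by positivity), ← ENNReal.rpow_mul, ← ENNReal.rpow_mul, mul_one_div_cancel hp0.ne',
      ENNReal.rpow_one, ENNReal.rpow_one] at h2
    have h3 : ‖w‖ₑ * (‖w‖ₑ * m)
        ≤ ‖w‖ₑ * (K * (Y ^ (1 / (p / (p - 1))) * m ^ (1 / p)) * ‖v‖ₑ) := by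
      refine le_trans (le_of_eq (by ring)) (h2.trans (le_of_eq (by ring)))
    have h4 := (ENNReal.mul_le_mul_iff_right hwe enorm_ne_top).1 h3
    rw [← ENNReal.le_div_iff_mul_le (Or.inl hm0) (Or.inl hmtop)] at h4
    refine h4.trans (le_of_eq ?_)
    rw [ENNReal.div_eq_inv_mul, ENNReal.div_eq_inv_mul]; ring
  have h := ENNReal.rpow_le_rpow (ContinuousLinearMap.opENorm_le_bound _ key) hp'.le
  have e1 : m ^ (1 / p) / m = m ^ (-(1 / (p / (p - 1)))) := by
    nth_rewrite 2 [← ENNReal.rpow_one m]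
    rw [← ENNReal.rpow_sub _ _ hm0 hmtop]
    congr 1; field_simp; ring
  rw [mul_div_assoc, e1, ENNReal.mul_rpow_of_nonneg _ _ hp'.le,
    ENNReal.mul_rpow_of_nonneg _ _ hp'.le, ← ENNReal.rpow_mul, ← ENNReal.rpow_mul, neg_mul,
    one_div_mul_cancel hp'.ne', ENNReal.rpow_one, ENNReal.rpow_neg_one] at h
  calc m * ‖B' I ∘L C‖ₑ ^ (p / (p - 1)) ≤ m * (K ^ (p / (p - 1)) * (Y * m⁻¹)) := by gcongr
    _ = K ^ (p / (p - 1)) * Y * (m * m⁻¹) := by ring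
    _ = _ := by rw [ENNReal.mul_inv_cancel hm0 hmtop, mul_one]

end ReducingFamily

end Weight

/-! ### Consequences of the `A_p` condition -/

section Ap

variable {d n : ℕ} {p : ℝ} {X K : ℝ≥0} {R R' : (Fin d → ℝ) → 𝔼 n →L[ℂ] 𝔼 n} {𝒟 : Set (Cube d)}
  {B B' : Cube d → 𝔼 n →L[ℂ] 𝔼 n}

lemma aemeasurable_enorm_comp_prod {S S' : (Fin d → ℝ) → 𝔼 n →L[ℂ] 𝔼 n}
    (hS : AEStronglyMeasurable S volume) (hS' : AEStronglyMeasurable S' volume)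
    (Ω Ω' : Set (Fin d → ℝ)) :
    AEMeasurable (fun z : (Fin d → ℝ) × (Fin d → ℝ) => ‖S z.1 ∘L S' z.2‖ₑ)
      ((volume.restrict Ω).prod (volume.restrict Ω')) := by
  have h1 := (hS.restrict (s := Ω)).comp_fst (ν := volume.restrict Ω')
  have h2 := (hS'.restrict (s := Ω')).comp_snd (μ := volume.restrict Ω)
  have h : Continuous fun z : (𝔼 n →L[ℂ] 𝔼 n) × (𝔼 n →L[ℂ] 𝔼 n) => z.1 ∘L z.2 := by fun_prop
  exact (h.comp_aestronglyMeasurable (h1.prodMk h2)).enorm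

lemma aemeasurable_lintegral_comp_rpow {S S' : (Fin d → ℝ) → 𝔼 n →L[ℂ] 𝔼 n}
    (hS : AEStronglyMeasurable S volume) (hS' : AEStronglyMeasurable S' volume)
    (Ω Ω' : Set (Fin d → ℝ)) (a b : ℝ) :
    AEMeasurable (fun x => (∫⁻ t in Ω', ‖S x ∘L S' t‖ₑ ^ a) ^ b) (volume.restrict Ω) :=
  (((aemeasurable_enorm_comp_prod hS hS' Ω Ω').pow_const a).lintegral_prod_right').pow_const b

namespace WeightFactors

/-- The dual weight is locally integrable. -/
lemma lintegral_enorm_rpow_lt_top (hW : WeightFactors p X R R') (hp : 1 < p) (I : Cube d) :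
    ∫⁻ t in I.toSet, ‖R' t‖ₑ ^ (p / (p - 1)) < ∞ := by
  have hp1 : 0 < p - 1 := by linarith
  have hp' : 0 < p / (p - 1) := by positivity
  have hfin : ∫⁻ x in I.toSet, (∫⁻ t in I.toSet, ‖R x ∘L R' t‖ₑ ^ (p / (p - 1))) ^ (p - 1) ≠ ∞ :=
    ((hW.ap I).trans_lt (ENNReal.mul_lt_top ENNReal.coe_lt_top
      (ENNReal.rpow_lt_top_of_nonneg (by linarith) I.volume_toSet_ne_top))).ne
  have h1 := ae_lt_top' (aemeasurable_lintegral_comp_rpow hW.meas hW.meas' _ _ _ _) hfin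
  have : (ae (volume.restrict I.toSet)).NeBot := by
    rw [ae_neBot, Ne, Measure.restrict_eq_zero]; exact I.volume_toSet_ne_zero
  obtain ⟨x, hx, hinv⟩ := (h1.and (ae_restrict_of_ae hW.left_inv_ae)).exists
  have hx' : ∫⁻ t in I.toSet, ‖R x ∘L R' t‖ₑ ^ (p / (p - 1)) < ∞ := by
    by_contra h
    rw [not_lt, top_le_iff] at h
    rw [h, ENNReal.top_rpow_of_pos hp1] at hx
    exact lt_irrefl _ hx
  calc ∫⁻ t in I.toSet, ‖R' t‖ₑ ^ (p / (p - 1))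
      ≤ ∫⁻ t in I.toSet, ‖R' x‖ₑ ^ (p / (p - 1)) * ‖R x ∘L R' t‖ₑ ^ (p / (p - 1)) := by
        refine lintegral_mono fun t => ?_
        rw [← ENNReal.mul_rpow_of_nonneg _ _ hp'.le]
        gcongr
        calc ‖R' t‖ₑ = ‖R' x ∘L (R x ∘L R' t)‖ₑ := by congr 1; ext1 v; simp [hinv]
          _ ≤ _ := ContinuousLinearMap.opENorm_comp_le _ _
    _ = ‖R' x‖ₑ ^ (p / (p - 1)) * ∫⁻ t in I.toSet, ‖R x ∘L R' t‖ₑ ^ (p / (p - 1)) :=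
        lintegral_const_mul' _ _ (ENNReal.rpow_ne_top_of_nonneg hp'.le enorm_ne_top)
    _ < ∞ := ENNReal.mul_lt_top (ENNReal.rpow_lt_top_of_nonneg hp'.le enorm_ne_top) hx'

/-- Hahn–Banach for the norm `z ↦ ‖R' z‖_{L^{p'}(I)}` on `ℂ^n`: the norm of a vector `y` is
attained at a vector `w` of the dual unit ball. -/
lemma exists_dual_vector (hW : WeightFactors p X R R') (hp : 1 < p) (I : Cube d) (y : 𝔼 n) :
    ∃ w : 𝔼 n,
      (∀ z, ‖inner ℂ w z‖ₑ ≤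
        (∫⁻ t in I.toSet, ‖R' t z‖ₑ ^ (p / (p - 1))) ^ (1 / (p / (p - 1)))) ∧
      (∫⁻ t in I.toSet, ‖R' t y‖ₑ ^ (p / (p - 1))) ^ (1 / (p / (p - 1))) ≤ ‖inner ℂ w y‖ₑ := by
  have hp1 : 0 < p - 1 := by linarith
  have hs1 : 1 < p / (p - 1) := by rw [lt_div_iff₀ hp1]; linarith
  set s := p / (p - 1) with hs
  have hs0 : 0 < s := by linarith
  set μ : Measure (Fin d → ℝ) := volume.restrict I.toSet with hμ
  have : Fact (1 ≤ ENNReal.ofReal s) := ⟨by rw [ENNReal.one_le_ofReal]; exact hs1.le⟩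
  have hnorm : ∀ z : 𝔼 n, eLpNorm (fun t => R' t z) (ENNReal.ofReal s) μ
      = (∫⁻ t, ‖R' t z‖ₑ ^ s ∂μ) ^ (1 / s) := fun z => by
    rw [eLpNorm_eq_lintegral_rpow_enorm_toReal (by simpa using hs0) ENNReal.ofReal_ne_top,
      ENNReal.toReal_ofReal hs0.le]
  have hmem : ∀ z : 𝔼 n, MemLp (fun t => R' t z) (ENNReal.ofReal s) μ := fun z => by
    refine ⟨((ContinuousLinearMap.apply ℂ (𝔼 n) z).continuous.comp_aestronglyMeasurable
      hW.meas').restrict, ?_⟩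
    rw [hnorm]
    refine ENNReal.rpow_lt_top_of_nonneg (by positivity) (ne_of_lt ?_)
    calc ∫⁻ t, ‖R' t z‖ₑ ^ s ∂μ ≤ ∫⁻ t, ‖R' t‖ₑ ^ s * ‖z‖ₑ ^ s ∂μ := by
          refine lintegral_mono fun t => ?_
          rw [← ENNReal.mul_rpow_of_nonneg _ _ hs0.le]
          gcongr
          exact (R' t).le_opENorm z
      _ = (∫⁻ t, ‖R' t‖ₑ ^ s ∂μ) * ‖z‖ₑ ^ s :=
          lintegral_mul_const' _ _ (ENNReal.rpow_ne_top_of_nonneg hs0.le enorm_ne_top)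
      _ < ∞ := ENNReal.mul_lt_top (hW.lintegral_enorm_rpow_lt_top hp I)
          (ENNReal.rpow_lt_top_of_nonneg hs0.le enorm_ne_top)
  let ι : 𝔼 n →ₗ[ℂ] Lp (𝔼 n) (ENNReal.ofReal s) μ :=
    { toFun := fun z => (hmem z).toLp _
      map_add' := fun z z' => by
        rw [← MemLp.toLp_add]
        congr 1; ext1 t; simp
      map_smul' := fun c z => by
        rw [RingHom.id_apply, ← MemLp.toLp_const_smul]
        congr 1; ext1 t; simp }
  have hι : ∀ z, ‖ι z‖ₑ = (∫⁻ t, ‖R' t z‖ₑ ^ s ∂μ) ^ (1 / s) := fun z => by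
    rw [← hnorm]; exact Lp.enorm_toLp (hmem z)
  by_cases h0 : ‖ι y‖ = 0
  · refine ⟨0, fun z => by simp, ?_⟩
    rw [← hι, ← ofReal_norm, h0]; simp
  obtain ⟨g, hg1, hg2⟩ := _root_.exists_dual_vector ℂ (ι y) h0
  set φ : StrongDual ℂ (𝔼 n) := LinearMap.toContinuousLinearMap (g.toLinearMap ∘ₗ ι) with hφ
  have hw : ∀ z, inner ℂ ((InnerProductSpace.toDual ℂ (𝔼 n)).symm φ) z = g (ι z) := fun z => by
    rw [InnerProductSpace.toDual_symm_apply]; rfl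
  refine ⟨(InnerProductSpace.toDual ℂ (𝔼 n)).symm φ, fun z => ?_, ?_⟩
  · rw [hw, ← hι]
    have := g.le_opENorm (ι z)
    rwa [← ofReal_norm g, hg1, ENNReal.ofReal_one, one_mul] at this
  · rw [hw, ← hι, hg2, ← ofReal_norm, ← ofReal_norm, RCLike.norm_ofReal, abs_norm]

end WeightFactors

namespace ReducingFamily

/-- Averages of the dual weight are controlled by the inverse of a reducing operator. The vector
`w` which is dual to `B I e` satisfies `|R x w| ≤ ‖R x R'‖_{L^{p'}(I)}`, and the `A_p` condition
bounds the average of the right-hand side. -/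
lemma lintegral_inv_apply_le (hB : ReducingFamily p K 𝒟 R B B') (hp : 1 < p)
    (hW : WeightFactors p X R R') {I : Cube d} (hI : I ∈ 𝒟) {e : 𝔼 n} (he : ‖e‖ₑ = 1) :
    ∫⁻ t in I.toSet, ‖R' t (B I e)‖ₑ ^ (p / (p - 1))
      ≤ (K * (X : ℝ≥0∞) ^ (1 / p)) ^ (p / (p - 1)) * volume I.toSet := by
  have hp0 : 0 < p := by linarith
  have hp1 : 0 < p - 1 := by linarith
  have hp' : 0 < p / (p - 1) := by positivity
  obtain ⟨w, hw1, hw2⟩ := hW.exists_dual_vector hp I (B I e)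
  set s := p / (p - 1) with hs
  set m := volume I.toSet with hm
  have hm0 : m ≠ 0 := I.volume_toSet_ne_zero
  have hmtop : m ≠ ∞ := I.volume_toSet_ne_top
  have h1 : ∀ x, ‖R x w‖ₑ ^ p ≤ (∫⁻ t in I.toSet, ‖R x ∘L R' t‖ₑ ^ s) ^ (p - 1) := fun x => by
    by_cases h0 : R x w = 0
    · rw [h0, enorm_zero, ENNReal.zero_rpow_of_pos hp0]; exact zero_le
    have h2 : ‖R x w‖ₑ * ‖R x w‖ₑ
        ≤ ‖R x w‖ₑ * (∫⁻ t in I.toSet, ‖R x ∘L R' t‖ₑ ^ s) ^ (1 / s) := by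
      calc ‖R x w‖ₑ * ‖R x w‖ₑ = ‖inner ℂ w (R x (R x w))‖ₑ := by
            rw [← sq, enorm_sq_eq_enorm_inner, inner_apply_comm (hW.selfAdjoint x)]
        _ ≤ (∫⁻ t in I.toSet, ‖R' t (R x (R x w))‖ₑ ^ s) ^ (1 / s) := hw1 _
        _ ≤ (∫⁻ t in I.toSet, ‖R x w‖ₑ ^ s * ‖R x ∘L R' t‖ₑ ^ s) ^ (1 / s) := by
            gcongr with t
            rw [← ENNReal.mul_rpow_of_nonneg _ _ hp'.le,
              enorm_comp_comm (hW.selfAdjoint x) (hW.selfAdjoint' t), mul_comm]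
            gcongr
            exact (R' t ∘L R x).le_opENorm (R x w)
        _ = _ := by
            rw [lintegral_const_mul' _ _ (ENNReal.rpow_ne_top_of_nonneg hp'.le enorm_ne_top),
              ENNReal.mul_rpow_of_nonneg _ _ (by positivity), ← ENNReal.rpow_mul,
              mul_one_div_cancel hp'.ne', ENNReal.rpow_one]
    have h3 := (ENNReal.mul_le_mul_iff_right (by simpa using h0) enorm_ne_top).1 h2
    refine (ENNReal.rpow_le_rpow h3 hp0.le).trans (le_of_eq ?_)
    rw [← ENNReal.rpow_mul]
    congr 1; rw [hs]; field_simp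
  have h2 : ‖B I w‖ₑ ^ p * m ≤ K ^ p * X * m ^ (p - 1) * m := by
    refine (hB.lower I hI w).trans ?_
    have e : m ^ p = m ^ (p - 1) * m := by
      nth_rewrite 3 [← ENNReal.rpow_one m]
      rw [← ENNReal.rpow_add _ _ hm0 hmtop]; congr 1; ring
    rw [mul_assoc, mul_assoc, ← e]
    gcongr
    exact (lintegral_mono h1).trans (hW.ap I)
  have h3 : ‖B I w‖ₑ ^ p ≤ K ^ p * X * m ^ (p - 1) :=
    (ENNReal.mul_le_mul_iff_left hm0 hmtop).1 h2
  have h4 : ‖B I w‖ₑ ^ s ≤ (K * (X : ℝ≥0∞) ^ (1 / p)) ^ s * m := by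
    have := ENNReal.rpow_le_rpow h3 (inv_nonneg.2 hp1.le)
    rw [← ENNReal.rpow_mul, ENNReal.mul_rpow_of_nonneg _ _ (by positivity),
      ENNReal.mul_rpow_of_nonneg _ _ (by positivity), ← ENNReal.rpow_mul, ← ENNReal.rpow_mul,
      mul_inv_cancel₀ hp1.ne', ENNReal.rpow_one] at this
    refine this.trans (le_of_eq ?_)
    rw [ENNReal.mul_rpow_of_nonneg _ _ hp'.le, ← ENNReal.rpow_mul]
    congr 3
    rw [hs]; field_simp
  have h5 : (∫⁻ t in I.toSet, ‖R' t (B I e)‖ₑ ^ s) ^ (1 / s) ≤ ‖B I w‖ₑ := by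
    refine hw2.trans ?_
    rw [← inner_apply_comm (hB.selfAdjoint I)]
    refine (enorm_inner_le _ _).trans (le_of_eq ?_)
    rw [he, mul_one]
  have h6 := ENNReal.rpow_le_rpow h5 hp'.le
  rw [← ENNReal.rpow_mul, one_div_mul_cancel hp'.ne', ENNReal.rpow_one] at h6
  exact h6.trans h4

lemma lintegral_inv_comp_le (hB : ReducingFamily p K 𝒟 R B B') (hp : 1 < p)
    (hW : WeightFactors p X R R') {I : Cube d} (hI : I ∈ 𝒟) :
    ∫⁻ t in I.toSet, ‖R' t ∘L B I‖ₑ ^ (p / (p - 1))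
      ≤ (n * K * (X : ℝ≥0∞) ^ (1 / p)) ^ (p / (p - 1)) * volume I.toSet := by
  have hp1 : 0 < p - 1 := by linarith
  have hs1 : 1 < p / (p - 1) := by rw [lt_div_iff₀ hp1]; linarith
  rw [mul_assoc (n : ℝ≥0∞), ENNReal.mul_rpow_of_nonneg _ _ (by linarith), mul_assoc]
  exact lintegral_opENorm_rpow_le hs1.le hW.meas' (B I) fun i =>
    hB.lintegral_inv_apply_le hp hW hI (enorm_basisFun i)

/-- The `A_p` characteristic is bounded below. -/
lemma one_le_mul_rpow (hB : ReducingFamily p K 𝒟 R B B') (hp : 1 < p)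
    (hW : WeightFactors p X R R') (h𝒟 : 𝒟.Nonempty) (hn : n ≠ 0) :
    1 ≤ n * K ^ 2 * (X : ℝ≥0∞) ^ (1 / p) := by
  obtain ⟨I, hI⟩ := h𝒟
  have hp1 : 0 < p - 1 := by linarith
  have hp' : 0 < p / (p - 1) := by positivity
  have h := (hB.le_lintegral_comp_inv hp hW hI (B I)).trans
    (mul_le_mul_right (hB.lintegral_inv_comp_le hp hW hI) _)
  have hid : ‖B' I ∘L B I‖ₑ = 1 := by
    have h1 : B' I ∘L B I = ContinuousLinearMap.id ℂ (𝔼 n) := by ext1 v; simp [hB.left_inv]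
    have : Nonempty (Fin n) := ⟨⟨0, Nat.pos_of_ne_zero hn⟩⟩
    rw [h1, ← ofReal_norm, ContinuousLinearMap.norm_id, ENNReal.ofReal_one]
  rw [hid, ENNReal.one_rpow, mul_one, ← mul_assoc, ← ENNReal.mul_rpow_of_nonneg _ _ hp'.le] at h
  nth_rewrite 1 [← one_mul (volume I.toSet)] at h
  have h2 := (ENNReal.mul_le_mul_iff_left I.volume_toSet_ne_zero I.volume_toSet_ne_top).1 h
  rw [← ENNReal.one_rpow (p / (p - 1)), ENNReal.rpow_le_rpow_iff hp'] at h2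
  refine h2.trans (le_of_eq ?_)
  ring

end ReducingFamily

/-- A doubling property of the scalar weights `‖C S‖ ^ s`. -/
lemma lintegral_enorm_comp_le_of_volume_le {s : ℝ} (hs : 1 < s)
    {S S' : (Fin d → ℝ) → 𝔼 n →L[ℂ] 𝔼 n} (hS : AEStronglyMeasurable S volume)
    (hS' : AEStronglyMeasurable S' volume) (hinv : ∀ᵐ t, ∀ v, S t (S' t v) = v) {J : Cube d}
    {Γ : ℝ≥0∞}
    (hΓ : ∫⁻ x in J.toSet, (∫⁻ t in J.toSet, ‖S' t ∘L S x‖ₑ ^ (s / (s - 1))) ^ (s - 1)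
      ≤ Γ * volume J.toSet ^ s)
    (C : 𝔼 n →L[ℂ] 𝔼 n) {E : Set (Fin d → ℝ)} (hE : E ⊆ J.toSet)
    (hvol : volume J.toSet ≤ 2 * volume E) :
    ∫⁻ x in J.toSet, ‖C ∘L S x‖ₑ ^ s ≤ 2 ^ s * Γ * ∫⁻ x in E, ‖C ∘L S x‖ₑ ^ s := by
  have hs0 : 0 < s := by linarith
  have hs1 : 0 < s - 1 := by linarith
  have hs' : 0 < s / (s - 1) := by positivity
  have hconj : s.HolderConjugate (s / (s - 1)) := Real.HolderConjugate.conjExponent hs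
  have hE0 : volume E ≠ 0 := by
    intro h0
    rw [h0, mul_zero, nonpos_iff_eq_zero] at hvol
    exact J.volume_toSet_ne_zero hvol
  have hEtop : volume E ≠ ∞ := ((measure_mono hE).trans_lt J.volume_toSet_ne_top.lt_top).ne
  have hEs0 : volume E ^ s ≠ 0 := (ENNReal.rpow_pos hE0.bot_lt hEtop).ne'
  have hEstop : volume E ^ s ≠ ∞ := ENNReal.rpow_ne_top_of_nonneg hs0.le hEtop
  have hmeas : AEMeasurable
      (fun x => (∫⁻ t in J.toSet, ‖S' t ∘L S x‖ₑ ^ (s / (s - 1))) ^ (s - 1))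
      (volume.restrict J.toSet) :=
    (((aemeasurable_enorm_comp_prod hS' hS J.toSet J.toSet).pow_const _).lintegral_prod_left'
      ).pow_const _
  have hpt : ∀ x, ‖C ∘L S x‖ₑ ^ s * volume E ^ s ≤ (∫⁻ t in E, ‖C ∘L S t‖ₑ ^ s) *
      (∫⁻ t in J.toSet, ‖S' t ∘L S x‖ₑ ^ (s / (s - 1))) ^ (s - 1) := fun x => by
    have h1 : ‖C ∘L S x‖ₑ * volume E ≤ (∫⁻ t in E, ‖C ∘L S t‖ₑ ^ s) ^ (1 / s) *
        (∫⁻ t in J.toSet, ‖S' t ∘L S x‖ₑ ^ (s / (s - 1))) ^ (1 / (s / (s - 1))) := by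
      calc ‖C ∘L S x‖ₑ * volume E = ∫⁻ _ in E, ‖C ∘L S x‖ₑ := by rw [setLIntegral_const]
        _ ≤ ∫⁻ t in E, ‖C ∘L S t‖ₑ * ‖S' t ∘L S x‖ₑ := by
            refine lintegral_mono_ae (ae_restrict_of_ae ?_)
            filter_upwards [hinv] with t ht
            calc ‖C ∘L S x‖ₑ = ‖(C ∘L S t) ∘L (S' t ∘L S x)‖ₑ := by congr 1; ext1 v; simp [ht]
              _ ≤ _ := ContinuousLinearMap.opENorm_comp_le _ _
        _ ≤ (∫⁻ t in E, ‖C ∘L S t‖ₑ ^ s) ^ (1 / s) *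
            (∫⁻ t in E, ‖S' t ∘L S x‖ₑ ^ (s / (s - 1))) ^ (1 / (s / (s - 1))) :=
            ENNReal.lintegral_mul_le_Lp_mul_Lq _ hconj
              (aemeasurable_enorm_comp_left hS C).restrict
              (aemeasurable_enorm_comp_right hS' (S x)).restrict
        _ ≤ _ := by gcongr
    have h2 := ENNReal.rpow_le_rpow h1 hs0.le
    rw [ENNReal.mul_rpow_of_nonneg _ _ hs0.le, ENNReal.mul_rpow_of_nonneg _ _ hs0.le,
      ← ENNReal.rpow_mul, ← ENNReal.rpow_mul, one_div_mul_cancel hs0.ne', ENNReal.rpow_one] at h2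
    refine h2.trans (le_of_eq ?_)
    congr 2; field_simp
  have h3 : (∫⁻ x in J.toSet, ‖C ∘L S x‖ₑ ^ s) * volume E ^ s
      ≤ (2 ^ s * Γ * ∫⁻ x in E, ‖C ∘L S x‖ₑ ^ s) * volume E ^ s := by
    calc (∫⁻ x in J.toSet, ‖C ∘L S x‖ₑ ^ s) * volume E ^ s
        = ∫⁻ x in J.toSet, ‖C ∘L S x‖ₑ ^ s * volume E ^ s :=
          (lintegral_mul_const' _ _ hEstop).symm
      _ ≤ ∫⁻ x in J.toSet, (∫⁻ t in E, ‖C ∘L S t‖ₑ ^ s) *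
            (∫⁻ t in J.toSet, ‖S' t ∘L S x‖ₑ ^ (s / (s - 1))) ^ (s - 1) :=
          lintegral_mono hpt
      _ = (∫⁻ t in E, ‖C ∘L S t‖ₑ ^ s) * ∫⁻ x in J.toSet,
            (∫⁻ t in J.toSet, ‖S' t ∘L S x‖ₑ ^ (s / (s - 1))) ^ (s - 1) :=
          lintegral_const_mul'' _ hmeas
      _ ≤ (∫⁻ t in E, ‖C ∘L S t‖ₑ ^ s) * (Γ * (2 * volume E) ^ s) := by
          gcongr
          refine hΓ.trans ?_
          gcongr
      _ = _ := by rw [ENNReal.mul_rpow_of_nonneg _ _ hs0.le]; ring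
  exact (ENNReal.mul_le_mul_iff_left hEs0 hEstop).1 h3

end Ap

/-! ### The local square function estimates for a weight and for its dual -/

namespace ReducingFamily

variable {d n : ℕ} {p : ℝ} {X K : ℝ≥0} {R R' : (Fin d → ℝ) → 𝔼 n →L[ℂ] 𝔼 n} {𝒟 : Set (Cube d)}
  {B B' : Cube d → 𝔼 n →L[ℂ] 𝔼 n}

lemma enorm_comp_inv_le (hB : ReducingFamily p K 𝒟 R B B') (I : Cube d) :
    ‖B I ∘L B' I‖ₑ ≤ 1 := by
  have : B I ∘L B' I = ContinuousLinearMap.id ℂ (𝔼 n) := by ext1 v; simp [hB.right_inv]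
  rw [this, ← ofReal_norm]
  exact ENNReal.ofReal_le_one.2 ContinuousLinearMap.norm_id_le

lemma lintegral_comp_inv_le (hB : ReducingFamily p K 𝒟 R B B') (hp : 1 < p)
    (hW : WeightFactors p X R R') {I : Cube d} (hI : I ∈ 𝒟) :
    ∫⁻ x in I.toSet, ‖R x ∘L B' I‖ₑ ^ p ≤ (n * K : ℝ≥0∞) ^ p * volume I.toSet := by
  refine (hB.lintegral_comp_le hp hW.meas hI (B' I)).trans ?_
  gcongr
  refine (mul_le_mul_left (ENNReal.rpow_le_rpow (hB.enorm_comp_inv_le I) (by linarith)) _).trans ?_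
  rw [ENNReal.one_rpow, one_mul]

/-- The dual `A_p` condition. -/
lemma lintegral_lintegral_inv_le (hB : ReducingFamily p K 𝒟 R B B') (hp : 1 < p)
    (hW : WeightFactors p X R R') {I : Cube d} (hI : I ∈ 𝒟) :
    ∫⁻ x in I.toSet, (∫⁻ t in I.toSet, ‖R t ∘L R' x‖ₑ ^ p) ^ (1 / (p - 1))
      ≤ (n ^ 2 * K ^ 2 * (X : ℝ≥0∞) ^ (1 / p)) ^ (p / (p - 1))
        * volume I.toSet ^ (p / (p - 1)) := by
  have hp0 : 0 < p := by linarith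
  have hp1 : 0 < p - 1 := by linarith
  have hp' : 0 < p / (p - 1) := by positivity
  set m := volume I.toSet with hm
  have hm0 : m ≠ 0 := I.volume_toSet_ne_zero
  have hmtop : m ≠ ∞ := I.volume_toSet_ne_top
  have e1 : m ^ (1 / (p - 1)) * m = m ^ (p / (p - 1)) := by
    nth_rewrite 2 [← ENNReal.rpow_one m]
    rw [← ENNReal.rpow_add _ _ hm0 hmtop]; congr 1; field_simp; ring
  calc ∫⁻ x in I.toSet, (∫⁻ t in I.toSet, ‖R t ∘L R' x‖ₑ ^ p) ^ (1 / (p - 1))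
      ≤ ∫⁻ x in I.toSet, ((n * K : ℝ≥0∞) ^ (p / (p - 1)) * m ^ (1 / (p - 1))) *
          ‖R' x ∘L B I‖ₑ ^ (p / (p - 1)) := by
        refine lintegral_mono fun x => ?_
        refine (ENNReal.rpow_le_rpow (hB.lintegral_comp_le hp hW.meas hI (R' x))
          (by positivity)).trans (le_of_eq ?_)
        have h0 : 0 ≤ 1 / (p - 1) := by positivity
        rw [ENNReal.mul_rpow_of_nonneg _ _ h0, ENNReal.mul_rpow_of_nonneg _ _ h0,
          ← ENNReal.rpow_mul, ← ENNReal.rpow_mul, mul_one_div,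
          enorm_comp_comm (hB.selfAdjoint I) (hW.selfAdjoint' x)]
        ring
    _ = ((n * K : ℝ≥0∞) ^ (p / (p - 1)) * m ^ (1 / (p - 1))) *
          ∫⁻ x in I.toSet, ‖R' x ∘L B I‖ₑ ^ (p / (p - 1)) := by
        refine lintegral_const_mul' _ _ (ENNReal.mul_ne_top ?_ ?_)
        · exact ENNReal.rpow_ne_top_of_nonneg hp'.le (by finiteness)
        · exact ENNReal.rpow_ne_top_of_nonneg (by positivity) hmtop
    _ ≤ ((n * K : ℝ≥0∞) ^ (p / (p - 1)) * m ^ (1 / (p - 1))) *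
          ((n * K * (X : ℝ≥0∞) ^ (1 / p)) ^ (p / (p - 1)) * m) := by
        gcongr; exact hB.lintegral_inv_comp_le hp hW hI
    _ = ((n * K : ℝ≥0∞) ^ (p / (p - 1)) * (n * K * (X : ℝ≥0∞) ^ (1 / p)) ^ (p / (p - 1))) *
          (m ^ (1 / (p - 1)) * m) := by ring
    _ = _ := by
        rw [← ENNReal.mul_rpow_of_nonneg _ _ hp'.le, e1]
        congr 2; ring

/-- The hypotheses of the local square function estimate for the weight itself. -/
lemma localBounds (hB : ReducingFamily p K 𝒟 R B B') (hp : 1 < p) (hW : WeightFactors p X R R')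
    (h𝒟 : IsDyadicGrid 𝒟) (hd : 0 < d) (hn : n ≠ 0) :
    LocalBounds 𝒟 p (K ^ p) (1 + n * K) (n * K * X ^ (1 / p))
      ((2 * n ^ 2 * K ^ 2 * X ^ (1 / p)) ^ (p / (p - 1))) B B' R R' := by
  have hp0 : 0 < p := by linarith
  have hp1 : 0 < p - 1 := by linarith
  have hp' : 0 < p / (p - 1) := by positivity
  have hne : 𝒟.Nonempty := let ⟨I, hI, _⟩ := h𝒟.partition 0 0; ⟨I, hI.1⟩
  have hX : ((X ^ (1 / p) : ℝ≥0) : ℝ≥0∞) = (X : ℝ≥0∞) ^ (1 / p) :=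
    ENNReal.coe_rpow_of_nonneg _ (by positivity)
  have hM : 1 ≤ n * K ^ 2 * X ^ (1 / p) := by
    have := hB.one_le_mul_rpow hp hW hne hn
    rw [← hX] at this; exact_mod_cast this
  have hn1 : (1 : ℝ≥0) ≤ n := by exact_mod_cast Nat.one_le_iff_ne_zero.2 hn
  refine
    { child_mem := fun I hI η => h𝒟.child_mem hd hI η
      left_inv := hB.left_inv
      right_inv := hB.right_inv
      left_inv_ae := hW.left_inv_ae
      meas := hW.meas
      meas' := hW.meas'
      one_le_α := le_self_add
      one_le_γ := ?_
      comparison := fun I hI T _ => ?_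
      upper := fun T hT => ?_
      upper_dual := fun T hT => ?_
      doubling := fun T hT J hJ E hE hEm hvol => ?_ }
  · refine NNReal.one_le_rpow ?_ hp'.le
    calc (1 : ℝ≥0) ≤ 2 * n * (n * K ^ 2 * X ^ (1 / p)) :=
          one_le_mul (one_le_mul one_le_two hn1) hM
      _ = _ := by ring
  · rw [ENNReal.coe_rpow_of_nonneg _ hp0.le]
    exact hB.le_lintegral_comp hp hI (B' T)
  · refine (hB.lintegral_comp_inv_le hp hW hT).trans ?_
    push_cast
    gcongr
    exact le_add_self
  · rw [ENNReal.coe_mul, hX]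
    push_cast
    refine le_of_eq_of_le ?_ (hB.lintegral_inv_comp_le hp hW hT)
    simp_rw [enorm_comp_comm (hB.selfAdjoint T) (hW.selfAdjoint' _)]
  · have hs1 : 1 < p / (p - 1) := by rw [lt_div_iff₀ hp1]; linarith
    have e1 : p / (p - 1) / (p / (p - 1) - 1) = p := by
      have : p / (p - 1) - 1 = 1 / (p - 1) := by field_simp; ring
      rw [this]; field_simp
    have e2 : p / (p - 1) - 1 = 1 / (p - 1) := by field_simp; ring
    refine (lintegral_enorm_comp_le_of_volume_le hs1 hW.meas' hW.meas hW.left_inv_ae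
      (Γ := (n ^ 2 * K ^ 2 * (X : ℝ≥0∞) ^ (1 / p)) ^ (p / (p - 1))) ?_ (B T) hE hvol).trans
      (le_of_eq ?_)
    · rw [e1, e2]
      exact hB.lintegral_lintegral_inv_le hp hW hJ
    · rw [← ENNReal.mul_rpow_of_nonneg _ _ hp'.le, ENNReal.coe_rpow_of_nonneg _ hp'.le,
        ENNReal.coe_mul, hX]
      push_cast
      congr 2; ring

/-- The hypotheses of the local square function estimate for the dual weight, with the inverses of
the reducing operators of the weight. -/
lemma localBounds_dual (hB : ReducingFamily p K 𝒟 R B B') (hp : 1 < p)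
    (hW : WeightFactors p X R R') (h𝒟 : IsDyadicGrid 𝒟) (hd : 0 < d) (hn : n ≠ 0) :
    LocalBounds 𝒟 (p / (p - 1)) (K ^ (p / (p - 1))) ((1 + K) * n * K * X ^ (1 / p)) (n * K)
      ((2 ^ p + (n * K ^ 2) ^ p) * X) B' B R' R := by
  have hp0 : 0 < p := by linarith
  have hp1 : 0 < p - 1 := by linarith
  have hp' : 0 < p / (p - 1) := by positivity
  have hne : 𝒟.Nonempty := let ⟨I, hI, _⟩ := h𝒟.partition 0 0; ⟨I, hI.1⟩
  have hX : ((X ^ (1 / p) : ℝ≥0) : ℝ≥0∞) = (X : ℝ≥0∞) ^ (1 / p) :=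
    ENNReal.coe_rpow_of_nonneg _ (by positivity)
  have hM : 1 ≤ n * K ^ 2 * X ^ (1 / p) := by
    have := hB.one_le_mul_rpow hp hW hne hn
    rw [← hX] at this; exact_mod_cast this
  have e1 : p / (p - 1) / (p / (p - 1) - 1) = p := by
    have : p / (p - 1) - 1 = 1 / (p - 1) := by field_simp; ring
    rw [this]; field_simp
  refine
    { child_mem := fun I hI η => h𝒟.child_mem hd hI η
      left_inv := hB.right_inv
      right_inv := hB.left_inv
      left_inv_ae := hW.right_inv_ae
      meas := hW.meas'
      meas' := hW.meas
      one_le_α := hM.trans ?_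
      one_le_γ := ?_
      comparison := fun I hI T _ => ?_
      upper := fun T hT => ?_
      upper_dual := fun T hT => ?_
      doubling := fun T hT J hJ E hE hEm hvol => ?_ }
  · calc n * K ^ 2 * X ^ (1 / p) = K * n * K * X ^ (1 / p) := by ring
      _ ≤ _ := by gcongr; exact le_add_self
  · calc (1 : ℝ≥0) ≤ (n * K ^ 2 * X ^ (1 / p)) ^ p := NNReal.one_le_rpow hM hp0.le
      _ = (n * K ^ 2) ^ p * X := by
          rw [NNReal.mul_rpow, ← NNReal.rpow_mul, one_div_mul_cancel hp0.ne', NNReal.rpow_one]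
      _ ≤ _ := by gcongr; exact le_add_self
  · rw [ENNReal.coe_rpow_of_nonneg _ hp'.le]
    exact hB.le_lintegral_comp_inv hp hW hI (B T)
  · refine (hB.lintegral_inv_comp_le hp hW hT).trans ?_
    rw [ENNReal.coe_mul, hX]
    push_cast
    gcongr
    nth_rewrite 1 [← one_mul (n : ℝ≥0∞)]
    gcongr
    exact le_self_add
  · rw [e1]
    refine le_of_eq_of_le ?_ ((hB.lintegral_comp_inv_le hp hW hT).trans (le_of_eq ?_))
    · simp_rw [enorm_comp_comm (hB.selfAdjoint' T) (hW.selfAdjoint _)]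
    · push_cast; rfl
  · rw [e1]
    refine (lintegral_enorm_comp_le_of_volume_le hp hW.meas hW.meas' hW.right_inv_ae
      (Γ := X) ?_ (B' T) hE hvol).trans ?_
    · simp_rw [enorm_comp_comm (hW.selfAdjoint' _) (hW.selfAdjoint _)]
      exact hW.ap J
    · rw [ENNReal.coe_mul, ENNReal.coe_add, ENNReal.coe_rpow_of_nonneg _ hp0.le]
      gcongr
      exact le_self_add

end ReducingFamily

/-! ### Dyadic martingales and duality -/

/-- The closed ball of the sup norm with the centre and the radius of a cube is its closure. -/
lemma Cube.toSet_ae_eq_closedBall {d : ℕ} (I : Cube d) :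
    I.toSet =ᵐ[volume] Metric.closedBall (fun i => I.corner i + I.side / 2) (I.side / 2) := by
  rw [I.toSet_eq_pi, closedBall_pi _ (by linarith [I.side_pos])]
  simp_rw [Real.closedBall_eq_Icc]
  rw [Set.pi_univ_Icc]
  refine Measure.univ_pi_Ico_ae_eq_Icc.trans (Filter.EventuallyEq.of_eq ?_)
  congr 1 <;> ext i <;> ring

lemma Cube.mem_closedBall {d : ℕ} {I : Cube d} {x : Fin d → ℝ} (hx : x ∈ I.toSet) :
    x ∈ Metric.closedBall (fun i => I.corner i + I.side / 2) (I.side / 2) := by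
  rw [closedBall_pi _ (by linarith [I.side_pos])]
  intro i _
  simp only [Real.closedBall_eq_Icc]
  have := hx i
  exact ⟨by linarith [this.1], by linarith [this.2]⟩

namespace IsDyadicGrid

variable {d n : ℕ} {𝒟 : Set (Cube d)}

/-- The conditional expectation of `g` with respect to the cubes of side length `2 ^ k`. -/
noncomputable def levelAverage (h𝒟 : IsDyadicGrid 𝒟) (k : ℤ) (g : (Fin d → ℝ) → 𝔼 n)
    (x : Fin d → ℝ) : 𝔼 n :=
  ⨍ y in (h𝒟.cubeAt k x).toSet, g y

variable (h𝒟 : IsDyadicGrid 𝒟) {f g : (Fin d → ℝ) → 𝔼 n} {M : ℝ}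

include h𝒟

lemma aestronglyMeasurable_levelAverage (k : ℤ) :
    AEStronglyMeasurable (h𝒟.levelAverage k g) volume :=
  (h𝒟.measurable_comp_cubeAt k fun I => ⨍ y in I.toSet, g y).aestronglyMeasurable

lemma norm_levelAverage_le (k : ℤ) (hgM : ∀ᵐ x, ‖g x‖ ≤ M) (x : Fin d → ℝ) :
    ‖h𝒟.levelAverage k g x‖ ≤ M := by
  have hv : 0 < volume.real (h𝒟.cubeAt k x).toSet :=
    ENNReal.toReal_pos (Cube.volume_toSet_ne_zero _) (Cube.volume_toSet_ne_top _)
  rw [levelAverage, setAverage_eq, norm_smul, Real.norm_of_nonneg (by positivity),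
    inv_mul_le_iff₀ hv, mul_comm]
  exact norm_setIntegral_le_of_norm_le_const_ae' (Cube.volume_toSet_ne_top _).lt_top
    (hgM.mono fun _ h _ => h)

lemma norm_levelAverage_le_integral (k : ℤ) (hg : Integrable g) (x : Fin d → ℝ) :
    ‖h𝒟.levelAverage k g x‖ ≤ (((2 : ℝ) ^ k) ^ d)⁻¹ * ∫ y, ‖g y‖ := by
  have hv : volume.real (h𝒟.cubeAt k x).toSet = ((2 : ℝ) ^ k) ^ d := by
    rw [measureReal_def, Cube.volume_toSet_eq_ofReal, h𝒟.side_cubeAt,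
      ENNReal.toReal_ofReal (by positivity)]
  rw [levelAverage, setAverage_eq, norm_smul, hv, Real.norm_of_nonneg (by positivity)]
  gcongr
  exact (norm_integral_le_integral_norm _).trans
    (setIntegral_le_integral hg.norm (Filter.Eventually.of_forall fun _ => norm_nonneg _))

/-- Lebesgue differentiation along the grid. -/
lemma tendsto_levelAverage (hg : Integrable g) :
    ∀ᵐ x, Filter.Tendsto (fun N : ℕ => h𝒟.levelAverage (-(N : ℤ)) g x) Filter.atTop
      (nhds (g x)) := by
  filter_upwards [IsUnifLocDoublingMeasure.ae_tendsto_average volume hg.locallyIntegrable 1]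
    with x hx
  have hlim : Filter.Tendsto (fun N : ℕ => (2 : ℝ) ^ (-(N : ℤ)) / 2) Filter.atTop
      (nhdsWithin 0 (Set.Ioi 0)) := by
    refine tendsto_nhdsWithin_iff.2 ⟨?_, Filter.Eventually.of_forall fun N => ?_⟩
    · have := (tendsto_pow_atTop_nhds_zero_of_lt_one (r := (1 / 2 : ℝ)) (by norm_num)
        (by norm_num)).div_const 2
      rw [zero_div] at this
      refine this.congr fun N => ?_
      rw [zpow_neg, zpow_natCast, one_div, inv_pow]
    · exact div_pos (zpow_pos (two_pos (α := ℝ)) _) two_pos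
  refine (hx (fun N : ℕ => fun i => (h𝒟.cubeAt (-(N : ℤ)) x).corner i + 2 ^ (-(N : ℤ)) / 2) _ hlim
    (Filter.Eventually.of_forall fun N => ?_)).congr fun N => ?_
  · rw [one_mul, ← h𝒟.side_cubeAt (-(N : ℤ)) x]
    exact Cube.mem_closedBall (h𝒟.mem_cubeAt _ x)
  · rw [levelAverage, setAverage_congr (Cube.toSet_ae_eq_closedBall _), h𝒟.side_cubeAt]

lemma integrable_inner_levelAverage (hf : Integrable f) (k : ℤ) (hgM : ∀ᵐ x, ‖g x‖ ≤ M) :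
    Integrable fun x => inner ℂ (f x) (h𝒟.levelAverage k g x) := by
  refine (hf.norm.mul_const M).mono'
    (hf.aestronglyMeasurable.inner (h𝒟.aestronglyMeasurable_levelAverage k)) ?_
  refine Filter.Eventually.of_forall fun x => (norm_inner_le_norm _ _).trans ?_
  gcongr
  exact h𝒟.norm_levelAverage_le k hgM x

lemma setIntegral_inner_levelAverage {k : ℤ} {I : Cube d} (hI : I ∈ level 𝒟 k)
    (hf : Integrable f) :
    ∫ x in I.toSet, inner ℂ (f x) (h𝒟.levelAverage k g x)
      = ((volume.real I.toSet)⁻¹ : ℂ)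
        * inner ℂ (∫ x in I.toSet, f x) (∫ x in I.toSet, g x) := by
  have h1 : ∀ x ∈ I.toSet, inner ℂ (f x) (h𝒟.levelAverage k g x)
      = starRingEnd ℂ (inner ℂ (⨍ y in I.toSet, g y) (f x)) := fun x hx => by
    rw [inner_conj_symm, levelAverage, ← h𝒟.eq_cubeAt hI hx]
  rw [setIntegral_congr_fun I.measurableSet_toSet h1, integral_conj, integral_inner hf.integrableOn,
    inner_conj_symm, setAverage_eq, inner_smul_right_eq_smul, Complex.real_smul]
  push_cast
  rfl

/-- The martingale difference is a sum over Haar coefficients. -/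
lemma setIntegral_inner_levelAverage_sub (hd : 0 < d) {k : ℤ} {I : Cube d} (hI : I ∈ level 𝒟 k)
    (hf : Integrable f) (hg : Integrable g) (hgM : ∀ᵐ x, ‖g x‖ ≤ M) :
    ∫ x in I.toSet, (inner ℂ (f x) (h𝒟.levelAverage (k - 1) g x)
        - inner ℂ (f x) (h𝒟.levelAverage k g x))
      = ∑ ε : Signature d, inner ℂ (haarCoeff f I ε) (haarCoeff g I ε) := by
  have h1 := (h𝒟.integrable_inner_levelAverage hf (k - 1) hgM).integrableOn (s := I.toSet)
  have h2 := (h𝒟.integrable_inner_levelAverage hf k hgM).integrableOn (s := I.toSet)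
  rw [integral_sub h1 h2, I.integral_eq_sum_child h1, h𝒟.setIntegral_inner_levelAverage hI hf,
    sub_eq_iff_eq_add, sum_inner_haarCoeff hf.integrableOn hg.integrableOn]
  exact Finset.sum_congr rfl fun η _ =>
    h𝒟.setIntegral_inner_levelAverage (h𝒟.child_mem_level hd hI η) hf

/-- Duality: the pairing of two functions is dominated by any expression which dominates the
pairings of their Haar coefficients. -/
lemma enorm_integral_inner_le (hd : 0 < d) (hf : Integrable f) (hg : Integrable g)
    (hgM : ∀ᵐ x, ‖g x‖ ≤ M) (φ : Cube d → ℝ≥0∞)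
    (hφ : ∀ I ∈ 𝒟, ‖∑ ε : Signature d, inner ℂ (haarCoeff f I ε) (haarCoeff g I ε)‖ₑ
      ≤ φ I * volume I.toSet) :
    ‖∫ x, inner ℂ (f x) (g x)‖ₑ ≤ ∫⁻ x, ∑' I : 𝒟, φ I * (I : Cube d).toSet.indicator 1 x := by
  set b : ℤ → ℂ := fun k => ∫ x, inner ℂ (f x) (h𝒟.levelAverage k g x) with hb
  set T : ℝ≥0∞ := ∫⁻ x, ∑' I : 𝒟, φ I * (I : Cube d).toSet.indicator 1 x with hT
  have hT' : T = ∑' k : ℤ, ∫⁻ x, φ (h𝒟.cubeAt k x) := by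
    rw [hT, ← lintegral_tsum fun k => (h𝒟.measurable_comp_cubeAt k φ).aemeasurable]
    simp_rw [h𝒟.tsum_indicator]
  have hstep : ∀ k, ‖b (k - 1) - b k‖ₑ ≤ ∫⁻ x, φ (h𝒟.cubeAt k x) := fun k => by
    have h1 := h𝒟.integrable_inner_levelAverage hf (k - 1) hgM
    have h2 := h𝒟.integrable_inner_levelAverage hf k hgM
    have := h𝒟.countable_level k
    have h3 := hasSum_integral_iUnion (μ := volume)
      (fun I : level 𝒟 k => (I : Cube d).measurableSet_toSet) (h𝒟.pairwise_disjoint_level k)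
      (h1.sub h2).integrableOn
    rw [h𝒟.iUnion_level, setIntegral_univ] at h3
    have h4 : b (k - 1) - b k = ∑' I : level 𝒟 k, ∫ x in (I : Cube d).toSet,
        (inner ℂ (f x) (h𝒟.levelAverage (k - 1) g x)
          - inner ℂ (f x) (h𝒟.levelAverage k g x)) := by
      rw [hb]
      simp only
      rw [← integral_sub h1 h2]
      exact h3.tsum_eq.symm
    rw [h4, h𝒟.lintegral_eq_tsum_level k]
    refine enorm_tsum_le_tsum_enorm.trans (ENNReal.tsum_le_tsum fun I => ?_)
    rw [h𝒟.setIntegral_inner_levelAverage_sub hd I.2 hf hg hgM]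
    refine (hφ I I.2.1).trans (le_of_eq ?_)
    rw [← setLIntegral_const]
    exact setLIntegral_congr_fun (I : Cube d).measurableSet_toSet fun x hx =>
      congrArg φ (h𝒟.eq_cubeAt I.2 hx)
  have htel : ∀ (k : ℤ) (N : ℕ), ‖b (k - N) - b k‖ₑ
      ≤ ∑ j ∈ Finset.range N, ∫⁻ x, φ (h𝒟.cubeAt (k - j) x) := fun k N => by
    induction N with
    | zero => simp
    | succ N ih =>
      have e : b (k - (N + 1 : ℕ)) - b k
          = (b (k - N - 1) - b (k - N)) + (b (k - N) - b k) := by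
        have : k - ((N + 1 : ℕ) : ℤ) = k - N - 1 := by push_cast; ring
        rw [this]; ring
      rw [e, Finset.sum_range_succ]
      exact (enorm_add_le _ _).trans ((add_le_add (hstep _) ih).trans_eq (add_comm _ _))
  have hle : ∀ N : ℕ, ‖b (-(N : ℤ)) - b N‖ₑ ≤ T := fun N => by
    have h1 := htel N (N + N)
    have e : ((N : ℤ) - (N + N : ℕ)) = -N := by push_cast; ring
    rw [e] at h1
    refine h1.trans ?_
    have hinj : Function.Injective fun j : ℕ => (N : ℤ) - j := fun i j h => by
      simpa using h
    rw [hT']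
    refine (ENNReal.sum_le_tsum _).trans ?_
    exact ENNReal.tsum_comp_le_tsum_of_injective hinj fun k => ∫⁻ x, φ (h𝒟.cubeAt k x)
  have hlim1 : Filter.Tendsto (fun N : ℕ => b (-(N : ℤ))) Filter.atTop
      (nhds (∫ x, inner ℂ (f x) (g x))) := by
    refine tendsto_integral_filter_of_dominated_convergence (fun x => ‖f x‖ * M)
      (Filter.Eventually.of_forall fun N =>
        (h𝒟.integrable_inner_levelAverage hf _ hgM).aestronglyMeasurable)
      (Filter.Eventually.of_forall fun N => Filter.Eventually.of_forall fun x => ?_)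
      (hf.norm.mul_const M) ?_
    · refine (norm_inner_le_norm _ _).trans ?_
      gcongr
      exact h𝒟.norm_levelAverage_le _ hgM x
    · filter_upwards [h𝒟.tendsto_levelAverage hg] with x hx
      exact tendsto_const_nhds.inner hx
  have hlim2 : Filter.Tendsto (fun N : ℕ => b N) Filter.atTop (nhds 0) := by
    have hz : Filter.Tendsto (fun N : ℕ => ((2 : ℝ) ^ d)⁻¹ ^ N * (∫ y, ‖g y‖) * ∫ x, ‖f x‖)
        Filter.atTop (nhds 0) := by
      have := tendsto_pow_atTop_nhds_zero_of_lt_one (r := ((2 : ℝ) ^ d)⁻¹) (by positivity)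
        (inv_lt_one_of_one_lt₀ (one_lt_pow₀ one_lt_two hd.ne'))
      simpa using (this.mul_const (∫ y, ‖g y‖)).mul_const (∫ x, ‖f x‖)
    refine squeeze_zero_norm (fun N => ?_) hz
    rw [← integral_const_mul]
    refine norm_integral_le_of_norm_le (hf.norm.const_mul _)
      (Filter.Eventually.of_forall fun x => ?_)
    refine (norm_inner_le_norm _ _).trans ?_
    rw [mul_comm]
    gcongr
    refine (h𝒟.norm_levelAverage_le_integral N hg x).trans (le_of_eq ?_)
    rw [zpow_natCast, ← pow_mul, mul_comm N d, pow_mul, inv_pow]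
  have hlim := (hlim1.sub hlim2).enorm
  rw [sub_zero] at hlim
  exact le_of_tendsto' hlim hle

end IsDyadicGrid

/-! ### The lower bound for the square function -/

variable {d n : ℕ}

/-- The square of the square function of `f` with the operators `A I`. -/
noncomputable def energySum (𝒟 : Set (Cube d)) (A : Cube d → 𝔼 n →L[ℂ] 𝔼 n)
    (f : (Fin d → ℝ) → 𝔼 n) (x : Fin d → ℝ) : ℝ≥0∞ :=
  ∑' I : 𝒟, haarEnergy (fun y => A I (f y)) I * (I : Cube d).toSet.indicator 1 x

lemma IsDyadicGrid.measurable_energySum {𝒟 : Set (Cube d)} (h𝒟 : IsDyadicGrid 𝒟)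
    (A : Cube d → 𝔼 n →L[ℂ] 𝔼 n) (f : (Fin d → ℝ) → 𝔼 n) : Measurable (energySum 𝒟 A f) := by
  have := h𝒟.countable
  exact Measurable.tsum fun I =>
    (measurable_one.indicator (I : Cube d).measurableSet_toSet).const_mul _

lemma haarEnergy_sub_le {f g : (Fin d → ℝ) → 𝔼 n} {I : Cube d} (hf : IntegrableOn f I.toSet)
    (hg : IntegrableOn g I.toSet) :
    haarEnergy (fun x => f x - g x) I ≤ 2 * (haarEnergy f I + haarEnergy g I) := by
  have h1 : ∀ ε : Fin d → Fin 2,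
      haarCoeff (fun x => f x - g x) I ε = haarCoeff f I ε - haarCoeff g I ε := fun ε => by
    change haarCoeff (f - g) I ε = _
    rw [haarCoeff_eq_sum hf, haarCoeff_eq_sum hg, haarCoeff_eq_sum (hf.sub hg), ← smul_sub,
      ← Finset.sum_sub_distrib]
    congr 1
    refine Finset.sum_congr rfl fun η _ => ?_
    rw [← smul_sub, Pi.sub_def,
      integral_sub (hf.mono_set (I.child_subset η)) (hg.mono_set (I.child_subset η))]
  simp_rw [haarEnergy, h1]
  rw [← ENNReal.add_div, ← mul_div_assoc, ← Finset.sum_add_distrib, Finset.mul_sum]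
  gcongr with ε _
  calc ‖haarCoeff f I ε - haarCoeff g I ε‖ₑ ^ 2
      ≤ (‖haarCoeff f I ε‖ₑ + ‖haarCoeff g I ε‖ₑ) ^ 2 := by gcongr; exact enorm_sub_le
    _ ≤ _ := by
        have := ENNReal.rpow_add_le_mul_rpow_add_rpow ‖haarCoeff f I ε‖ₑ ‖haarCoeff g I ε‖ₑ
          (p := 2) (by norm_num)
        norm_num at this
        exact_mod_cast this

lemma energySum_sub_le {𝒟 : Set (Cube d)} (A : Cube d → 𝔼 n →L[ℂ] 𝔼 n) {f g : (Fin d → ℝ) → 𝔼 n}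
    (hf : ∀ I : Cube d, IntegrableOn f I.toSet) (hg : ∀ I : Cube d, IntegrableOn g I.toSet)
    (x : Fin d → ℝ) :
    energySum 𝒟 A (fun y => f y - g y) x ≤ 2 * (energySum 𝒟 A f x + energySum 𝒟 A g x) := by
  rw [energySum, energySum, energySum, ← ENNReal.tsum_add, ← ENNReal.tsum_mul_left]
  refine ENNReal.tsum_le_tsum fun I => ?_
  rw [← add_mul, ← mul_assoc]
  gcongr
  simp_rw [map_sub]
  exact haarEnergy_sub_le ((A I).integrable_comp (hf I)) ((A I).integrable_comp (hg I))

/-- Cauchy–Schwarz for the Haar coefficients of one cube, after moving an invertible operator from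
one factor to the other. -/
lemma enorm_sum_inner_haarCoeff_le {f g : (Fin d → ℝ) → 𝔼 n} {I : Cube d}
    (hf : IntegrableOn f I.toSet) (hg : IntegrableOn g I.toSet) {B B' : 𝔼 n →L[ℂ] 𝔼 n}
    (hB : IsSelfAdjoint B) (hinv : ∀ v, B (B' v) = v) :
    ‖∑ ε : Signature d, inner ℂ (haarCoeff f I ε) (haarCoeff g I ε)‖ₑ
      ≤ haarEnergy (fun x => B (f x)) I ^ (1 / 2 : ℝ)
        * haarEnergy (fun x => B' (g x)) I ^ (1 / 2 : ℝ) * volume I.toSet := by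
  have h2 : (2 : ℝ).HolderConjugate 2 := Real.HolderConjugate.two_two
  calc ‖∑ ε : Signature d, inner ℂ (haarCoeff f I ε) (haarCoeff g I ε)‖ₑ
      ≤ ∑ ε : Signature d, ‖haarCoeff (fun x => B (f x)) I ε‖ₑ
          * ‖haarCoeff (fun x => B' (g x)) I ε‖ₑ := by
        refine (enorm_sum_le _ _).trans (Finset.sum_le_sum fun ε _ => ?_)
        rw [haarCoeff_clm_comp hf, haarCoeff_clm_comp hg]
        nth_rewrite 1 [← hinv (haarCoeff g I ε), ← inner_apply_comm hB]
        exact enorm_inner_le _ _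
    _ ≤ (∑ ε : Signature d, ‖haarCoeff (fun x => B (f x)) I ε‖ₑ ^ (2 : ℝ)) ^ (1 / 2 : ℝ)
          * (∑ ε : Signature d, ‖haarCoeff (fun x => B' (g x)) I ε‖ₑ ^ (2 : ℝ)) ^ (1 / 2 : ℝ) :=
        ENNReal.inner_le_Lp_mul_Lq _ _ _ h2
    _ = (haarEnergy (fun x => B (f x)) I * volume I.toSet) ^ (1 / 2 : ℝ)
          * (haarEnergy (fun x => B' (g x)) I * volume I.toSet) ^ (1 / 2 : ℝ) := by
        simp_rw [haarEnergy_mul_volume, ENNReal.rpow_two]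
    _ = haarEnergy (fun x => B (f x)) I ^ (1 / 2 : ℝ)
          * haarEnergy (fun x => B' (g x)) I ^ (1 / 2 : ℝ)
          * (volume I.toSet ^ (1 / 2 : ℝ) * volume I.toSet ^ (1 / 2 : ℝ)) := by
        rw [ENNReal.mul_rpow_of_nonneg _ _ (by norm_num),
          ENNReal.mul_rpow_of_nonneg _ _ (by norm_num)]
        ring
    _ = _ := by
        rw [← ENNReal.rpow_add_of_nonneg _ _ (by norm_num) (by norm_num)]
        norm_num

/-- Cauchy–Schwarz for the sum over the cubes. -/
lemma tsum_haarEnergy_le (𝒟 : Set (Cube d)) (A A' : Cube d → 𝔼 n →L[ℂ] 𝔼 n)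
    (f g : (Fin d → ℝ) → 𝔼 n) (x : Fin d → ℝ) :
    ∑' I : 𝒟, haarEnergy (fun y => A I (f y)) I ^ (1 / 2 : ℝ)
        * haarEnergy (fun y => A' I (g y)) I ^ (1 / 2 : ℝ) * (I : Cube d).toSet.indicator 1 x
      ≤ energySum 𝒟 A f x ^ (1 / 2 : ℝ) * energySum 𝒟 A' g x ^ (1 / 2 : ℝ) := by
  refine ENNReal.summable.tsum_le_of_sum_le fun s => ?_
  have e : ∀ (I : Cube d) (a b : ℝ≥0∞), a ^ (1 / 2 : ℝ) * b ^ (1 / 2 : ℝ) * I.toSet.indicator 1 x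
      = (a * I.toSet.indicator 1 x) ^ (1 / 2 : ℝ) * (b * I.toSet.indicator 1 x) ^ (1 / 2 : ℝ) := by
    intro I a b
    by_cases hx : x ∈ I.toSet <;> simp [hx]
  have e2 : ∀ a : ℝ≥0∞, (a ^ (1 / 2 : ℝ)) ^ (2 : ℝ) = a := fun a => by
    rw [← ENNReal.rpow_mul]; norm_num
  simp_rw [e]
  refine (ENNReal.inner_le_Lp_mul_Lq s _ _ Real.HolderConjugate.two_two).trans ?_
  simp_rw [e2]
  gcongr
  · exact ENNReal.sum_le_tsum s
  · exact ENNReal.sum_le_tsum s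

/-- Absorption of a power of a finite quantity. -/
lemma le_of_le_rpow_mul_rpow {p : ℝ} (hp : 1 < p) {T U c : ℝ≥0∞} (hT : T ≠ ∞)
    (h : T ≤ U ^ (1 / p) * (c * T) ^ (1 / (p / (p - 1)))) : T ≤ c ^ (p - 1) * U := by
  have hp0 : 0 < p := by linarith
  have hp1 : 0 < p - 1 := by linarith
  by_cases hT0 : T = 0
  · rw [hT0]; exact zero_le
  have h1 := ENNReal.rpow_le_rpow h hp0.le
  rw [ENNReal.mul_rpow_of_nonneg _ _ hp0.le, ← ENNReal.rpow_mul, ← ENNReal.rpow_mul,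
    one_div_mul_cancel hp0.ne', ENNReal.rpow_one,
    show 1 / (p / (p - 1)) * p = p - 1 by field_simp, ENNReal.mul_rpow_of_nonneg _ _ hp1.le] at h1
  have e : T ^ p = T * T ^ (p - 1) := by
    nth_rewrite 2 [← ENNReal.rpow_one T]
    rw [← ENNReal.rpow_add _ _ hT0 hT]; congr 1; ring
  rw [e, ← mul_assoc] at h1
  have h2 := (ENNReal.mul_le_mul_iff_left (ENNReal.rpow_pos (pos_iff_ne_zero.2 hT0) hT).ne'
    (ENNReal.rpow_ne_top_of_nonneg hp1.le hT)).1 h1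
  rwa [mul_comm] at h2

variable {p : ℝ} {X K : ℝ≥0} {R R' : (Fin d → ℝ) → 𝔼 n →L[ℂ] 𝔼 n} {𝒟 : Set (Cube d)}
  {B B' : Cube d → 𝔼 n →L[ℂ] 𝔼 n}

lemma WeightFactors.integrableOn (hW : WeightFactors p X R R') (hp : 1 < p)
    {f : (Fin d → ℝ) → 𝔼 n} (hfm : AEStronglyMeasurable f volume)
    (hf : ∫⁻ x, ‖R x (f x)‖ₑ ^ p ≠ ∞) (I : Cube d) : IntegrableOn f I.toSet := by
  have hp0 : 0 < p := by linarith
  have hp1 : 0 < p - 1 := by linarith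
  have hp' : 0 < p / (p - 1) := by positivity
  have hconj : (p / (p - 1)).HolderConjugate p := (Real.HolderConjugate.conjExponent hp).symm
  refine ⟨hfm.restrict, ?_⟩
  have hRf : AEMeasurable (fun x => ‖R x (f x)‖ₑ) (volume.restrict I.toSet) :=
    (ContinuousLinearMap.aestronglyMeasurable_comp₂
      (ContinuousLinearMap.id ℂ (𝔼 n →L[ℂ] 𝔼 n)) hW.meas hfm).enorm.restrict
  calc ∫⁻ x in I.toSet, ‖f x‖ₑ ≤ ∫⁻ x in I.toSet, ‖R' x‖ₑ * ‖R x (f x)‖ₑ := by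
        refine lintegral_mono_ae (ae_restrict_of_ae ?_)
        filter_upwards [hW.left_inv_ae] with x hx
        nth_rewrite 1 [← hx (f x)]
        exact (R' x).le_opENorm _
    _ ≤ (∫⁻ x in I.toSet, ‖R' x‖ₑ ^ (p / (p - 1))) ^ (1 / (p / (p - 1)))
          * (∫⁻ x in I.toSet, ‖R x (f x)‖ₑ ^ p) ^ (1 / p) :=
        ENNReal.lintegral_mul_le_Lp_mul_Lq _ hconj hW.meas'.enorm.restrict hRf
    _ < ∞ := by
        refine ENNReal.mul_lt_top
          (ENNReal.rpow_lt_top_of_nonneg (by positivity) (hW.lintegral_enorm_rpow_lt_top hp I).ne)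
          (ENNReal.rpow_lt_top_of_nonneg (by positivity) ?_)
        exact ((setLIntegral_le_lintegral _ _).trans_lt hf.lt_top).ne

namespace ReducingFamily

/-- The lower bound for the square function of the restriction of `f` to a set on which `f` and the
weight are bounded: duality with the function `g = R |F| ^ (p - 2) F`, where `F = R f`, and the
upper bound for the square function of `g` in the dual weighted space. -/
lemma setLIntegral_le_energySum (hB : ReducingFamily p K 𝒟 R B B') (hp : 1 < p)
    (hW : WeightFactors p X R R') (h𝒟 : IsDyadicGrid 𝒟) (hd : 0 < d) {C₁ α β γ : ℝ≥0}
    (hL : LocalBounds 𝒟 (p / (p - 1)) C₁ α β γ B' B R' R) {f : (Fin d → ℝ) → 𝔼 n}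
    (hfm : AEStronglyMeasurable f volume) {S : Set (Fin d → ℝ)} (hS : MeasurableSet S)
    (hSvol : volume S ≠ ∞) {m : ℝ} (hm : 0 ≤ m) (hRm : ∀ᵐ x, x ∈ S → ‖R x‖ ≤ m)
    (hfS : ∀ᵐ x, x ∈ S → ‖f x‖ ≤ m) :
    ∫⁻ x in S, ‖R x (f x)‖ₑ ^ p
      ≤ (localConst d (p / (p - 1)) C₁ * (α * β * γ) ^ (p / (p - 1))) ^ (p - 1)
        * ∫⁻ x, energySum 𝒟 B (S.indicator f) x ^ (p / 2) := by
  have hp0 : 0 < p := by linarith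
  have hp1 : 0 < p - 1 := by linarith
  have hs1 : 1 < p / (p - 1) := by rw [lt_div_iff₀ hp1]; linarith
  have hconj : p.HolderConjugate (p / (p - 1)) := Real.HolderConjugate.conjExponent hp
  set s := p / (p - 1) with hs
  set F : (Fin d → ℝ) → 𝔼 n := fun x => R x (f x) with hF
  have hFm : AEStronglyMeasurable F volume :=
    ContinuousLinearMap.aestronglyMeasurable_comp₂
      (ContinuousLinearMap.id ℂ (𝔼 n →L[ℂ] 𝔼 n)) hW.meas hfm
  set G : (Fin d → ℝ) → 𝔼 n := fun x => ((‖F x‖ ^ (p - 2) : ℝ) : ℂ) • F x with hG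
  have hGm : AEStronglyMeasurable G volume :=
    (Complex.continuous_ofReal.comp_aestronglyMeasurable
      ((hFm.norm.aemeasurable.pow_const _).aestronglyMeasurable)).smul hFm
  have hGnorm : ∀ x, ‖G x‖ = ‖F x‖ ^ (p - 1) := fun x => by
    rw [hG]
    simp only
    rw [norm_smul, Complex.norm_real, Real.norm_of_nonneg (by positivity)]
    by_cases h0 : ‖F x‖ = 0
    · rw [h0, mul_zero, Real.zero_rpow hp1.ne']
    · rw [← Real.rpow_add_one h0]; congr 1; ring
  set g : (Fin d → ℝ) → 𝔼 n := S.indicator fun x => R x (G x) with hg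
  have hgm : AEStronglyMeasurable g volume :=
    (ContinuousLinearMap.aestronglyMeasurable_comp₂
      (ContinuousLinearMap.id ℂ (𝔼 n →L[ℂ] 𝔼 n)) hW.meas hGm).indicator hS
  have hFS : ∀ᵐ x, x ∈ S → ‖F x‖ ≤ m * m := by
    filter_upwards [hRm, hfS] with x h1 h2 hx
    exact ((R x).le_opNorm _).trans (mul_le_mul (h1 hx) (h2 hx) (norm_nonneg _) hm)
  have hgM : ∀ᵐ x, ‖g x‖ ≤ m * (m * m) ^ (p - 1) := by
    filter_upwards [hRm, hFS] with x h1 h2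
    by_cases hx : x ∈ S
    · rw [hg, Set.indicator_of_mem hx]
      refine ((R x).le_opNorm _).trans (mul_le_mul (h1 hx) ?_ (norm_nonneg _) hm)
      rw [hGnorm]
      exact Real.rpow_le_rpow (norm_nonneg _) (h2 hx) hp1.le
    · rw [hg, Set.indicator_of_notMem hx, norm_zero]; positivity
  have hgi : Integrable g := by
    have : IntegrableOn g S := Measure.integrableOn_of_bounded hSvol hgm
      (ae_restrict_of_ae hgM)
    rw [hg, integrable_indicator_iff hS]
    refine this.congr_fun (fun x hx => ?_) hS
    rw [hg, Set.indicator_of_mem hx]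
  have hfi : Integrable (S.indicator f) := by
    rw [integrable_indicator_iff hS]
    refine Measure.integrableOn_of_bounded (M := m) hSvol hfm ?_
    exact (ae_restrict_iff' hS).2 hfS
  set T : ℝ≥0∞ := ∫⁻ x in S, ‖F x‖ₑ ^ p with hT
  have hTtop : T ≠ ∞ := by
    have : T ≤ ∫⁻ _ in S, ENNReal.ofReal (m * m) ^ p := by
      refine lintegral_mono_ae ((ae_restrict_iff' hS).2 ?_)
      filter_upwards [hFS] with x hx hxS
      rw [← ofReal_norm]
      gcongr
      exact hx hxS
    refine (this.trans_lt ?_).ne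
    rw [setLIntegral_const]
    exact ENNReal.mul_lt_top (ENNReal.rpow_lt_top_of_nonneg hp0.le ENNReal.ofReal_ne_top)
      hSvol.lt_top
  have hinner : ∀ x, inner ℂ (S.indicator f x) (g x)
      = ((S.indicator (fun x => ‖F x‖ ^ p) x : ℝ) : ℂ) := fun x => by
    by_cases hx : x ∈ S
    · rw [hg, Set.indicator_of_mem hx, Set.indicator_of_mem hx, Set.indicator_of_mem hx,
        ← inner_apply_comm (hW.selfAdjoint x), hG]
      simp only
      have h1 : inner ℂ (F x) (F x) = ((‖F x‖ ^ 2 : ℝ) : ℂ) := by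
        rw [inner_self_eq_norm_sq_to_K, Complex.ofReal_pow]; rfl
      rw [inner_smul_right, h1, ← Complex.ofReal_mul]
      congr 1
      by_cases h0 : ‖F x‖ = 0
      · rw [h0, Real.zero_rpow hp0.ne']; simp
      · rw [← Real.rpow_add_natCast h0]; congr 1; push_cast; ring
    · rw [Set.indicator_of_notMem hx, Set.indicator_of_notMem hx, inner_zero_left,
        Complex.ofReal_zero]
  have hTeq : ‖∫ x, inner ℂ (S.indicator f x) (g x)‖ₑ = T := by
    simp_rw [hinner]
    have h0 : 0 ≤ ∫ x, S.indicator (fun x => ‖F x‖ ^ p) x :=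
      integral_nonneg fun x => Set.indicator_nonneg (fun _ _ => by positivity) _
    rw [integral_complex_ofReal, ← ofReal_norm, Complex.norm_real, Real.norm_of_nonneg h0,
      integral_indicator hS, ofReal_integral_eq_lintegral_ofReal, hT]
    · refine lintegral_congr fun x => ?_
      rw [← ofReal_norm, ENNReal.ofReal_rpow_of_nonneg (norm_nonneg _) hp0.le]
    · refine Measure.integrableOn_of_bounded (M := (m * m) ^ p) hSvol
        ((hFm.norm.aemeasurable.pow_const _).aestronglyMeasurable) ((ae_restrict_iff' hS).2 ?_)
      filter_upwards [hFS] with x hx hxS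
      rw [Real.norm_of_nonneg (by positivity)]
      exact Real.rpow_le_rpow (norm_nonneg _) (hx hxS) hp0.le
    · exact Filter.Eventually.of_forall fun x => by positivity
  have hdual : ∫⁻ x, ‖R' x (g x)‖ₑ ^ s = T := by
    rw [hT, ← lintegral_indicator hS]
    refine lintegral_congr_ae ?_
    filter_upwards [hW.left_inv_ae] with x hx
    by_cases hxS : x ∈ S
    · rw [hg, Set.indicator_of_mem hxS, Set.indicator_of_mem hxS, hx, ← ofReal_norm, hGnorm,
        ← ENNReal.ofReal_rpow_of_nonneg (norm_nonneg _) hp1.le, ofReal_norm, ← ENNReal.rpow_mul]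
      congr 1; rw [hs]; field_simp
    · rw [hg, Set.indicator_of_notMem hxS, Set.indicator_of_notMem hxS, map_zero, enorm_zero,
        ENNReal.zero_rpow_of_pos (by linarith)]
  have hup := h𝒟.lintegral_tsum_haarEnergy_le hd hL hs1 (fun I => hgi.integrableOn) hgm
  rw [hdual] at hup
  refine le_of_le_rpow_mul_rpow hp hTtop ?_
  calc T ≤ ∫⁻ x, ∑' I : 𝒟, haarEnergy (fun y => B I (S.indicator f y)) I ^ (1 / 2 : ℝ)
          * haarEnergy (fun y => B' I (g y)) I ^ (1 / 2 : ℝ)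
          * (I : Cube d).toSet.indicator 1 x := by
        rw [← hTeq]
        exact h𝒟.enorm_integral_inner_le hd hfi hgi hgM
          (fun I => haarEnergy (fun y => B I (S.indicator f y)) I ^ (1 / 2 : ℝ)
            * haarEnergy (fun y => B' I (g y)) I ^ (1 / 2 : ℝ))
          fun I _ => enorm_sum_inner_haarCoeff_le hfi.integrableOn hgi.integrableOn
            (hB.selfAdjoint I) (hB.right_inv I)
    _ ≤ ∫⁻ x, energySum 𝒟 B (S.indicator f) x ^ (1 / 2 : ℝ)
          * energySum 𝒟 B' g x ^ (1 / 2 : ℝ) :=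
        lintegral_mono fun x => tsum_haarEnergy_le 𝒟 B B' _ g x
    _ ≤ (∫⁻ x, (energySum 𝒟 B (S.indicator f) x ^ (1 / 2 : ℝ)) ^ p) ^ (1 / p)
          * (∫⁻ x, (energySum 𝒟 B' g x ^ (1 / 2 : ℝ)) ^ s) ^ (1 / s) :=
        ENNReal.lintegral_mul_le_Lp_mul_Lq _ hconj
          ((h𝒟.measurable_energySum B _).pow_const _).aemeasurable
          ((h𝒟.measurable_energySum B' g).pow_const _).aemeasurable
    _ ≤ _ := by
        simp_rw [← ENNReal.rpow_mul, one_div_mul_eq_div]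
        gcongr
        exact hup

/-- The square function controls the weighted norm. -/
theorem lintegral_le_energySum (hB : ReducingFamily p K 𝒟 R B B') (hp : 1 < p)
    (hW : WeightFactors p X R R') (h𝒟 : IsDyadicGrid 𝒟) (hd : 0 < d) {C₁ α β γ C₁' α' β' γ' : ℝ≥0}
    (hL' : LocalBounds 𝒟 p C₁' α' β' γ' B B' R R')
    (hL : LocalBounds 𝒟 (p / (p - 1)) C₁ α β γ B' B R' R) {f : (Fin d → ℝ) → 𝔼 n}
    (hfm : AEStronglyMeasurable f volume) (hf : ∫⁻ x, ‖R x (f x)‖ₑ ^ p ≠ ∞) :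
    ∫⁻ x, ‖R x (f x)‖ₑ ^ p
      ≤ (localConst d (p / (p - 1)) C₁ * (α * β * γ) ^ (p / (p - 1))) ^ (p - 1) * 4 ^ p
        * ∫⁻ x, energySum 𝒟 B f x ^ (p / 2) := by
  have hp0 : 0 < p := by linarith
  have hp1 : 0 < p - 1 := by linarith
  have hp' : 0 < p / (p - 1) := by positivity
  have hs1 : 1 < p / (p - 1) := by rw [lt_div_iff₀ hp1]; linarith
  set c : ℝ≥0∞ := (localConst d (p / (p - 1)) C₁ * (α * β * γ) ^ (p / (p - 1))) ^ (p - 1) with hc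
  have hctop : c ≠ ∞ := by
    refine ENNReal.rpow_ne_top_of_nonneg hp1.le (ENNReal.mul_ne_top (localConst_ne_top d hs1 C₁) ?_)
    exact ENNReal.rpow_ne_top_of_nonneg hp'.le (by finiteness)
  set c' : ℝ≥0∞ := localConst d p C₁' * (α' * β' * γ') ^ p with hc'
  have hctop' : c' ≠ ∞ := ENNReal.mul_ne_top (localConst_ne_top d hp C₁')
    (ENNReal.rpow_ne_top_of_nonneg hp0.le (by finiteness))
  set U : ℝ≥0∞ := ∫⁻ x, energySum 𝒟 B f x ^ (p / 2) with hU
  set φ : (Fin d → ℝ) → ℝ≥0∞ := fun x => ‖R x (f x)‖ₑ ^ p with hφ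
  have hφm : AEMeasurable φ volume :=
    (ContinuousLinearMap.aestronglyMeasurable_comp₂
      (ContinuousLinearMap.id ℂ (𝔼 n →L[ℂ] 𝔼 n)) hW.meas hfm).enorm.pow_const _
  have hfI := hW.integrableOn hp hfm hf
  -- an exhaustion by sets on which `f` and the weight are bounded
  set S : ℕ → Set (Fin d → ℝ) := fun N =>
    {x | ‖x‖ ≤ N} ∩ ({x | ‖hW.meas.mk R x‖ ≤ N} ∩ {x | ‖hfm.mk f x‖ ≤ N}) with hS
  have hSm : ∀ N, MeasurableSet (S N) := fun N =>
    (measurableSet_le measurable_norm measurable_const).inter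
      ((measurableSet_le hW.meas.stronglyMeasurable_mk.norm.measurable measurable_const).inter
        (measurableSet_le hfm.stronglyMeasurable_mk.norm.measurable measurable_const))
  have hSmem : ∀ x, ∀ᶠ N in Filter.atTop, x ∈ S N := fun x => by
    filter_upwards [Filter.eventually_ge_atTop (⌈‖x‖⌉₊ + ⌈‖hW.meas.mk R x‖⌉₊ + ⌈‖hfm.mk f x‖⌉₊)]
      with N hN
    have h : ∀ {r : ℝ}, ⌈r⌉₊ ≤ N → r ≤ N := fun h => Nat.ceil_le.1 h
    refine ⟨h (r := ‖x‖) ?_, h (r := ‖hW.meas.mk R x‖) ?_, h (r := ‖hfm.mk f x‖) ?_⟩ <;> omega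
  have hbound : ∀ N, ∫⁻ x, φ x ≤ c * (4 ^ p * (U + c' * ∫⁻ x, (S N)ᶜ.indicator φ x))
      + ∫⁻ x, (S N)ᶜ.indicator φ x := fun N => by
    have hSvol : volume (S N) ≠ ∞ := by
      have : S N ⊆ Metric.closedBall 0 N := fun x hx => mem_closedBall_zero_iff.2 hx.1
      exact ((measure_mono this).trans_lt measure_closedBall_lt_top).ne
    have h1 := hB.setLIntegral_le_energySum hp hW h𝒟 hd hL hfm (hSm N) hSvol N.cast_nonneg
      (by filter_upwards [hW.meas.ae_eq_mk] with x hx hxS; rw [hx]; exact hxS.2.1)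
      (by filter_upwards [hfm.ae_eq_mk] with x hx hxS; rw [hx]; exact hxS.2.2)
    rw [lintegral_indicator (hSm N).compl, ← lintegral_add_compl φ (hSm N)]
    gcongr
    refine h1.trans ?_
    gcongr
    have hind : ∀ I : Cube d, IntegrableOn ((S N)ᶜ.indicator f) I.toSet := fun I =>
      (hfI I).indicator (hSm N).compl
    have hh : ∫⁻ x, energySum 𝒟 B ((S N)ᶜ.indicator f) x ^ (p / 2)
        ≤ c' * ∫⁻ x in (S N)ᶜ, φ x := by
      refine (h𝒟.lintegral_tsum_haarEnergy_le hd hL' hp hind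
        (hfm.indicator (hSm N).compl)).trans (le_of_eq ?_)
      rw [← lintegral_indicator (hSm N).compl]
      congr 2
      ext1 x
      by_cases hx : x ∈ (S N)ᶜ
      · rw [Set.indicator_of_mem hx, Set.indicator_of_mem hx]
      · rw [Set.indicator_of_notMem hx, Set.indicator_of_notMem hx, map_zero, enorm_zero,
          ENNReal.zero_rpow_of_pos hp0]
    have hsub : (S N).indicator f = fun y => f y - (S N)ᶜ.indicator f y := by
      ext1 y
      rw [eq_sub_iff_add_eq, Set.indicator_self_add_compl_apply]
    have hpt : ∀ x, energySum 𝒟 B ((S N).indicator f) x ^ (p / 2)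
        ≤ 4 ^ p * (energySum 𝒟 B f x ^ (p / 2)
          + energySum 𝒟 B ((S N)ᶜ.indicator f) x ^ (p / 2)) := fun x => by
      have h2 := energySum_sub_le (𝒟 := 𝒟) B hfI hind x
      rw [← hsub] at h2
      set a := energySum 𝒟 B f x
      set b := energySum 𝒟 B ((S N)ᶜ.indicator f) x
      calc energySum 𝒟 B ((S N).indicator f) x ^ (p / 2) ≤ (4 ^ (2 : ℝ) * max a b) ^ (p / 2) := by
            gcongr
            refine h2.trans ?_
            calc 2 * (a + b) ≤ 2 * (max a b + max a b) := by
                  gcongr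
                  · exact le_max_left _ _
                  · exact le_max_right _ _
              _ = 4 * max a b := by ring
              _ ≤ 4 ^ (2 : ℝ) * max a b := by
                  gcongr
                  rw [ENNReal.rpow_two]; norm_num
        _ = 4 ^ p * max (a ^ (p / 2)) (b ^ (p / 2)) := by
            rw [ENNReal.mul_rpow_of_nonneg _ _ (by positivity), ← ENNReal.rpow_mul,
              mul_div_cancel₀ _ (two_ne_zero), (ENNReal.monotone_rpow_of_nonneg
              (by positivity : 0 ≤ p / 2)).map_max]
        _ ≤ _ := by
            gcongr
            exact max_le le_self_add le_add_self
    refine (lintegral_mono hpt).trans ?_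
    rw [lintegral_const_mul' _ _ (ENNReal.rpow_ne_top_of_nonneg hp0.le (by norm_num)),
      lintegral_add_left ((h𝒟.measurable_energySum B f).pow_const _)]
    gcongr
  have hlim0 : Filter.Tendsto (fun N => ∫⁻ x, (S N)ᶜ.indicator φ x) Filter.atTop (nhds 0) := by
    rw [← lintegral_zero (μ := (volume : Measure (Fin d → ℝ)))]
    refine tendsto_lintegral_of_dominated_convergence' φ (fun N => hφm.indicator (hSm N).compl)
      (fun N => Filter.Eventually.of_forall fun x => Set.indicator_le_self _ _ _) hf
      (Filter.Eventually.of_forall fun x => ?_)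
    refine tendsto_const_nhds.congr' ?_
    filter_upwards [hSmem x] with N hN
    rw [Set.indicator_of_notMem (by simpa using hN)]
  have hlim := (ENNReal.Tendsto.const_mul (ENNReal.Tendsto.const_mul
    (tendsto_const_nhds.add (ENNReal.Tendsto.const_mul hlim0 (Or.inr hctop')) :
      Filter.Tendsto _ _ (nhds (U + c' * 0)))
    (Or.inr (ENNReal.rpow_ne_top_of_nonneg hp0.le (by norm_num) : (4 : ℝ≥0∞) ^ p ≠ ∞)))
    (Or.inr hctop)).add hlim0
  have := ge_of_tendsto' hlim hbound
  rwa [mul_zero, add_zero, add_zero, ← mul_assoc] at this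

end ReducingFamily

/-! ### The estimates with powers of the characteristic -/

section Constants

variable {d n : ℕ} {p : ℝ} {X K : ℝ≥0} {R R' : (Fin d → ℝ) → 𝔼 n →L[ℂ] 𝔼 n} {𝒟 : Set (Cube d)}
  {B B' : Cube d → 𝔼 n →L[ℂ] 𝔼 n}

/-- Since the characteristic is bounded below, its powers may be raised. -/
lemma rpow_div_le_mul_rpow_div {a X : ℝ≥0} {u v : ℝ} (h : 1 ≤ a * X ^ (1 / p)) (huv : u ≤ v) :
    X ^ (u / p) ≤ a ^ (v - u) * X ^ (v / p) := by
  have hX : X ^ (1 / p) ≠ 0 := by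
    intro h0
    rw [h0, mul_zero] at h
    exact absurd h (by norm_num)
  have e : ∀ w : ℝ, X ^ (w / p) = (X ^ (1 / p)) ^ w := fun w => by
    rw [← NNReal.rpow_mul]; congr 1; ring
  rw [e u, e v]
  calc (X ^ (1 / p)) ^ u ≤ (a * X ^ (1 / p)) ^ (v - u) * (X ^ (1 / p)) ^ u :=
        le_mul_of_one_le_left' (NNReal.one_le_rpow h (by linarith))
    _ = a ^ (v - u) * (X ^ (1 / p)) ^ v := by
        rw [NNReal.mul_rpow, mul_assoc, ← NNReal.rpow_add hX]; congr 2; ring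

/-- The constant in the upper bound for the square function. -/
noncomputable def upperConst (d n : ℕ) (p : ℝ) (K : ℝ≥0) : ℝ≥0 :=
  (localConst d p (K ^ p)).toNNReal ^ (1 / p) *
    ((1 + n * K) * (n * K) * (2 * n ^ 2 * K ^ 2) ^ (p / (p - 1)) *
      (n * K ^ 2) ^ (2 + (⌈p / (p - 1)⌉ : ℝ) - (1 + p / (p - 1))))

/-- The constant in the lower bound for the square function. -/
noncomputable def lowerConst (d n : ℕ) (p : ℝ) (K : ℝ≥0) : ℝ≥0 :=
  (localConst d (p / (p - 1)) (K ^ (p / (p - 1)))).toNNReal ^ ((p - 1) / p) * 4 *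
    ((1 + K) * n * K * (n * K) * (2 ^ p + (n * K ^ 2) ^ p) *
      (n * K ^ 2) ^ (1 + (⌈p⌉ : ℝ) - (1 + p)))

namespace ReducingFamily

lemma one_le_mul_rpow_nnreal (hB : ReducingFamily p K 𝒟 R B B') (hp : 1 < p)
    (hW : WeightFactors p X R R') (h𝒟 : IsDyadicGrid 𝒟) (hn : n ≠ 0) :
    1 ≤ n * K ^ 2 * X ^ (1 / p) := by
  have hne : 𝒟.Nonempty := let ⟨I, hI, _⟩ := h𝒟.partition 0 0; ⟨I, hI.1⟩
  have := hB.one_le_mul_rpow hp hW hne hn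
  rw [← ENNReal.coe_rpow_of_nonneg _ (by positivity)] at this
  exact_mod_cast this

theorem energySum_le (hB : ReducingFamily p K 𝒟 R B B') (hp : 1 < p)
    (hW : WeightFactors p X R R') (h𝒟 : IsDyadicGrid 𝒟) (hd : 0 < d) (hn : n ≠ 0)
    {f : (Fin d → ℝ) → 𝔼 n} (hfm : AEStronglyMeasurable f volume)
    (hf : ∫⁻ x, ‖R x (f x)‖ₑ ^ p ≠ ∞) :
    (∫⁻ x, energySum 𝒟 B f x ^ (p / 2)) ^ (1 / p)
      ≤ upperConst d n p K * (X : ℝ≥0∞) ^ (2 / p + (⌈p / (p - 1)⌉ : ℝ) / p)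
        * (∫⁻ x, ‖R x (f x)‖ₑ ^ p) ^ (1 / p) := by
  have hp0 : 0 < p := by linarith
  have hp1 : 0 < p - 1 := by linarith
  have hp' : 0 < p / (p - 1) := by positivity
  have hM := hB.one_le_mul_rpow_nnreal hp hW h𝒟 hn
  have hceil : p / (p - 1) ≤ ⌈p / (p - 1)⌉ := Int.le_ceil _
  have hprod : (1 + n * K) * (n * K * X ^ (1 / p))
      * (2 * n ^ 2 * K ^ 2 * X ^ (1 / p)) ^ (p / (p - 1))
      ≤ (1 + n * K) * (n * K) * (2 * n ^ 2 * K ^ 2) ^ (p / (p - 1)) *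
        (n * K ^ 2) ^ (2 + (⌈p / (p - 1)⌉ : ℝ) - (1 + p / (p - 1))) *
        X ^ (2 / p + (⌈p / (p - 1)⌉ : ℝ) / p) := by
    have h1 := rpow_div_le_mul_rpow_div (u := 1 + p / (p - 1)) (v := 2 + ⌈p / (p - 1)⌉) hM
      (by linarith)
    rw [add_div 2] at h1
    calc _ = (1 + n * K) * (n * K) * (2 * n ^ 2 * K ^ 2) ^ (p / (p - 1))
            * X ^ ((1 + p / (p - 1)) / p) := by
          rw [add_div, NNReal.rpow_add_of_nonneg _ (by positivity) (by positivity),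
            NNReal.mul_rpow, ← NNReal.rpow_mul, one_div_mul_eq_div]
          ring
      _ ≤ _ := by rw [mul_assoc _ _ (X ^ (2 / p + _))]; gcongr
  have h := ENNReal.rpow_le_rpow (h𝒟.lintegral_tsum_haarEnergy_le hd
    (hB.localBounds hp hW h𝒟 hd hn) hp (hW.integrableOn hp hfm hf) hfm)
    (by positivity : 0 ≤ 1 / p)
  rw [ENNReal.mul_rpow_of_nonneg _ _ (by positivity), ENNReal.mul_rpow_of_nonneg _ _
    (by positivity), ← ENNReal.rpow_mul, mul_one_div_cancel hp0.ne', ENNReal.rpow_one] at h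
  refine h.trans (mul_le_mul_left ?_ _)
  have hX : (X : ℝ≥0∞) ^ (2 / p + (⌈p / (p - 1)⌉ : ℝ) / p)
      = ((X ^ (2 / p + (⌈p / (p - 1)⌉ : ℝ) / p) : ℝ≥0) : ℝ≥0∞) :=
    (ENNReal.coe_rpow_of_nonneg _ (by positivity)).symm
  rw [← ENNReal.coe_toNNReal (localConst_ne_top d hp (K ^ p)),
    ← ENNReal.coe_rpow_of_nonneg _ (by positivity), hX, ← ENNReal.coe_mul, ← ENNReal.coe_mul,
    ← ENNReal.coe_mul, ← ENNReal.coe_mul, ENNReal.coe_le_coe, upperConst]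
  exact (mul_le_mul_right hprod _).trans (le_of_eq (by ring))

theorem le_energySum (hB : ReducingFamily p K 𝒟 R B B') (hp : 1 < p)
    (hW : WeightFactors p X R R') (h𝒟 : IsDyadicGrid 𝒟) (hd : 0 < d) (hn : n ≠ 0)
    {f : (Fin d → ℝ) → 𝔼 n} (hfm : AEStronglyMeasurable f volume)
    (hf : ∫⁻ x, ‖R x (f x)‖ₑ ^ p ≠ ∞) :
    (∫⁻ x, ‖R x (f x)‖ₑ ^ p) ^ (1 / p)
      ≤ lowerConst d n p K * (X : ℝ≥0∞) ^ (1 / p + (⌈p⌉ : ℝ) / p)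
        * (∫⁻ x, energySum 𝒟 B f x ^ (p / 2)) ^ (1 / p) := by
  have hp0 : 0 < p := by linarith
  have hp1 : 0 < p - 1 := by linarith
  have hs1 : 1 < p / (p - 1) := by rw [lt_div_iff₀ hp1]; linarith
  have hM := hB.one_le_mul_rpow_nnreal hp hW h𝒟 hn
  have hceil : p ≤ ⌈p⌉ := Int.le_ceil _
  have hprod : (1 + K) * n * K * X ^ (1 / p) * (n * K) * ((2 ^ p + (n * K ^ 2) ^ p) * X)
      ≤ (1 + K) * n * K * (n * K) * (2 ^ p + (n * K ^ 2) ^ p) *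
        (n * K ^ 2) ^ (1 + (⌈p⌉ : ℝ) - (1 + p)) * X ^ (1 / p + (⌈p⌉ : ℝ) / p) := by
    have h1 := rpow_div_le_mul_rpow_div (u := 1 + p) (v := 1 + ⌈p⌉) hM (by linarith)
    rw [add_div 1 (⌈p⌉ : ℝ)] at h1
    calc _ = (1 + K) * n * K * (n * K) * (2 ^ p + (n * K ^ 2) ^ p) * X ^ ((1 + p) / p) := by
          rw [add_div, NNReal.rpow_add_of_nonneg _ (by positivity) (by positivity),
            div_self hp0.ne', NNReal.rpow_one]
          ring
      _ ≤ _ := by rw [mul_assoc _ _ (X ^ (1 / p + _))]; gcongr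
  have h := ENNReal.rpow_le_rpow (hB.lintegral_le_energySum hp hW h𝒟 hd
    (hB.localBounds hp hW h𝒟 hd hn) (hB.localBounds_dual hp hW h𝒟 hd hn) hfm hf)
    (by positivity : 0 ≤ 1 / p)
  have h0 : 0 ≤ 1 / p := by positivity
  rw [ENNReal.mul_rpow_of_nonneg _ _ h0, ENNReal.mul_rpow_of_nonneg _ _ h0,
    ENNReal.mul_rpow_of_nonneg _ _ hp1.le, ENNReal.mul_rpow_of_nonneg _ _ h0, ← ENNReal.rpow_mul,
    ← ENNReal.rpow_mul, ← ENNReal.rpow_mul, ← ENNReal.rpow_mul, mul_one_div_cancel hp0.ne',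
    show p / (p - 1) * ((p - 1) * (1 / p)) = 1 by field_simp, mul_one_div, ENNReal.rpow_one,
    ENNReal.rpow_one] at h
  refine h.trans (mul_le_mul_left ?_ _)
  have hX : (X : ℝ≥0∞) ^ (1 / p + (⌈p⌉ : ℝ) / p)
      = ((X ^ (1 / p + (⌈p⌉ : ℝ) / p) : ℝ≥0) : ℝ≥0∞) :=
    (ENNReal.coe_rpow_of_nonneg _ (by positivity)).symm
  rw [← ENNReal.coe_toNNReal (localConst_ne_top d hs1 (K ^ (p / (p - 1)))),
    ← ENNReal.coe_rpow_of_nonneg _ (by positivity), hX, ← ENNReal.coe_mul, ← ENNReal.coe_mul,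
    ← ENNReal.coe_mul, ← ENNReal.coe_mul, show (4 : ℝ≥0∞) = ((4 : ℝ≥0) : ℝ≥0∞) by norm_num,
    ← ENNReal.coe_mul, ENNReal.coe_le_coe, lowerConst]
  calc _ = (localConst d (p / (p - 1)) (K ^ (p / (p - 1)))).toNNReal ^ ((p - 1) / p) * 4
          * ((1 + K) * n * K * X ^ (1 / p) * (n * K) * ((2 ^ p + (n * K ^ 2) ^ p) * X)) := by ring
    _ ≤ _ := (mul_le_mul_right hprod _).trans (le_of_eq (by ring))

end ReducingFamily

end Constants

/-! ### Matrix weights -/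

section Matrix

variable {d n : ℕ} {p : ℝ} {K : ℝ≥0} {W : (Fin d → ℝ) → Matrix (Fin n) (Fin n) ℂ}
  {𝒟 : Set (Cube d)} {V : Cube d → Matrix (Fin n) (Fin n) ℂ}

lemma IsMatrixApWeight.weightFactors (hW : IsMatrixApWeight p W) (hp : 1 < p) :
    WeightFactors p (apChar p W).toNNReal (fun x => act (matPow (W x) (1 / p)))
      (fun x => act (matPow (W x) (-(1 / p)))) := by
  have hp0 : 0 < p := by linarith
  have hp1 : 0 < p - 1 := by linarith
  refine
    { meas := aestronglyMeasurable_act_matPow hW.aemeasurable hW.posDef _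
      meas' := aestronglyMeasurable_act_matPow hW.aemeasurable hW.posDef _
      selfAdjoint := fun x => isSelfAdjoint_act (isSelfAdjoint_matPow _ _)
      selfAdjoint' := fun x => isSelfAdjoint_act (isSelfAdjoint_matPow _ _)
      left_inv_ae := ?_
      right_inv_ae := ?_
      ap := fun I => ?_ }
  · filter_upwards [hW.posDef] with x hx v
    have := matPow_mul_matPow_neg hx (-(1 / p))
    rw [neg_neg] at this
    rw [← ContinuousLinearMap.comp_apply, ← act_mul, this, act_one, ContinuousLinearMap.id_apply]
  · filter_upwards [hW.posDef] with x hx v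
    rw [← ContinuousLinearMap.comp_apply, ← act_mul, matPow_mul_matPow_neg hx, act_one,
      ContinuousLinearMap.id_apply]
  · have h1 : ⨍⁻ x in I.toSet, (⨍⁻ t in I.toSet,
        ‖act (matPow (W x) (1 / p) * matPow (W t) (-(1 / p)))‖ₑ ^ p.conjExponent ∂volume)
          ^ (p / p.conjExponent) ∂volume ≤ apChar p W :=
      le_iSup (fun I : Cube d => ⨍⁻ x in I.toSet, (⨍⁻ t in I.toSet,
        ‖act (matPow (W x) (1 / p) * matPow (W t) (-(1 / p)))‖ₑ ^ p.conjExponent ∂volume)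
          ^ (p / p.conjExponent) ∂volume) I
    set m := volume I.toSet with hm
    have hm0 : m ≠ 0 := I.volume_toSet_ne_zero
    have hmtop : m ≠ ∞ := I.volume_toSet_ne_top
    have e : p / p.conjExponent = p - 1 := by rw [Real.conjExponent]; field_simp
    have hmp : m ^ (p - 1) * m = m ^ p := by
      nth_rewrite 2 [← ENNReal.rpow_one m]
      rw [← ENNReal.rpow_add _ _ hm0 hmtop]; congr 1; ring
    simp_rw [setLAverage_eq, e, act_mul, ENNReal.div_rpow_of_nonneg _ _ hp1.le] at h1
    rw [ENNReal.div_le_iff hm0 hmtop] at h1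
    rw [ENNReal.coe_toNNReal hW.apChar_lt_top.ne, ← hmp]
    have hmp0 : m ^ (p - 1) ≠ 0 := (ENNReal.rpow_pos (pos_iff_ne_zero.2 hm0) hmtop).ne'
    have hmptop : m ^ (p - 1) ≠ ∞ := ENNReal.rpow_ne_top_of_nonneg hp1.le hmtop
    simp_rw [ENNReal.div_eq_inv_mul] at h1
    rw [lintegral_const_mul' _ _ (ENNReal.inv_ne_top.2 hmp0), ← ENNReal.div_eq_inv_mul,
      ENNReal.div_le_iff hmp0 hmptop] at h1
    refine h1.trans (le_of_eq ?_)
    ring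

open Classical in
/-- The reducing matrices as operators, completed by the identity off the grid. -/
lemma exists_reducingFamily (hp : 1 < p) (hV : ∀ I ∈ 𝒟, IsReducing K p W I (V I)) :
    ∃ B B' : Cube d → 𝔼 n →L[ℂ] 𝔼 n,
      ReducingFamily p K 𝒟 (fun x => act (matPow (W x) (1 / p))) B B' ∧
        ∀ I ∈ 𝒟, B I = act (V I) := by
  have hp0 : 0 < p := by linarith
  have hunit : ∀ I ∈ 𝒟, IsUnit (V I).det := fun I hI =>
    (Matrix.isUnit_iff_isUnit_det _).1 (hV I hI).1.isUnit
  have hid : ∀ v : 𝔼 n, act (1 : Matrix (Fin n) (Fin n) ℂ) v = v := fun v => by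
    rw [act_one, ContinuousLinearMap.id_apply]
  refine ⟨fun I => if I ∈ 𝒟 then act (V I) else act 1,
    fun I => if I ∈ 𝒟 then act (V I)⁻¹ else act 1, ?_, fun I hI => if_pos hI⟩
  refine
    { selfAdjoint := fun I => ?_
      selfAdjoint' := fun I => ?_
      left_inv := fun I v => ?_
      right_inv := fun I v => ?_
      lower := fun I hI e => ?_
      upper := fun I hI e => ?_ }
  · split_ifs with hI
    · exact isSelfAdjoint_act (hV I hI).1.isHermitian
    · exact isSelfAdjoint_act (IsSelfAdjoint.one _)
  · split_ifs with hI
    · exact isSelfAdjoint_act (hV I hI).1.isHermitian.inv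
    · exact isSelfAdjoint_act (IsSelfAdjoint.one _)
  · by_cases hI : I ∈ 𝒟
    · rw [if_pos hI, if_pos hI, ← ContinuousLinearMap.comp_apply, ← act_mul,
        Matrix.nonsing_inv_mul _ (hunit I hI), hid]
    · rw [if_neg hI, if_neg hI, hid, hid]
  · by_cases hI : I ∈ 𝒟
    · rw [if_pos hI, if_pos hI, ← ContinuousLinearMap.comp_apply, ← act_mul,
        Matrix.mul_nonsing_inv _ (hunit I hI), hid]
    · rw [if_neg hI, if_neg hI, hid, hid]
  · have h := ENNReal.rpow_le_rpow ((hV I hI).2 e).1 hp0.le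
    rw [ENNReal.mul_rpow_of_nonneg _ _ hp0.le, ← ENNReal.rpow_mul, one_div_mul_cancel hp0.ne',
      ENNReal.rpow_one, setLAverage_eq, ← mul_div_assoc, ENNReal.le_div_iff_mul_le
      (Or.inl I.volume_toSet_ne_zero) (Or.inl I.volume_toSet_ne_top)] at h
    rwa [if_pos hI]
  · have h := ENNReal.rpow_le_rpow ((hV I hI).2 e).2 hp0.le
    rw [ENNReal.mul_rpow_of_nonneg _ _ hp0.le, ← ENNReal.rpow_mul, one_div_mul_cancel hp0.ne',
      ENNReal.rpow_one, setLAverage_eq, ENNReal.div_le_iff I.volume_toSet_ne_zero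
      I.volume_toSet_ne_top, mul_assoc] at h
    rwa [if_pos hI]

lemma squareFunction_eq_energySum {B : Cube d → 𝔼 n →L[ℂ] 𝔼 n} (hB : ∀ I ∈ 𝒟, B I = act (V I))
    {f : (Fin d → ℝ) → 𝔼 n} (hf : ∀ I : Cube d, IntegrableOn f I.toSet) (x : Fin d → ℝ) :
    squareFunction 𝒟 V f x = energySum 𝒟 B f x ^ (1 / 2 : ℝ) := by
  rw [squareFunction, energySum]
  congr 1
  refine tsum_congr fun I => ?_
  simp_rw [haarEnergy, haarCoeff_clm_comp (hf I), hB I I.2, div_eq_mul_inv]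
  rw [Finset.sum_mul, Finset.sum_mul]

lemma eLpNorm_squareFunction_eq (hp : 0 < p) {B : Cube d → 𝔼 n →L[ℂ] 𝔼 n}
    (hB : ∀ I ∈ 𝒟, B I = act (V I)) {f : (Fin d → ℝ) → 𝔼 n}
    (hf : ∀ I : Cube d, IntegrableOn f I.toSet) :
    eLpNorm (squareFunction 𝒟 V f) (ENNReal.ofReal p) volume
      = (∫⁻ x, energySum 𝒟 B f x ^ (p / 2)) ^ (1 / p) := by
  rw [eLpNorm_eq_lintegral_rpow_enorm_toReal (by simpa using hp) ENNReal.ofReal_ne_top,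
    ENNReal.toReal_ofReal hp.le]
  simp_rw [enorm_eq_self, squareFunction_eq_energySum hB hf, ← ENNReal.rpow_mul,
    one_div_mul_eq_div]

lemma weightedNorm_eq (hp : 0 < p) (f : (Fin d → ℝ) → 𝔼 n) :
    weightedNorm p W f = (∫⁻ x, ‖act (matPow (W x) (1 / p)) (f x)‖ₑ ^ p) ^ (1 / p) := by
  rw [weightedNorm, eLpNorm_eq_lintegral_rpow_enorm_toReal (by simpa using hp)
    ENNReal.ofReal_ne_top, ENNReal.toReal_ofReal hp.le]

lemma locallyIntegrable_of_forall_cube {f : (Fin d → ℝ) → 𝔼 n}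
    (hf : ∀ I : Cube d, IntegrableOn f I.toSet) : LocallyIntegrable f volume := by
  intro x
  let I : Cube d := ⟨fun i => x i - 1, 2, two_pos⟩
  refine ⟨I.toSet, Filter.mem_of_superset (Metric.ball_mem_nhds x one_pos) fun y hy i => ?_, hf I⟩
  have h := (dist_le_pi_dist y x i).trans_lt hy
  rw [Real.dist_eq, abs_lt] at h
  exact ⟨by change x i - 1 ≤ y i; linarith [h.1], by change y i < x i - 1 + 2; linarith [h.2]⟩

end Matrix

end MatrixWeighted

theorem mainTheorem1 (d n : ℕ) (hd : 0 < d) (p : ℝ) (hp : 1 < p) (K : ℝ≥0) :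
    ∃ C : ℝ≥0, ∀ W : (Fin d → ℝ) → Matrix (Fin n) (Fin n) ℂ, IsMatrixApWeight p W →
      ∀ 𝒟 : Set (Cube d), IsDyadicGrid 𝒟 →
      ∀ V : Cube d → Matrix (Fin n) (Fin n) ℂ, (∀ I ∈ 𝒟, IsReducing K p W I (V I)) →
      ∀ f : (Fin d → ℝ) → EuclideanSpace ℂ (Fin n), MemWeightedLp p W f →
        LocallyIntegrable f volume ∧
        weightedNorm p W f ≤
          C * apChar p W ^ (1 / p + (⌈p⌉ : ℝ) / p) *
            eLpNorm (squareFunction 𝒟 V f) (ENNReal.ofReal p) volume ∧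
        eLpNorm (squareFunction 𝒟 V f) (ENNReal.ofReal p) volume ≤
          C * apChar p W ^ (2 / p + (⌈p.conjExponent⌉ : ℝ) / p) * weightedNorm p W f := by
  have hp0 : 0 < p := by linarith
  rcases Nat.eq_zero_or_pos n with rfl | hn
  · -- the lower bound for the characteristic fails here, but all norms vanish
    refine ⟨0, fun W _ 𝒟 _ V _ f _ => ?_⟩
    obtain rfl : f = 0 := Subsingleton.elim _ _
    refine ⟨locallyIntegrable_zero, ?_, ?_⟩
    · simp [weightedNorm]
    · have : squareFunction 𝒟 V (0 : (Fin d → ℝ) → 𝔼 0) = 0 := by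
        ext1 x
        have h : ∀ I ε, act (V I) (haarCoeff (0 : (Fin d → ℝ) → 𝔼 0) I ε) = 0 := fun I ε =>
          Subsingleton.elim _ _
        simp [squareFunction, h]
      rw [this, eLpNorm_zero]
      exact zero_le
  · refine ⟨lowerConst d n p K + upperConst d n p K, fun W hW 𝒟 h𝒟 V hV f hf => ?_⟩
    obtain ⟨B, B', hB, hBV⟩ := exists_reducingFamily hp hV
    have hWF := hW.weightFactors hp
    have hfin : ∫⁻ x, ‖act (matPow (W x) (1 / p)) (f x)‖ₑ ^ p ≠ ∞ := by
      intro h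
      have := hf.2
      rw [weightedNorm_eq hp0, h, ENNReal.top_rpow_of_pos (by positivity)] at this
      exact lt_irrefl _ this
    have hfI := hWF.integrableOn hp hf.1 hfin
    have hlow := hB.le_energySum hp hWF h𝒟 hd hn.ne' hf.1 hfin
    have hup := hB.energySum_le hp hWF h𝒟 hd hn.ne' hf.1 hfin
    rw [ENNReal.coe_toNNReal hW.apChar_lt_top.ne, ← weightedNorm_eq hp0,
      ← eLpNorm_squareFunction_eq hp0 hBV hfI] at hlow hup
    refine ⟨locallyIntegrable_of_forall_cube hfI, hlow.trans ?_, hup.trans ?_⟩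
    · gcongr
      exact le_self_add
    · rw [Real.conjExponent]
      gcongr
      exact le_add_self
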